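/- **Setting.** Let $\mathcal K\subset[-1,1]^2$ be a simply connected compact set whose boundary is a Jordan curve of class $C^{1,\beta}$ for some $\beta>0$. For $\varepsilon,d>0$ put $N_{\varepsilon,d}=\left\lfloor\frac{1+d}{\varepsilon+d}\right\rfloor$ and $$\mathcal K_{i,j}^{\varepsilon,d}=z_{i,j}^{\varepsilon,d}+\tfrac{\varepsilon}{2}\mathcal K,\qquad z_{i,j}^{\varepsilon,d}=\big(\tfrac{\varepsilon}{2}+(i-1)(\varepsilon+d),\,(j-1)(\varepsilon+d)\big),$$ $$\Omega_1^{\varepsilon,d}=\mathbb R^2\setminus\bigcup_{i=1}^{N_{\varepsilon,d}}\mathcal K_{i,1}^{\varepsilon,d},\qquad \Omega_2^{\varepsilon,d}=\mathbb R^2\setminus\bigcup_{i=1}^{N_{\varepsilon,d}}\bigcup_{j=1}^{N_{\varepsilon,d}}\mathcal K_{i,j}^{\varepsilon,d},$$ $$\Omega_1=\mathbb R^2\setminus([0,1]\times\{0\}),\qquad \Omega_2=\mathbb R^2\setminus[0,1]^2 .$$ For an open set $\Omega\subset\mathbb R^2$ let $C_c^\infty(\overline\Omega)$ be the set of functions that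 are smooth in $\Omega$, have all derivatives bounded in $\Omega$, and vanish for large $x$; functions in $C_c^\infty(\overline{\Omega_1})$ may jump across the segment. A field $v\in L^2_{\rm loc}(\mathbb R^2)^2$ is called divergence free in $\Omega$ and tangent to $\partial\Omega$ if $\int_{\Omega}v\cdot\nabla\varphi\,dx=0$ for all $\varphi\in C_c^\infty(\mathbb R^2)$. For $\gamma\in(0,\infty]$, consider the condition (with $|s|^{1+\gamma}:=0$ for $|s|\le 1$ if $\gamma=\infty$) **(H2)** there are $\rho_0\in(0,1)$ and $\rho_1,\rho_2>0$ such that $[-(1-\rho_1|s|^{1+\gamma}),\,1-\rho_1|s|^{1+\gamma}]\times\{s\}\subset\mathcal K$ for all $|s|\le\rho_0$, and $\mathcal K\cap(\mathbb R\times\{s\})\subset[-(1-\rho_2|s|^{1+\gamma}),\,1-\rho_2|s|^{1+\gamma}]\times\{s\}$ for all $|s|\le1$. **Proposition (Non-penetration).** Let $(\varepsilon_n)$ and $(d_n)$ be sequences of positive numbers with $\varepsilon_n\to0$, and let $(v_n)$ be a bounded sequence in $L^2_{\rm loc}(\mathbb R^2)^2$. * *(Segment.)* Suppose that each $v_n$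 is divergence free in $\Omega_1^{\varepsilon_n,d_n}$ and tangent to its boundary, that $\mathcal K$ satisfies (H2) for some $\gamma\in(0,\infty]$, and that $d_n/\varepsilon_n^{\,2+1/\gamma}\to0$ (with $1/\infty=0$). Then for every $p\in C_c^\infty(\overline{\Omega_1})$, $$\int_{\Omega_1}v_n\cdot\nabla p\,dx\to0\qquad(n\to\infty).$$ * *(Square.)* Suppose that each $v_n$ is divergence free in $\Omega_2^{\varepsilon_n,d_n}$ and tangent to its boundary, that $(\pm1,0),(0,\pm1)\in\partial\mathcal K$, and that $d_n/\varepsilon_n\to0$. Then for every $p\in C_c^\infty(\overline{\Omega_2})$, $$\int_{\Omega_2}v_n\cdot\nabla p\,dx\to0\qquad(n\to\infty).$$ -/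

import Mathlib

open MeasureTheory Filter Topology Set
open scoped NNReal ENNReal ContDiff

noncomputable section

namespace PorousMedium

/-- The Euclidean plane; `x 0` and `x 1` are the horizontal and vertical coordinates. -/
abbrev Plane : Type := EuclideanSpace ℝ (Fin 2)

/-- `Γ` is a Jordan curve of class `C^{1,β}` for some `β ∈ (0,1]`: the image of a
closed simple regular parametrization whose derivative is `β`-Hölder. -/
def IsHolderJordanCurve (Γ : Set Plane) : Prop :=
  ∃ (β C : ℝ≥0) (c : ℝ → Plane), 0 < β ∧ β ≤ 1 ∧
    ContDiff ℝ 1 c ∧ Function.Periodic c 1 ∧ InjOn c (Ico 0 1) ∧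
    (∀ t, deriv c t ≠ 0) ∧ HolderWith C β (deriv c) ∧ range c = Γ

/-- The standing assumption on the shape of the inclusions: a simply connected compact subset
of `[-1,1]²` whose boundary is a Jordan curve of class `C^{1,β}`. -/
structure IsInclusionShape (K : Set Plane) : Prop where
  subset_square : ∀ x ∈ K, |x 0| ≤ 1 ∧ |x 1| ≤ 1
  isCompact : IsCompact K
  simplyConnected : SimplyConnectedSpace K
  jordan : IsHolderJordanCurve (frontier K)

/-- `|s|^{1+γ}` for `γ ∈ (0,∞]`, with `|s|^∞ = 0` (used for `|s| ≤ 1`). -/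
def absPow (γ : ℝ≥0∞) (s : ℝ) : ℝ :=
  if γ = ⊤ then 0 else |s| ^ (1 + γ.toReal)

/-- The lateral boundaries of `K` have tangency exponent `γ` at `(±1,0)`:
`[-(1-ρ₁|s|^{1+γ}), 1-ρ₁|s|^{1+γ}] × {s} ⊆ K` for `|s| ≤ ρ₀`, and
`K ∩ (ℝ × {s}) ⊆ [-(1-ρ₂|s|^{1+γ}), 1-ρ₂|s|^{1+γ}] × {s}` for `|s| ≤ 1`. -/
def HasTangencyExponent (K : Set Plane) (γ : ℝ≥0∞) : Prop :=
  0 < γ ∧ ∃ ρ₀ ρ₁ ρ₂ : ℝ, 0 < ρ₀ ∧ ρ₀ < 1 ∧ 0 < ρ₁ ∧ 0 < ρ₂ ∧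
    (∀ s : ℝ, |s| ≤ ρ₀ → ∀ x : ℝ, |x| ≤ 1 - ρ₁ * absPow γ s → !₂[x, s] ∈ K) ∧
    (∀ s : ℝ, |s| ≤ 1 → ∀ x : ℝ, !₂[x, s] ∈ K → |x| ≤ 1 - ρ₂ * absPow γ s)

/-- The number of inclusions of size `ε` at mutual distance `d` along the unit segment. -/
def numInclusions (ε d : ℝ) : ℕ := ⌊(1 + d) / (ε + d)⌋₊

/-- The centre `z_{i,j} = (ε/2 + (i-1)(ε+d), (j-1)(ε+d))`. -/
def centre (ε d : ℝ) (i j : ℕ) : Plane :=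
  !₂[ε / 2 + ((i : ℝ) - 1) * (ε + d), ((j : ℝ) - 1) * (ε + d)]

/-- The inclusion `z_{i,j} + (ε/2) K`. -/
def inclusion (K : Set Plane) (ε d : ℝ) (i j : ℕ) : Set Plane :=
  (fun k : Plane => centre ε d i j + (ε / 2) • k) '' K

/-- The fluid domain when the inclusions are distributed along the unit segment (`j = 1`). -/
def segmentFluidDomain (K : Set Plane) (ε d : ℝ) : Set Plane :=
  (⋃ i ∈ Finset.Icc 1 (numInclusions ε d), inclusion K ε d i 1)ᶜ

/-- The fluid domain when the inclusions are distributed over the unit square. -/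
def squareFluidDomain (K : Set Plane) (ε d : ℝ) : Set Plane :=
  (⋃ i ∈ Finset.Icc 1 (numInclusions ε d), ⋃ j ∈ Finset.Icc 1 (numInclusions ε d),
    inclusion K ε d i j)ᶜ

/-- The exterior of the unit segment, `ℝ² ∖ ([0,1] × {0})`. -/
def segmentExterior : Set Plane := {x | x 0 ∈ Icc (0 : ℝ) 1 ∧ x 1 = 0}ᶜ

/-- The exterior of the unit square, `ℝ² ∖ [0,1]²`. -/
def squareExterior : Set Plane := {x | x 0 ∈ Icc (0 : ℝ) 1 ∧ x 1 ∈ Icc (0 : ℝ) 1}ᶜ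

/-- Test functions on the open set `Ω` up to its boundary: smooth in `Ω`, with
all derivatives bounded in `Ω`, and zero for large `x`. Boundedness of the derivative of order
`k + 1` makes the one of order `k` uniformly continuous for the path distance of `Ω`, but not
across a slit: on `segmentExterior` these functions may jump across the segment. Values
outside `Ω` play no role. -/
structure IsTestFunction (Ω : Set Plane) (p : Plane → ℝ) : Prop where
  smooth : ContDiffOn ℝ ∞ p Ω
  bounded : ∀ k : ℕ, ∃ C : ℝ, ∀ x ∈ Ω, ‖iteratedFDeriv ℝ k p x‖ ≤ C
  zero_at_large : ∃ R : ℝ, ∀ x ∈ Ω, R < ‖x‖ → p x = 0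

/-- `v` is divergence free in `Ω` and tangent to `∂Ω`, in the weak sense (it is tested
with the restrictions to `Ω` of smooth compactly supported functions on the plane). -/
def IsDivFreeTangent (Ω : Set Plane) (v : Plane → Plane) : Prop :=
  ∀ φ : Plane → ℝ, ContDiff ℝ ∞ φ → HasCompactSupport φ →
    ∫ x in Ω, inner ℝ (v x) (gradient φ x) = 0

/-- The sequence `v` is bounded in `L²_loc(ℝ²)`. -/
def IsBoundedL2Loc (v : ℕ → Plane → Plane) : Prop :=
  (∀ n, AEStronglyMeasurable (v n) volume) ∧
    ∀ R : ℝ, ∃ C : ℝ≥0, ∀ n, eLpNorm (v n) 2 (volume.restrict (Metric.ball 0 R)) ≤ C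

end PorousMedium

end

noncomputable section

namespace PorousMedium

/-! ### Crossing of plane curves -/

section

open scoped unitInterval

/-! Smooth compactly supported functions on the whole plane pair to zero with `v n` in the fluid
domain. It is therefore enough to find such a function whose gradient, restricted to the fluid, is
close in a weighted sense to that of `p` restricted to the exterior: the `L²_loc` bound and
Cauchy–Schwarz do the rest (`abs_pairing_sub_le`). By `tendsto_pairing_of_dilations`, `p` may first
be replaced by its composition with a dilation of ratio `l > 1` about the centre of the obstacle.
This function is smooth off a strictly smaller obstacle, which leaves room for boundary layers of
size `ε`.

Segment: the competitor interpolates between the two traces in a strip of half-height `h = ε t / 2`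
(`exists_interpolation`). Its large gradient, of order `1 / h`, matters only in the fluid, that is
in about `1 / ε` gaps of width `d + ε ρ₁ t^(1+γ)` (`mem_gaps`). The energy is of order `(d + ε ρ₁
t^(1+γ)) / (ε² t)`, and the hypothesis on `d` is what allows a choice of `t` making it vanish
(`exists_layer_heights`).

Square: the dilated function extends to a smooth `P` on the plane. The competitor is `P ∘ (X, Y)` in
the square, where the staircases `X`, `Y` are within `O(ε)` of the coordinates and are flat in the
fluid except in thin rectangles where neighbouring inclusions almost touch
(`exists_square_competitor`). In units of a cell these have width of order `t` and height of order
`e t + d / ε`, and the gradient is of order `1 / t`. The energy is thus `O(e + d / (ε t))`, with `e`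
arbitrarily small.

The staircases rest on `exists_cell_function`, where topology enters. `K` with two vertical
half-lines separates left from right, by Poincaré–Miranda (`far_right_notMem_leftSide`). The two
sides touch only along the half-lines (`closure_sides_inter`), since near each boundary point `K` is
exactly one side of a `C¹` graph (`exists_local_graph`). Simple connectedness excludes that `K` be a
mere arc there (`not_graph_of_simplyConnected`). At the contact points, `K ⊆ [-1, 1]²` forces a
tangent line along the side of the square, so the opening is `o(t)` at distance `t`. -/

lemma mem_Ioo_of_avoids {f : I → ℝ} (hf : Continuous f) {a b : ℝ} (h0 : f 0 ∈ Ioo a b)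
    (ha : ∀ s, f s ≠ a) (hb : ∀ s, f s ≠ b) (s : I) : f s ∈ Ioo a b := by
  have hpre : IsPreconnected (range f) := isPreconnected_range hf
  have hoc := hpre.ordConnected
  constructor
  · by_contra h
    obtain ⟨u, hu⟩ := hoc.out ⟨s, rfl⟩ ⟨0, rfl⟩ ⟨not_lt.1 h, h0.1.le⟩
    exact ha u hu
  · by_contra h
    obtain ⟨u, hu⟩ := hoc.out ⟨0, rfl⟩ ⟨s, rfl⟩ ⟨h0.2.le, not_lt.1 h⟩
    exact hb u hu

/-- The two-dimensional Poincaré–Miranda theorem. -/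
theorem exists_zero_of_sides {F : I × I → ℂ} (hF : Continuous F)
    (hl : ∀ s, 0 < (F (s, 0)).re) (hr : ∀ s, (F (s, 1)).re < 0)
    (hb : ∀ t, (F (0, t)).im < 0) (ht : ∀ t, 0 < (F (1, t)).im) : ∃ x, F x = 0 := by
  by_contra! hne
  -- `F` is extended to the plane through the retraction onto the square; a logarithm is lifted
  -- there through `Complex.exp` and then restricted. Each side of the square confines the resulting
  -- argument `θ` to a half-turn.
  let π : ℝ × ℝ → I × I := fun x => (projIcc 0 1 zero_le_one x.1, projIcc 0 1 zero_le_one x.2)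
  have hπ : Continuous π := by
    have := continuous_projIcc (a := (0 : ℝ)) (b := 1) (h := zero_le_one)
    fun_prop
  obtain ⟨B, ⟨hB0, hB⟩, -⟩ := Complex.isCoveringMapOn_exp.existsUnique_continuousMap_lifts
    ⟨F ∘ π, hF.comp hπ⟩ (a₀ := ((0 : ℝ), (0 : ℝ))) (e₀ := Complex.log (F (0, 0)))
    (by
      have : π (0, 0) = (0, 0) := by simp [π]
      simp [Complex.exp_log (hne _), this]) (fun a => by simpa using hne (π a))
  let A : C(I × I, ℂ) := B.comp ⟨fun x => ((x.1 : ℝ), (x.2 : ℝ)), by fun_prop⟩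
  have hA0 : A (0, 0) = Complex.log (F (0, 0)) := by simpa [A] using hB0
  have hA : Complex.exp ∘ A = F := by
    funext x
    have := congrFun hB ((x.1 : ℝ), (x.2 : ℝ))
    simpa [A, π] using this
  set θ : I × I → ℝ := fun x => (A x).im with hθ
  have hθc : Continuous θ := Complex.continuous_im.comp A.continuous
  have hAF : ∀ x, F x = Complex.exp (A x) := fun x => (congrFun hA x).symm
  have hre : ∀ x, (F x).re = Real.exp (A x).re * Real.cos (θ x) := fun x => by
    rw [hAF, Complex.exp_re]
  have him : ∀ x, (F x).im = Real.exp (A x).re * Real.sin (θ x) := fun x => by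
    rw [hAF, Complex.exp_im]
  have cl : ∀ s, 0 < Real.cos (θ (s, 0)) := fun s => by
    have := hl s; rw [hre] at this; exact (pos_iff_pos_of_mul_pos this).1 (Real.exp_pos _)
  have cr : ∀ s, Real.cos (θ (s, 1)) < 0 := fun s => by
    have := hr s; rw [hre] at this; exact (pos_iff_neg_of_mul_neg this).1 (Real.exp_pos _)
  have sb : ∀ s, Real.sin (θ (0, s)) < 0 := fun s => by
    have := hb s; rw [him] at this; exact (pos_iff_neg_of_mul_neg this).1 (Real.exp_pos _)
  have st : ∀ s, 0 < Real.sin (θ (1, s)) := fun s => by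
    have := ht s; rw [him] at this; exact (pos_iff_pos_of_mul_pos this).1 (Real.exp_pos _)
  have hpi := Real.pi_pos
  have h00 : θ (0, 0) = Complex.arg (F (0, 0)) := by
    simp only [hθ, hA0, Complex.log_im]
  have h00a : θ (0, 0) ∈ Ioo (-(Real.pi / 2)) 0 := by
    rw [h00]
    refine ⟨?_, Complex.arg_neg_iff.2 (hb 0)⟩
    have := Complex.abs_arg_lt_pi_div_two_iff.2 (Or.inl (hl 0))
    exact (abs_lt.1 this).1
  have avoid_cos : ∀ {x y : ℝ}, Real.cos x ≠ 0 → Real.cos y = 0 → x ≠ y := by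
    intro x y hx hy h; rw [h] at hx; exact hx hy
  have avoid_sin : ∀ {x y : ℝ}, Real.sin x ≠ 0 → Real.sin y = 0 → x ≠ y := by
    intro x y hx hy h; rw [h] at hx; exact hx hy
  -- along the side `t = 0`
  have h10 : θ (1, 0) ∈ Ioo (-(Real.pi / 2)) (Real.pi / 2) :=
    mem_Ioo_of_avoids (f := fun s => θ (s, 0)) (by fun_prop) ⟨h00a.1, by linarith [h00a.2]⟩
      (fun s => avoid_cos (cl s).ne' (by simp)) (fun s => avoid_cos (cl s).ne' (by simp)) 1
  have h10' : 0 < θ (1, 0) := by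
    by_contra h
    exact absurd (st 0) (not_lt.2 (Real.sin_nonpos_of_nonpos_of_neg_pi_le (not_lt.1 h)
      (by linarith [h10.1])))
  have h11 : θ (1, 1) ∈ Ioo 0 Real.pi :=
    mem_Ioo_of_avoids (f := fun s => θ (1, s)) (by fun_prop) ⟨h10', by linarith [h10.2]⟩
      (fun s => avoid_sin (st s).ne' (by simp)) (fun s => avoid_sin (st s).ne' (by simp)) 1
  have h01 : θ (0, 1) ∈ Ioo (-Real.pi) 0 :=
    mem_Ioo_of_avoids (f := fun s => θ (0, s)) (by fun_prop) ⟨by linarith [h00a.1], h00a.2⟩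
      (fun s => avoid_sin (sb s).ne (by simp)) (fun s => avoid_sin (sb s).ne (by simp)) 1
  have h01' : θ (0, 1) < -(Real.pi / 2) := by
    by_contra h
    exact absurd (cr 0) (not_lt.2 (Real.cos_nonneg_of_neg_pi_div_two_le_of_le (by linarith)
      (by linarith [h01.2])))
  -- The route through the corner `(0, 1)` puts `θ (1, 1)` below `-π / 2`, whereas the route through
  -- `(1, 0)` made it positive.
  have h11' : θ (1, 1) ∈ Ioo (-(3 * Real.pi / 2)) (-(Real.pi / 2)) :=
    mem_Ioo_of_avoids (f := fun s => θ (s, 1)) (by fun_prop) ⟨by linarith [h01.1], h01'⟩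
      (fun s => avoid_cos (cr s).ne (by
        rw [show -(3 * Real.pi / 2) = Real.pi / 2 - 2 * Real.pi by ring, Real.cos_sub_two_pi]
        simp))
      (fun s => avoid_cos (cr s).ne (by simp)) 1
  linarith [h11.1, h11'.2]

/-- A bottom-to-top curve meets a left-to-right curve. -/
theorem paths_cross {α β : I → Plane} (hα : Continuous α) (hβ : Continuous β)
    (hl : ∀ s, (β 0) 0 < (α s) 0) (hr : ∀ s, (α s) 0 < (β 1) 0)
    (hb : ∀ t, (α 0) 1 < (β t) 1) (ht : ∀ t, (β t) 1 < (α 1) 1) : ∃ s t, α s = β t := by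
  obtain ⟨⟨s, t⟩, h⟩ := exists_zero_of_sides
    (F := fun x => ⟨(α x.1) 0 - (β x.2) 0, (α x.1) 1 - (β x.2) 1⟩)
    (by
      have h : ∀ i : Fin 2, Continuous fun z : Plane => z i := fun i => by fun_prop
      have : Continuous fun x : I × I => ((α x.1) 0 - (β x.2) 0, (α x.1) 1 - (β x.2) 1) := by
        fun_prop
      exact Complex.equivRealProdCLM.symm.continuous.comp this)
    (fun s => by simpa using hl s) (fun s => by simpa using hr s)
    (fun t => by simpa using hb t) (fun t => by simpa using ht t)
  refine ⟨s, t, ?_⟩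
  have h0 := congrArg Complex.re h
  have h1 := congrArg Complex.im h
  simp only [Complex.zero_re, Complex.zero_im] at h0 h1
  ext i
  fin_cases i
  · exact sub_eq_zero.1 h0
  · exact sub_eq_zero.1 h1

end

/-! ### Winding numbers, graphs in a box, rotated frames -/

section

open scoped unitInterval

/-- In a simply connected space, a circle-valued map has winding number zero along loops. -/
theorem lift_endpoints_eq {X : Type*} [TopologicalSpace X] [SimplyConnectedSpace X]
    {g : X → Circle} (hg : Continuous g) {γ : I → X} (hγ : Continuous γ) (hγ01 : γ 0 = γ 1)
    {l : I → ℝ} (hl : Continuous l) (h : ∀ t, Circle.exp (l t) = g (γ t)) : l 0 = l 1 := by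
  let p : Path (γ 0) (γ 0) := ⟨⟨γ, hγ⟩, rfl, hγ01.symm⟩
  have hom := ContinuousMap.HomotopicRel.comp_continuousMap
    (SimplyConnectedSpace.paths_homotopic p (Path.refl (γ 0))) ⟨g, hg⟩
  -- `l` lifts the image of the loop and a constant lifts that of the trivial loop; homotopic paths
  -- have lifts with the same endpoint.
  have key := Circle.isCoveringMap_exp.liftPath_apply_one_eq_of_homotopicRel hom (l 0)
    (by simp [p, h]) (by simp [h])
  have e1 : (⟨l, hl⟩ : C(I, ℝ)) = Circle.isCoveringMap_exp.liftPath
      ((⟨g, hg⟩ : C(X, Circle)).comp p.toContinuousMap) (l 0) (by simp [p, h]) :=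
    (Circle.isCoveringMap_exp.eq_liftPath_iff' _).2 ⟨by funext t; simpa [p] using h t, rfl⟩
  have e2 : (ContinuousMap.const I (l 0) : C(I, ℝ)) = Circle.isCoveringMap_exp.liftPath
      ((⟨g, hg⟩ : C(X, Circle)).comp (Path.refl (γ 0)).toContinuousMap) (l 0) (by simp [h]) :=
    (Circle.isCoveringMap_exp.eq_liftPath_iff' _).2 ⟨by funext t; simpa using h 0, rfl⟩
  rw [← e1, ← e2] at key
  simpa using key.symm

/-- The bound `r / 2` leaves the height `3 * r / 4` above the whole graph: a point is raised at
least that far, moved horizontally to abscissa `0`, then lowered to that height. -/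
lemma isPathConnected_above {f : ℝ → ℝ} {r : ℝ} (hr : 0 < r) (hf : ∀ a, |a| < r → |f a| ≤ r / 2) :
    IsPathConnected {x : ℝ × ℝ | |x.1| < r ∧ |x.2| < r ∧ f x.1 < x.2} := by
  have h0 := hf 0 (by simpa using hr)
  refine ⟨(0, 3 * r / 4), ⟨by simpa using hr, ?_, ?_⟩, ?_⟩
  · show |3 * r / 4| < r
    rw [abs_of_pos (by linarith)]; linarith
  · show f 0 < 3 * r / 4
    linarith [(abs_le.1 h0).2]
  rintro ⟨a, b⟩ ⟨ha, hb, hab⟩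
  simp only at ha hb hab
  have hb' := abs_lt.1 hb
  have ha' := abs_lt.1 ha
  set m := max b (3 * r / 4) with hm
  have hm1 : b ≤ m := le_max_left _ _
  have hm2 : 3 * r / 4 ≤ m := le_max_right _ _
  have hm3 : m < r := max_lt hb'.2 (by linarith)
  refine JoinedIn.symm ((JoinedIn.of_segment_subset (y := (a, m)) ?_).trans
    ((JoinedIn.of_segment_subset (y := (0, m)) ?_).trans (JoinedIn.of_segment_subset ?_)))
  · rintro x hx
    obtain ⟨h1, h2⟩ : x.1 = a ∧ b ≤ x.2 ∧ x.2 ≤ m := by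
      obtain ⟨s, t, hs, ht, hst, rfl⟩ := hx
      simp only [Prod.fst_add, Prod.smul_fst, smul_eq_mul, Prod.snd_add, Prod.smul_snd]
      refine ⟨by rw [← add_mul, hst, one_mul], ?_, ?_⟩
      · nlinarith
      · nlinarith
    refine ⟨by rwa [h1], abs_lt.2 ⟨by linarith, by linarith⟩, by rw [h1]; linarith⟩
  · rintro x hx
    obtain ⟨h1, h2⟩ : |x.1| < r ∧ x.2 = m := by
      obtain ⟨s, t, hs, ht, hst, rfl⟩ := hx
      simp only [Prod.fst_add, Prod.smul_fst, smul_eq_mul, Prod.snd_add, Prod.smul_snd]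
      refine ⟨?_, by rw [← add_mul, hst, one_mul]⟩
      rw [mul_zero, add_zero, abs_mul, abs_of_nonneg hs]
      nlinarith [abs_nonneg a]
    have := (abs_le.1 (hf _ h1)).2
    refine ⟨h1, abs_lt.2 ⟨by linarith, by linarith⟩, by linarith⟩
  · rintro x hx
    obtain ⟨h1, h2⟩ : x.1 = 0 ∧ 3 * r / 4 ≤ x.2 ∧ x.2 ≤ m := by
      obtain ⟨s, t, hs, ht, hst, rfl⟩ := hx
      simp only [Prod.fst_add, Prod.smul_fst, smul_eq_mul, Prod.snd_add, Prod.smul_snd]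
      refine ⟨by simp, ?_, ?_⟩
      · nlinarith
      · nlinarith
    refine ⟨by rw [h1]; simpa using hr, abs_lt.2 ⟨by linarith, by linarith⟩, ?_⟩
    rw [h1]; linarith [(abs_le.1 h0).2]

lemma isPreconnected_below {f : ℝ → ℝ} {r : ℝ} (hr : 0 < r) (hf : ∀ a, |a| < r → |f a| ≤ r / 2) :
    IsPreconnected {x : ℝ × ℝ | |x.1| < r ∧ |x.2| < r ∧ x.2 < f x.1} := by
  have h := (isPathConnected_above (f := fun a => -f a) hr
    (by simpa using hf)).isConnected.isPreconnected.image (fun x : ℝ × ℝ => (x.1, -x.2))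
    (by fun_prop)
  convert h using 1
  ext ⟨a, b⟩
  constructor
  · rintro ⟨h1, h2, h3⟩
    exact ⟨(a, -b), ⟨h1, by simpa using h2, by simpa using h3⟩, by simp⟩
  · rintro ⟨⟨a', b'⟩, ⟨h1, h2, h3⟩, h4⟩
    simp only [Prod.mk.injEq] at h4 h1 h2 h3
    obtain ⟨rfl, rfl⟩ := h4
    exact ⟨h1, by simpa using h2, by simp only; linarith⟩

/-- Off the frontier, the interiors of `S` and of its complement form a separation, which a
connected set cannot straddle. -/
lemma subset_or_subset_compl_of_frontier {X : Type*} [TopologicalSpace X] {S V : Set X}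
    (hV : IsPreconnected V) (h : ∀ x ∈ V, x ∉ frontier S) : V ⊆ S ∨ V ⊆ Sᶜ := by
  have := hV.subset_or_subset (u := interior S) (v := interior Sᶜ) isOpen_interior isOpen_interior
    ((disjoint_compl_right (a := S)).mono interior_subset interior_subset) (fun x hx => by
      by_cases h1 : x ∈ interior S
      · exact Or.inl h1
      · right
        rw [interior_compl]
        intro h2
        exact h x hx ⟨h2, h1⟩)
  exact this.imp (fun h => h.trans interior_subset) (fun h => h.trans interior_subset)

/-- The two sides of a graph which is the frontier of the closed set `S` inside a box. -/
lemma sides_of_graph {S : Set (ℝ × ℝ)} (hS : IsClosed S) {f : ℝ → ℝ} {r : ℝ} (hr : 0 < r)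
    (hf : ∀ a, |a| ≤ r → |f a| ≤ |a| / 2)
    (hfr : ∀ a b, |a| ≤ r → |b| ≤ r → ((a, b) ∈ frontier S ↔ b = f a)) :
    (∀ a b, |a| < r → |b| < r → ((a, b) ∈ S ↔ b ≤ f a)) ∨
    (∀ a b, |a| < r → |b| < r → ((a, b) ∈ S ↔ f a ≤ b)) ∨
    (∀ a b, |a| < r → |b| < r → ((a, b) ∈ S ↔ b = f a)) := by
  have hf' : ∀ a, |a| < r → |f a| ≤ r / 2 := fun a ha => (hf a ha.le).trans (by linarith)
  have hgr : ∀ a b, |a| < r → |b| < r → b = f a → (a, b) ∈ S := fun a b ha hb h =>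
    hS.frontier_subset ((hfr a b ha.le hb.le).2 h)
  have ha := subset_or_subset_compl_of_frontier (S := S)
    (isPathConnected_above hr hf').isConnected.isPreconnected
    (fun x hx h => hx.2.2.ne' ((hfr _ _ hx.1.le hx.2.1.le).1 h))
  have hb := subset_or_subset_compl_of_frontier (S := S) (isPreconnected_below hr hf')
    (fun x hx h => hx.2.2.ne ((hfr _ _ hx.1.le hx.2.1.le).1 h))
  rcases ha with ha | ha <;> rcases hb with hb | hb
  -- If both sides belonged to `S`, the origin, which lies on the graph, would be interior to `S`.
  · exfalso
    have h0 : ((0 : ℝ), (0 : ℝ)) ∈ frontier S := (hfr 0 0 (by simpa using hr.le)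
      (by simpa using hr.le)).2 (by
        have := hf 0 (by simpa using hr.le)
        simpa [eq_comm] using this)
    refine h0.2 (mem_interior_iff_mem_nhds.2 ?_)
    have hbox : Ioo (-r) r ×ˢ Ioo (-r) r ∈ 𝓝 ((0 : ℝ), (0 : ℝ)) :=
      prod_mem_nhds (Ioo_mem_nhds (by linarith) hr) (Ioo_mem_nhds (by linarith) hr)
    filter_upwards [hbox]
    rintro ⟨a, b⟩ ⟨h1, h2⟩
    have h1' : |a| < r := abs_lt.2 h1
    have h2' : |b| < r := abs_lt.2 h2
    rcases lt_trichotomy b (f a) with h | h | h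
    · exact hb ⟨h1', h2', h⟩
    · exact hgr _ _ h1' h2' h
    · exact ha ⟨h1', h2', h⟩
  · right; left
    intro a b h1 h2
    rcases lt_trichotomy b (f a) with h | h | h
    · exact iff_of_false (hb ⟨h1, h2, h⟩) (not_le.2 h)
    · exact iff_of_true (hgr _ _ h1 h2 h) h.ge
    · exact iff_of_true (ha ⟨h1, h2, h⟩) h.le
  · left
    intro a b h1 h2
    rcases lt_trichotomy b (f a) with h | h | h
    · exact iff_of_true (hb ⟨h1, h2, h⟩) h.le
    · exact iff_of_true (hgr _ _ h1 h2 h) h.le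
    · exact iff_of_false (ha ⟨h1, h2, h⟩) (not_le.2 h)
  · right; right
    intro a b h1 h2
    rcases lt_trichotomy b (f a) with h | h | h
    · exact iff_of_false (hb ⟨h1, h2, h⟩) h.ne
    · exact iff_of_true (hgr _ _ h1 h2 h) h
    · exact iff_of_false (ha ⟨h1, h2, h⟩) h.ne'

/-- The point with coordinates `(a, b)` in the frame with origin `q` and first axis `τ`. -/
def framePoint (q τ : Plane) (x : ℝ × ℝ) : Plane :=
  !₂[q 0 + (x.1 * τ 0 - x.2 * τ 1), q 1 + (x.1 * τ 1 + x.2 * τ 0)]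

/-- The frame coordinates as a homeomorphism. -/
def frameHomeo (q τ : Plane) (hτ : τ 0 ^ 2 + τ 1 ^ 2 = 1) : ℝ × ℝ ≃ₜ Plane where
  toFun := framePoint q τ
  invFun z := ((z 0 - q 0) * τ 0 + (z 1 - q 1) * τ 1, (z 1 - q 1) * τ 0 - (z 0 - q 0) * τ 1)
  left_inv x := by
    ext
    · simp only [framePoint, PiLp.toLp_apply, Matrix.cons_val_zero, Matrix.cons_val_one]
      linear_combination x.1 * hτ
    · simp only [framePoint, PiLp.toLp_apply, Matrix.cons_val_zero, Matrix.cons_val_one]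
      linear_combination x.2 * hτ
  right_inv z := by
    ext i
    fin_cases i
    · simp [framePoint]
      linear_combination (z 0 - q 0) * hτ
    · simp [framePoint]
      linear_combination (z 1 - q 1) * hτ
  continuous_toFun := by
    unfold framePoint
    refine (PiLp.continuous_toLp 2 _).comp ?_
    refine continuous_pi fun i => ?_
    fin_cases i
    · simp; fun_prop
    · simp; fun_prop
  continuous_invFun := by fun_prop

end

/-! ### Boundary arcs as graphs -/

section

open scoped unitInterval

/-- A regular arc with horizontal tangent at the origin is locally a graph. -/
lemma exists_graph_of_curve {A B : ℝ → ℝ} (hA : ContDiff ℝ 1 A) (hB : ContDiff ℝ 1 B)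
    (hA0 : A 0 = 0) (hB0 : B 0 = 0) (hA' : 0 < deriv A 0) (hB' : deriv B 0 = 0)
    (hinj : ∀ t, |t| ≤ 1 / 2 → A t = 0 → B t = 0 → t = 0) :
    ∃ (δ r : ℝ) (f : ℝ → ℝ), 0 < δ ∧ δ < 1 / 2 ∧ 0 < r ∧
      (∀ a, |a| ≤ r → |f a| ≤ |a| / 2) ∧
      (∀ e, 0 < e → ∃ ρ, 0 < ρ ∧ ∀ a, |a| ≤ r → |a| ≤ ρ → |f a| ≤ e * |a|) ∧
      (∀ a, |a| ≤ r → ∃ t, |t| ≤ δ ∧ A t = a ∧ B t = f a) ∧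
      (∀ t, |t| ≤ 1 / 2 → |A t| ≤ r → |B t| ≤ r → B t = f (A t)) ∧
      (∀ t, |t| ≤ δ → |B t| ≤ |A t| / 2) ∧ r < A δ ∧ A (-δ) < -r ∧
      (∀ t, δ ≤ |t| → |t| ≤ 1 / 2 → ¬(|A t| ≤ r ∧ |B t| ≤ r)) := by
  set m := deriv A 0 with hm
  have cA : Continuous (deriv A) := hA.continuous_deriv le_rfl
  have cB : Continuous (deriv B) := hB.continuous_deriv le_rfl
  have e1 : ∀ᶠ t in 𝓝 (0 : ℝ), m / 2 < deriv A t ∧ |deriv B t| < m / 4 := by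
    refine (cA.continuousAt.eventually_const_lt (by linarith)).and ?_
    refine (cB.abs.continuousAt.eventually_lt_const ?_)
    show |deriv B 0| < m / 4
    rw [hB', abs_zero]; linarith
  obtain ⟨δ₀, hδ₀, hball⟩ := Metric.eventually_nhds_iff.1 e1
  -- On `[-δ, δ]` the function `A` grows at rate at least `m / 2` and `B` at rate at most `m / 4`,
  -- whence the slope `1 / 2`.
  set δ := min (δ₀ / 2) (1 / 4) with hδdef
  have hδ : 0 < δ := lt_min (by linarith) (by norm_num)
  have hδ1 : δ ≤ 1 / 4 := min_le_right _ _
  have hδ2 : δ < δ₀ := lt_of_le_of_lt (min_le_left _ _) (by linarith)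
  have hder : ∀ t ∈ Icc (-δ) δ, m / 2 < deriv A t ∧ |deriv B t| < m / 4 := fun t ht =>
    hball (by rw [Real.dist_eq, sub_zero]; exact lt_of_le_of_lt (abs_le.2 ht) hδ2)
  have hAmono : ∀ s ∈ Icc (-δ) δ, ∀ t ∈ Icc (-δ) δ, s ≤ t → m / 2 * (t - s) ≤ A t - A s :=
    (convex_Icc _ _).mul_sub_le_image_sub_of_le_deriv hA.continuous.continuousOn
      (hA.differentiable one_ne_zero).differentiableOn
      (fun x hx => (hder x (interior_subset hx)).1.le)
  have hBl : ∀ s ∈ Icc (-δ) δ, ∀ t ∈ Icc (-δ) δ, |B t - B s| ≤ m / 4 * |t - s| :=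
    fun s hs t ht => (convex_Icc _ _).norm_image_sub_le_of_norm_deriv_le
      (fun x _ => hB.differentiable one_ne_zero x) (fun x hx => (hder x hx).2.le) hs ht
  have hzero : (0 : ℝ) ∈ Icc (-δ) δ := ⟨by linarith, hδ.le⟩
  have hAlow : ∀ t ∈ Icc (-δ) δ, m / 2 * |t| ≤ |A t| := by
    intro t ht
    rcases le_total 0 t with h | h
    · have := hAmono 0 hzero t ht h
      rw [hA0] at this
      rw [abs_of_nonneg h]
      exact le_trans (by linarith) (le_abs_self _)
    · have := hAmono t ht 0 hzero h
      rw [hA0] at this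
      rw [abs_of_nonpos h]
      exact le_trans (by linarith) (neg_le_abs _)
  have hBA : ∀ t, |t| ≤ δ → |B t| ≤ |A t| / 2 := by
    intro t ht
    have h1 := hBl 0 hzero t (abs_le.1 ht)
    have h2 := hAlow t (abs_le.1 ht)
    rw [hB0, sub_zero, sub_zero] at h1
    linarith
  have hAinj : ∀ s ∈ Icc (-δ) δ, ∀ t ∈ Icc (-δ) δ, A s = A t → s = t := by
    intro s hs t ht h
    rcases le_total s t with h' | h'
    · have := hAmono s hs t ht h'
      rw [h, sub_self] at this
      nlinarith
    · have := hAmono t ht s hs h'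
      rw [h, sub_self] at this
      nlinarith
  have hcpt : IsCompact {t : ℝ | δ ≤ |t| ∧ |t| ≤ 1 / 2} := by
    refine (isCompact_Icc (a := (-(1 / 2) : ℝ)) (b := 1 / 2)).of_isClosed_subset ?_ ?_
    · exact (isClosed_le continuous_const continuous_abs).inter
        (isClosed_le continuous_abs continuous_const)
    · exact fun t ht => abs_le.1 ht.2
  -- Simplicity and compactness keep the rest of the period at sup-distance at least `m₀` from the
  -- origin.
  obtain ⟨m₀, hm₀, hm₀'⟩ : ∃ m₀ : ℝ, 0 < m₀ ∧ ∀ t, δ ≤ |t| → |t| ≤ 1 / 2 →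
      m₀ ≤ max |A t| |B t| := by
    have hne : {t : ℝ | δ ≤ |t| ∧ |t| ≤ 1 / 2}.Nonempty :=
      ⟨1 / 2, by
        show δ ≤ |(1 / 2 : ℝ)| ∧ |(1 / 2 : ℝ)| ≤ 1 / 2
        rw [abs_of_pos (by norm_num)]; constructor <;> linarith⟩
    obtain ⟨t₀, ht₀, hmin⟩ := hcpt.exists_isMinOn hne
      (f := fun t => max |A t| |B t|) (hA.continuous.abs.max hB.continuous.abs).continuousOn
    refine ⟨max |A t₀| |B t₀|, ?_, fun t h1 h2 => hmin ⟨h1, h2⟩⟩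
    by_contra h
    have hA1 : |A t₀| ≤ 0 := (le_max_left _ _).trans (not_lt.1 h)
    have hB1 : |B t₀| ≤ 0 := (le_max_right _ _).trans (not_lt.1 h)
    have := hinj t₀ ht₀.2 (abs_nonpos_iff.1 hA1) (abs_nonpos_iff.1 hB1)
    have h3 := ht₀.1
    rw [this, abs_zero] at h3
    linarith
  -- Below `m₀`, the box sees only the arc `|t| < δ`; below `m / 2 * δ`, this arc spans the whole
  -- width of the box.
  set r := min m₀ (m / 2 * δ) / 2 with hr
  have hmd : 0 < m / 2 * δ := by positivity
  have hrpos : 0 < r := by have := lt_min hm₀ hmd; linarith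
  have hr1 : r < m₀ := by have := min_le_left m₀ (m / 2 * δ); linarith
  have hr2 : r < m / 2 * δ := by have := min_le_right m₀ (m / 2 * δ); linarith
  have hAδ : r < A δ := by
    have := hAmono 0 hzero δ ⟨by linarith, le_rfl⟩ hδ.le
    rw [hA0] at this; linarith
  have hAδ' : A (-δ) < -r := by
    have := hAmono (-δ) ⟨le_rfl, by linarith⟩ 0 hzero (by linarith)
    rw [hA0] at this; linarith
  have hiv : ∀ a, |a| ≤ r → ∃ t, |t| ≤ δ ∧ A t = a := by
    intro a ha
    have ha' := abs_le.1 ha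
    obtain ⟨t, ht, h⟩ := intermediate_value_Icc (by linarith : -δ ≤ δ)
      hA.continuous.continuousOn (show a ∈ Icc (A (-δ)) (A δ) from ⟨by linarith, by linarith⟩)
    exact ⟨t, abs_le.2 ht, h⟩
  choose! T hT1 hT2 using hiv
  have hfar : ∀ t, δ ≤ |t| → |t| ≤ 1 / 2 → ¬(|A t| ≤ r ∧ |B t| ≤ r) := by
    rintro t h1 h2 ⟨h3, h4⟩
    have := (hm₀' t h1 h2).trans (max_le h3 h4)
    linarith
  refine ⟨δ, r, fun a => B (T a), hδ, by linarith, hrpos, fun a ha => ?_, fun e he => ?_,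
    fun a ha => ⟨T a, hT1 a ha, hT2 a ha, rfl⟩, fun t h1 h2 h3 => ?_, hBA, hAδ, hAδ', hfar⟩
  · have := hBA (T a) (hT1 a ha)
    rwa [hT2 a ha] at this
  · have hd : HasDerivAt B 0 0 := by
      have := (hB.differentiable one_ne_zero 0).hasDerivAt
      rwa [hB'] at this
    -- `B t = o(t)` becomes `f a = o(a)`, because `m / 2 * |t| ≤ |A t|` on the arc.
    have := (hasDerivAt_iff_isLittleO.1 hd).def (c := e * (m / 2)) (by positivity)
    obtain ⟨ρ, hρ, hB2⟩ := Metric.eventually_nhds_iff.1 this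
    refine ⟨m / 2 * (ρ / 2), by positivity, fun a ha haρ => ?_⟩
    have h1 := hAlow (T a) (abs_le.1 (hT1 a ha))
    rw [hT2 a ha] at h1
    have h2 : |T a| ≤ ρ / 2 := le_of_mul_le_mul_left (h1.trans haρ) (by linarith)
    have h3 := hB2 (y := T a) (by rw [Real.dist_eq, sub_zero]; linarith)
    simp only [hB0, sub_zero, smul_zero, Real.norm_eq_abs] at h3
    calc |B (T a)| ≤ e * (m / 2) * |T a| := h3
      _ = e * (m / 2 * |T a|) := by ring
      _ ≤ e * |a| := by gcongr
  · have h4 : |t| < δ := by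
      by_contra h
      exact hfar t (not_lt.1 h) h1 ⟨h2, h3⟩
    have := hAinj t (abs_le.1 h4.le) (T (A t)) (abs_le.1 (hT1 _ h2)) (hT2 _ h2).symm
    simp only
    rw [← this]

/-- If a closed simple curve `c` through the origin lies in a simply connected set `S`, then `S`
cannot reduce to the graph of `f` in the box where `c` is this graph. -/
lemma not_graph_of_simplyConnected {S : Set (ℝ × ℝ)} [SimplyConnectedSpace S]
    {c : ℝ → ℝ × ℝ} (hc : Continuous c) (hper : c (-(1 / 2)) = c (1 / 2)) (hcS : ∀ t, c t ∈ S)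
    {δ r : ℝ} (hδ : 0 < δ) (hδ2 : δ < 1 / 2) (hr : 0 < r) {f : ℝ → ℝ}
    (hf : ∀ a, |a| ≤ r → |f a| ≤ |a| / 2)
    (hBA : ∀ t, |t| ≤ δ → |(c t).2| ≤ |(c t).1| / 2) (h1 : r < (c δ).1) (h2 : (c (-δ)).1 < -r)
    (hfar : ∀ t, δ ≤ |t| → |t| ≤ 1 / 2 → ¬(|(c t).1| ≤ r ∧ |(c t).2| ≤ r)) :
    ¬ ∀ a b, |a| ≤ r → |b| ≤ r → (a, b) ∈ S → b = f a := by
  intro hgraph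
  classical
  -- If `S` is only a graph in the box, `g` wraps this graph once around the circle and collapses
  -- the rest of `S` to a point. Its winding number along `c` is then one, which simple
  -- connectedness forbids.
  let g : S → Circle := fun z => if |z.1.1| ≤ r ∧ |z.1.2| ≤ r then
    Circle.exp (Real.pi * (z.1.1 / r)) else Circle.exp Real.pi
  have hpi : Circle.exp (-Real.pi) = Circle.exp Real.pi := by
    rw [← Circle.exp_add_two_pi (-Real.pi)]; congr 1; ring
  have hg : Continuous g := by
    refine Continuous.if ?_ (by fun_prop) continuous_const
    intro z hz
    have k1 : Continuous fun z : S => |z.1.1| := by fun_prop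
    have k2 : Continuous fun z : S => |z.1.2| := by fun_prop
    have hcl : IsClosed {z : S | |z.1.1| ≤ r ∧ |z.1.2| ≤ r} :=
      (isClosed_le k1 continuous_const).inter (isClosed_le k2 continuous_const)
    have hz1 : |z.1.1| ≤ r ∧ |z.1.2| ≤ r := hcl.frontier_subset hz
    have hz2 : ¬(|z.1.1| < r ∧ |z.1.2| < r) := by
      intro h
      refine hz.2 (mem_interior.2 ⟨{z : S | |z.1.1| < r ∧ |z.1.2| < r},
        fun y hy => ⟨hy.1.le, hy.2.le⟩, ?_, h⟩)
      exact (isOpen_lt k1 continuous_const).inter (isOpen_lt k2 continuous_const)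
    have hz3 := hgraph z.1.1 z.1.2 hz1.1 hz1.2 z.2
    have hz4 := hf z.1.1 hz1.1
    rw [← hz3] at hz4
    -- The slope at most `1 / 2` makes the graph leave the box through its lateral sides, where the
    -- angles `±π` give the same point of the circle.
    have hz5 : |z.1.1| = r := by
      refine le_antisymm hz1.1 (not_lt.1 fun h => hz2 ⟨h, ?_⟩)
      linarith
    rcases (abs_eq hr.le).1 hz5 with h | h
    · rw [h, div_self hr.ne', mul_one]
    · rw [h, neg_div, div_self hr.ne', mul_neg, mul_one, hpi]
  let clip : ℝ → ℝ := fun x => max (-1) (min 1 x)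
  have hclip : Continuous clip := by fun_prop
  let γ : I → S := fun t => ⟨c (t - 1 / 2), hcS _⟩
  -- Freezing the parameter beyond `±δ` and clipping at `±1` holds the angle at `±π` off the box:
  -- the lift runs from `-π` to `π`.
  let l : I → ℝ := fun t => Real.pi * clip ((c (max (-δ) (min δ ((t : ℝ) - 1 / 2)))).1 / r)
  have hlift : ∀ t, Circle.exp (l t) = g (γ t) := by
    intro t
    obtain ⟨t, ht0, ht1⟩ := t
    have ht : |t - 1 / 2| ≤ 1 / 2 := abs_le.2 ⟨by linarith, by linarith⟩
    simp only [l, g, γ]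
    generalize t - 1 / 2 = s at ht
    rcases le_total δ |s| with hs | hs
    · rw [if_neg (hfar s hs ht)]
      rcases le_total 0 s with h | h
      · rw [abs_of_nonneg h] at hs
        have e1 : max (-δ) (min δ s) = δ := by rw [min_eq_left hs, max_eq_right (by linarith)]
        have e2 : clip ((c δ).1 / r) = 1 := by
          have : 1 ≤ (c δ).1 / r := by rw [le_div_iff₀ hr]; linarith
          simp only [clip]
          rw [min_eq_left this, max_eq_right (by linarith)]
        rw [e1, e2, mul_one]
      · rw [abs_of_nonpos h] at hs
        have e1 : max (-δ) (min δ s) = -δ := by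
          rw [min_eq_right (by linarith), max_eq_left (by linarith)]
        have e2 : clip ((c (-δ)).1 / r) = -1 := by
          have : (c (-δ)).1 / r ≤ -1 := by rw [div_le_iff₀ hr]; linarith
          simp only [clip]
          rw [min_eq_right (by linarith), max_eq_left this]
        rw [e1, e2, mul_neg, mul_one, hpi]
    · have hs' := abs_le.1 hs
      have e1 : max (-δ) (min δ s) = s := by rw [min_eq_right hs'.2, max_eq_right hs'.1]
      rw [e1]
      have hb := hBA s hs
      by_cases hA : |(c s).1| ≤ r
      · rw [if_pos ⟨hA, by linarith⟩]
        have hA' := abs_le.1 hA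
        congr 2
        have u1 : (c s).1 / r ≤ 1 := by rw [div_le_iff₀ hr]; linarith
        have u2 : -1 ≤ (c s).1 / r := by rw [le_div_iff₀ hr]; linarith
        simp only [clip]
        rw [min_eq_right u1, max_eq_right u2]
      · rw [if_neg (fun h => hA h.1)]
        rcases lt_abs.1 (not_le.1 hA) with h | h
        · have : 1 ≤ (c s).1 / r := by rw [le_div_iff₀ hr]; linarith
          simp only [clip]
          rw [min_eq_left this, max_eq_right (by linarith), mul_one]
        · have : (c s).1 / r ≤ -1 := by rw [div_le_iff₀ hr]; linarith
          simp only [clip]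
          rw [min_eq_right (by linarith), max_eq_left this, mul_neg, mul_one, hpi]
  have hends := lift_endpoints_eq hg (γ := γ) (by fun_prop)
    (by
      simp only [γ, Icc.coe_zero, Icc.coe_one]
      congr 1
      rw [show (0 : ℝ) - 1 / 2 = -(1 / 2) by norm_num, hper]; norm_num)
    (l := l) (by fun_prop) hlift
  simp only [l, Icc.coe_zero, Icc.coe_one] at hends
  have e1 : max (-δ) (min δ ((1 : ℝ) - 1 / 2)) = δ := by
    rw [min_eq_left (by linarith), max_eq_right (by linarith)]
  have e2 : max (-δ) (min δ ((0 : ℝ) - 1 / 2)) = -δ := by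
    rw [min_eq_right (by linarith), max_eq_left (by linarith)]
  have u1 : 1 ≤ (c δ).1 / r := by rw [le_div_iff₀ hr]; linarith
  have u2 : (c (-δ)).1 / r ≤ -1 := by rw [div_le_iff₀ hr]; linarith
  rw [e1, e2] at hends
  simp only [clip] at hends
  rw [min_eq_left u1, min_eq_right (by linarith : (c (-δ)).1 / r ≤ 1), max_eq_left u2,
    max_eq_right (by linarith)] at hends
  linarith [Real.pi_pos]

end

/-! ### The inclusion shape near a boundary point -/

section

open scoped unitInterval

lemma eq_zero_of_periodic_injOn {X : Type*} {c : ℝ → X} (hper : Function.Periodic c 1)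
    (hinj : InjOn c (Ico 0 1)) {s t : ℝ} (ht : |t| ≤ 1 / 2) (h : c (t + s) = c s) : t = 0 := by
  have hfr : ∀ x, c (Int.fract x) = c x := fun x => by
    have := hper.sub_zsmul_eq (x := x) ⌊x⌋
    rwa [zsmul_eq_mul, mul_one] at this
  have hmem : ∀ x : ℝ, Int.fract x ∈ Ico (0 : ℝ) 1 := fun x =>
    ⟨Int.fract_nonneg x, Int.fract_lt_one x⟩
  have h1 := hinj (hmem _) (hmem _) (((hfr (t + s)).trans h).trans (hfr s).symm)
  obtain ⟨z, hz⟩ := Int.fract_eq_fract.1 h1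
  have hz' : t = z := by linarith
  rw [hz'] at ht ⊢
  have : |z| < 1 := by
    have : (|z| : ℝ) < 1 := by linarith
    exact_mod_cast this
  rw [Int.abs_lt_one_iff.1 this]; simp

lemma hasDerivAt_coord {c : ℝ → Plane} {T : Plane} {t : ℝ} (h : HasDerivAt c T t) (i : Fin 2) :
    HasDerivAt (fun s => c s i) (T i) t :=
  (EuclideanSpace.proj (𝕜 := ℝ) i).hasFDerivAt.comp_hasDerivAt t h

/-- Near a boundary point, the inclusion shape is the subgraph, in a suitable frame, of a function
with vanishing derivative at the origin. -/
theorem exists_local_graph {K : Set Plane} (hK : IsInclusionShape K) {q : Plane}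
    (hq : q ∈ frontier K) : ∃ (τ : Plane) (r : ℝ) (f : ℝ → ℝ), τ 0 ^ 2 + τ 1 ^ 2 = 1 ∧ 0 < r ∧
      (∀ a, |a| ≤ r → |f a| ≤ |a| / 2) ∧
      (∀ e, 0 < e → ∃ ρ, 0 < ρ ∧ ∀ a, |a| ≤ r → |a| ≤ ρ → |f a| ≤ e * |a|) ∧
      ∀ a b, |a| ≤ r → |b| ≤ r → (framePoint q τ (a, b) ∈ K ↔ b ≤ f a) := by
  obtain ⟨β, C, c, -, -, hc, hper, hinj, hd, -, hrange⟩ := hK.jordan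
  rw [← hrange] at hq
  obtain ⟨t₀, rfl⟩ := hq
  set q := c t₀ with hqdef
  set T := deriv c t₀ with hT
  set n := ‖T‖ with hn
  have hnpos : 0 < n := norm_pos_iff.2 (hd t₀)
  have hn2 : T 0 ^ 2 + T 1 ^ 2 = n ^ 2 := by
    rw [hn, EuclideanSpace.norm_sq_eq, Fin.sum_univ_two]; simp
  set τ : Plane := n⁻¹ • T with hτdef
  have τi : ∀ i, τ i = n⁻¹ * T i := fun i => by simp [hτdef]
  have hτ : τ 0 ^ 2 + τ 1 ^ 2 = 1 := by
    rw [τi, τi, mul_pow, mul_pow, ← mul_add, hn2]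
    field_simp
  let e := frameHomeo q τ hτ
  set A : ℝ → ℝ := fun t => (c (t + t₀) 0 - q 0) * τ 0 + (c (t + t₀) 1 - q 1) * τ 1 with hAdef
  set B : ℝ → ℝ := fun t => (c (t + t₀) 1 - q 1) * τ 0 - (c (t + t₀) 0 - q 0) * τ 1 with hBdef
  have hcc : ∀ t, e (A t, B t) = c (t + t₀) := fun t => e.right_inv (c (t + t₀))
  have hci : ∀ i : Fin 2, ContDiff ℝ 1 fun t => c (t + t₀) i := fun i =>
    (EuclideanSpace.proj (𝕜 := ℝ) i).contDiff.comp (hc.comp (by fun_prop))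
  have hA : ContDiff ℝ 1 A := by
    have := hci 0; have := hci 1; fun_prop
  have hB : ContDiff ℝ 1 B := by
    have := hci 0; have := hci 1; fun_prop
  have hA0 : A 0 = 0 := by simp [hAdef, hqdef]
  have hB0 : B 0 = 0 := by simp [hBdef, hqdef]
  have hder : ∀ i : Fin 2, HasDerivAt (fun t => c (t + t₀) i) (T i) 0 := fun i => by
    have h1 : HasDerivAt c T (0 + t₀) := by
      rw [zero_add]; exact (hc.differentiable one_ne_zero t₀).hasDerivAt
    exact hasDerivAt_coord (h1.comp_add_const 0 t₀) i
  have hA' : deriv A 0 = n := by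
    have := (((hder 0).sub_const (q 0)).mul_const (τ 0)).add
      (((hder 1).sub_const (q 1)).mul_const (τ 1))
    have h2 : deriv A 0 = _ := this.deriv
    rw [h2, τi, τi]
    field_simp
    linarith
  have hB' : deriv B 0 = 0 := by
    have := (((hder 1).sub_const (q 1)).mul_const (τ 0)).sub
      (((hder 0).sub_const (q 0)).mul_const (τ 1))
    have h2 : deriv B 0 = _ := this.deriv
    rw [h2, τi, τi]
    ring
  have hinj0 : ∀ t, |t| ≤ 1 / 2 → A t = 0 → B t = 0 → t = 0 := by
    intro t ht h1 h2
    refine eq_zero_of_periodic_injOn hper hinj ht (s := t₀) ?_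
    have h3 := hcc t
    have h4 := hcc 0
    rw [h1, h2] at h3
    rw [hA0, hB0, zero_add] at h4
    rw [← h3, ← h4]
  obtain ⟨δ, r, f, hδ, hδ2, hr, hf, hfo, hsurj, hgraph, hBA, h1, h2, hfar⟩ :=
    exists_graph_of_curve hA hB hA0 hB0 (by rw [hA']; exact hnpos) hB' hinj0
  set S : Set (ℝ × ℝ) := e ⁻¹' K with hS
  have hScl : IsClosed S := hK.isCompact.isClosed.preimage e.continuous
  have hSfr : frontier S = e ⁻¹' (range c) := by
    rw [hS, ← e.preimage_frontier, hrange]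
  have hfr : ∀ a b, |a| ≤ r → |b| ≤ r → ((a, b) ∈ frontier S ↔ b = f a) := by
    intro a b ha hb
    rw [hSfr]
    constructor
    · rintro ⟨t', ht'⟩
      -- Subtracting the nearest integer brings the parameter within `1 / 2` of `t₀`, where the
      -- graph property is available.
      have hp : c ((t' - t₀ - round (t' - t₀)) + t₀) = c t' := by
        have := hper.sub_zsmul_eq (x := t') (round (t' - t₀))
        rw [← this]; congr 1; simp; ring
      have hab := hcc (t' - t₀ - round (t' - t₀))
      rw [hp, ht'] at hab
      have hab' := e.injective hab
      rw [Prod.mk.injEq] at hab'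
      have := hgraph _ (abs_sub_round _) (by rw [hab'.1]; exact ha) (by rw [hab'.2]; exact hb)
      rwa [hab'.1, hab'.2] at this
    · intro h
      obtain ⟨t, -, hta, htb⟩ := hsurj a ha
      refine ⟨t + t₀, ?_⟩
      rw [← hcc, hta, htb, h]
  have hSsc : SimplyConnectedSpace S := by
    have := hK.simplyConnected
    exact (e.sets (s := S) (t := K) rfl).toHomotopyEquiv.simplyConnectedSpace
  have hr2 : 0 < r / 2 := by linarith
  have hlt : ∀ a, |a| ≤ r / 2 → |a| < r := fun a ha => by linarith
  have hle : ∀ a, |a| ≤ r / 2 → |a| ≤ r := fun a ha => by linarith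
  rcases sides_of_graph hScl hr hf hfr with h | h | h
  · refine ⟨τ, r / 2, f, hτ, hr2, fun a ha => hf a (hle a ha), fun ε hε => ?_,
      fun a b ha hb => h a b (hlt a ha) (hlt b hb)⟩
    obtain ⟨ρ, hρ, hρ'⟩ := hfo ε hε
    exact ⟨ρ, hρ, fun a ha => hρ' a (hle a ha)⟩
  -- A half-turn of the frame changes an epigraph into a subgraph.
  · refine ⟨-τ, r / 2, fun a => -f (-a), by simpa using hτ, hr2, fun a ha => ?_, fun ε hε => ?_,
      fun a b ha hb => ?_⟩
    · simpa using hf (-a) (hle _ (by simpa using ha))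
    · obtain ⟨ρ, hρ, hρ'⟩ := hfo ε hε
      exact ⟨ρ, hρ, fun a ha haρ => by
        simpa using hρ' (-a) (hle _ (by simpa using ha)) (by simpa using haρ)⟩
    · have key := h (-a) (-b) (by simpa using hlt a ha) (by simpa using hlt b hb)
      have e1 : framePoint q (-τ) (a, b) = e (-a, -b) := by
        show _ = framePoint q τ (-a, -b)
        simp [framePoint]
      rw [e1]
      exact key.trans ⟨fun h => by linarith, fun h => by linarith⟩
  -- If `K` were a mere arc near the point, its closed boundary curve would be a loop in `K` with
  -- nonzero winding number.
  · exfalso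
    refine not_graph_of_simplyConnected (S := S) (c := fun t => (A t, B t))
      (hA.continuous.prodMk hB.continuous) ?_ (fun t => ?_) hδ hδ2 hr2
      (fun a ha => hf a (hle a ha)) hBA (by simp only; linarith) (by simp only; linarith)
      (fun t u1 u2 u3 => hfar t u1 u2 ⟨hle _ u3.1, hle _ u3.2⟩)
      (fun a b ha hb hab => (h a b (hlt a ha) (hlt b hb)).1 hab)
    · apply e.injective
      rw [hcc, hcc]
      have := hper (-(1 / 2) + t₀)
      rw [← this]; congr 1; ring
    · show e (A t, B t) ∈ K
      rw [hcc]
      exact hK.isCompact.isClosed.frontier_subset (hrange ▸ mem_range_self _)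

end

/-! ### The wall and its two sides -/

section

open scoped unitInterval

lemma plane_eta (z : Plane) : !₂[z 0, z 1] = z := by
  ext i; fin_cases i <;> rfl

lemma continuous_coord (i : Fin 2) : Continuous fun z : Plane => z i := by fun_prop

/-- The two vertical half-lines issued from `(0, ±1)`. -/
def verticalRays : Set Plane := {z | z 0 = 0 ∧ 1 ≤ |z 1|}

/-- The inclusion shape together with two vertical half-lines: it cuts the plane in two. -/
def wall (K : Set Plane) : Set Plane := K ∪ verticalRays

/-- The part of the plane on the left of the wall. -/
def leftSide (K : Set Plane) : Set Plane := connectedComponentIn (wall K)ᶜ !₂[-2, 0]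

/-- The part of the plane which is not on the left of the wall. -/
def rightSide (K : Set Plane) : Set Plane := (wall K)ᶜ \ leftSide K

lemma isClosed_verticalRays : IsClosed verticalRays :=
  (isClosed_eq (continuous_coord 0) continuous_const).inter
    (isClosed_le continuous_const (continuous_coord 1).abs)

section sides

variable {K : Set Plane}

lemma isClosed_wall (hK : IsInclusionShape K) : IsClosed (wall K) :=
  hK.isCompact.isClosed.union isClosed_verticalRays

lemma isOpen_leftSide (hK : IsInclusionShape K) : IsOpen (leftSide K) :=
  (isClosed_wall hK).isOpen_compl.connectedComponentIn

lemma leftSide_subset : leftSide K ⊆ (wall K)ᶜ := connectedComponentIn_subset _ _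

/-- `leftSide K` is a whole component of the complement of the wall, so the side of a connected set
off the wall can be read at any one of its points. -/
lemma subset_left_or_right {V : Set Plane} (hV : IsPreconnected V) (h : V ⊆ (wall K)ᶜ) :
    V ⊆ leftSide K ∨ V ⊆ rightSide K := by
  by_cases hx : ∃ x ∈ V, x ∈ leftSide K
  · obtain ⟨x, hxV, hxL⟩ := hx
    left
    have := hV.subset_connectedComponentIn hxV h
    rwa [← connectedComponentIn_eq hxL] at this
  · push Not at hx
    exact Or.inr fun x hxV => ⟨h hxV, hx x hxV⟩

lemma isOpen_rightSide (hK : IsInclusionShape K) : IsOpen (rightSide K) := by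
  rw [isOpen_iff_mem_nhds]
  intro x hx
  have ho : IsOpen (connectedComponentIn (wall K)ᶜ x) :=
    (isClosed_wall hK).isOpen_compl.connectedComponentIn
  refine mem_of_superset (ho.mem_nhds (mem_connectedComponentIn hx.1)) ?_
  rcases subset_left_or_right (K := K) isPreconnected_connectedComponentIn
    (connectedComponentIn_subset (wall K)ᶜ x) with h | h
  · exact absurd (h (mem_connectedComponentIn hx.1)) hx.2
  · exact h

lemma left_or_right {z : Plane} (hz : z ∉ wall K) : z ∈ leftSide K ∨ z ∈ rightSide K := by
  by_cases h : z ∈ leftSide K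
  · exact Or.inl h
  · exact Or.inr ⟨hz, h⟩

lemma convex_coord_lt (i : Fin 2) (a : ℝ) : Convex ℝ {z : Plane | z i < a} :=
  (convex_Iio a).linear_preimage (EuclideanSpace.proj (𝕜 := ℝ) i).toLinearMap

lemma convex_coord_gt (i : Fin 2) (a : ℝ) : Convex ℝ {z : Plane | a < z i} :=
  (convex_Ioi a).linear_preimage (EuclideanSpace.proj (𝕜 := ℝ) i).toLinearMap

lemma notMem_wall_of_left (hK : IsInclusionShape K) {z : Plane} (h0 : z 0 ≠ 0)
    (h : 1 < |z 0| ∨ 1 < |z 1|) : z ∉ wall K := by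
  rintro (hz | hz)
  · have := hK.subset_square z hz
    rcases h with h | h <;> linarith [this.1, this.2]
  · exact h0 hz.1

/-- The half-plane `z 0 < -1` contains the base point, and the quadrants `z 0 < 0`, `±z 1 > 1`
overlap it; all are convex and off the wall. -/
lemma outer_left (hK : IsInclusionShape K) {z : Plane}
    (h : z 0 < -1 ∨ (z 0 < 0 ∧ 1 < |z 1|)) : z ∈ leftSide K := by
  have hbase : !₂[(-2 : ℝ), 0] ∈ {z : Plane | z 0 < -1} := by
    show (-2 : ℝ) < -1; norm_num
  have hsub1 : {z : Plane | z 0 < -1} ⊆ (wall K)ᶜ := fun y hy =>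
    notMem_wall_of_left hK (by have : y 0 < -1 := hy; linarith)
      (Or.inl (by have : y 0 < -1 := hy; exact lt_abs.2 (Or.inr (by linarith))))
  have hL1 : {z : Plane | z 0 < -1} ⊆ leftSide K :=
    (convex_coord_lt 0 (-1)).isPreconnected.subset_connectedComponentIn hbase hsub1
  rcases h with h | ⟨h0, h1⟩
  · exact hL1 h
  · have key : ∀ V : Set Plane, Convex ℝ V → (∀ y ∈ V, y 0 < 0 ∧ 1 < |y 1|) →
        (∃ y ∈ V, y 0 < -1) → V ⊆ leftSide K := by
      rintro V hV hV1 ⟨y, hy, hy0⟩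
      rcases subset_left_or_right (K := K) hV.isPreconnected (fun y hy =>
        notMem_wall_of_left hK (hV1 y hy).1.ne (Or.inr (hV1 y hy).2)) with h | h
      · exact h
      · exact absurd (hL1 hy0) (h hy).2
    rcases lt_abs.1 h1 with h | h
    · exact key ({z | z 0 < 0} ∩ {z | 1 < z 1}) ((convex_coord_lt 0 0).inter (convex_coord_gt 1 1))
        (fun y hy => ⟨hy.1, lt_abs.2 (Or.inl hy.2)⟩)
        ⟨!₂[-2, 2], ⟨by show (-2 : ℝ) < 0; norm_num, by show (1 : ℝ) < 2; norm_num⟩,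
          by show (-2 : ℝ) < -1; norm_num⟩ ⟨h0, h⟩
    · exact key ({z | z 0 < 0} ∩ {z | z 1 < -1})
        ((convex_coord_lt 0 0).inter (convex_coord_lt 1 (-1)))
        (fun y hy => ⟨hy.1, lt_abs.2 (Or.inr (by have : y 1 < -1 := hy.2; linarith))⟩)
        ⟨!₂[-2, -2], ⟨by show (-2 : ℝ) < 0; norm_num, by show (-2 : ℝ) < -1; norm_num⟩,
          by show (-2 : ℝ) < -1; norm_num⟩ ⟨h0, by show z 1 < -1; linarith⟩

/-- The wall separates its left side from the far right. -/
lemma far_right_notMem_leftSide (hK : IsInclusionShape K) (htop : !₂[(0 : ℝ), 1] ∈ frontier K)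
    (hbot : !₂[(0 : ℝ), -1] ∈ frontier K) : !₂[(2 : ℝ), 0] ∉ leftSide K := by
  intro h
  have hL : IsPathConnected (leftSide K) :=
    (isOpen_leftSide hK).isConnected_iff_isPathConnected.1
      ⟨⟨_, h⟩, isPreconnected_connectedComponentIn⟩
  have hbase : !₂[(-2 : ℝ), 0] ∈ leftSide K :=
    outer_left hK (Or.inl (by show (-2 : ℝ) < -1; norm_num))
  obtain ⟨β, hβ⟩ := hL.joinedIn _ hbase _ h
  obtain ⟨M, hM⟩ := (isCompact_range β.continuous).isBounded.exists_norm_le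
  have hM' : ∀ t, |(β t) 1| ≤ M := fun t =>
    (PiLp.norm_apply_le (β t) 1).trans (hM _ (mem_range_self t))
  -- The wall contains a curve from `(0, -N)` to `(0, N)` through `K`. As `N` exceeds the height of
  -- `β`, `paths_cross` makes the two meet.
  set N := max M 1 + 1 with hN
  have hN1 : 1 < N := by have := le_max_right M 1; linarith
  have hNM : M < N := by have := le_max_left M 1; linarith
  have hKpc : IsPathConnected K := by
    have := hK.simplyConnected
    exact isPathConnected_iff_pathConnectedSpace.2 inferInstance
  have hfr := hK.isCompact.isClosed.frontier_subset
  have hmid : JoinedIn (wall K) !₂[(0 : ℝ), -1] !₂[(0 : ℝ), 1] :=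
    (hKpc.joinedIn _ (hfr hbot) _ (hfr htop)).mono subset_union_left
  have hseg : ∀ a b : ℝ, 1 ≤ a ∧ 1 ≤ b ∨ a ≤ -1 ∧ b ≤ -1 →
      JoinedIn (wall K) !₂[(0 : ℝ), a] !₂[(0 : ℝ), b] := by
    intro a b hab
    refine JoinedIn.of_segment_subset ?_
    rintro z ⟨s, t, hs, ht, hst, rfl⟩
    right
    refine ⟨by simp, ?_⟩
    simp only [PiLp.add_apply, PiLp.smul_apply, Matrix.cons_val_one,
      Matrix.cons_val_fin_one, smul_eq_mul]
    rcases hab with h | h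
    · exact le_trans (by nlinarith) (le_abs_self _)
    · exact le_trans (by nlinarith) (neg_le_abs _)
  obtain ⟨α, hα⟩ := ((hseg (-N) (-1) (Or.inr ⟨by linarith, le_rfl⟩)).trans hmid).trans
    (hseg 1 N (Or.inl ⟨le_rfl, by linarith⟩))
  have hα1 : ∀ s, |(α s) 0| ≤ 1 := by
    intro s
    rcases hα s with h | h
    · exact (hK.subset_square _ h).1
    · rw [h.1, abs_zero]; exact zero_le_one
  obtain ⟨s, t, hst⟩ := paths_cross α.continuous β.continuous
    (fun s => by rw [β.source]; have := (abs_le.1 (hα1 s)).1; show (-2 : ℝ) < _; linarith)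
    (fun s => by rw [β.target]; have := (abs_le.1 (hα1 s)).2; show _ < (2 : ℝ); linarith)
    (fun t => by rw [α.source]; have := (abs_le.1 (hM' t)).1; show -N < _; linarith)
    (fun t => by rw [α.target]; have := (abs_le.1 (hM' t)).2; show _ < N; linarith)
  exact leftSide_subset (hβ t) (hst ▸ hα s)

/-- The mirror images of the convex regions on the left, anchored this time at `(2, 0)`, which the
wall separates from the left side. -/
lemma outer_right (hK : IsInclusionShape K) (htop : !₂[(0 : ℝ), 1] ∈ frontier K)
    (hbot : !₂[(0 : ℝ), -1] ∈ frontier K) {z : Plane}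
    (h : 1 < z 0 ∨ (0 < z 0 ∧ 1 < |z 1|)) : z ∈ rightSide K := by
  have key : ∀ V : Set Plane, Convex ℝ V → (∀ y ∈ V, 0 < y 0 ∧ (1 < |y 0| ∨ 1 < |y 1|)) →
      (∃ y ∈ V, y ∈ rightSide K) → V ⊆ rightSide K := by
    rintro V hV hV1 ⟨y, hy, hy0⟩
    rcases subset_left_or_right (K := K) hV.isPreconnected (fun y hy =>
      notMem_wall_of_left hK (hV1 y hy).1.ne' (hV1 y hy).2) with h | h
    · exact absurd (h hy) hy0.2
    · exact h
  have hfar := far_right_notMem_leftSide hK htop hbot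
  have hR1 : {z : Plane | 1 < z 0} ⊆ rightSide K :=
    key _ (convex_coord_gt 0 1) (fun y hy => by
      have hy' : 1 < y 0 := hy
      exact ⟨by linarith, Or.inl (lt_abs.2 (Or.inl hy'))⟩)
      ⟨!₂[2, 0], by show (1 : ℝ) < 2; norm_num,
        (left_or_right (notMem_wall_of_left hK (by show (2 : ℝ) ≠ 0; norm_num)
          (Or.inl (by show 1 < |(2 : ℝ)|; norm_num)))).resolve_left hfar⟩
  rcases h with h | ⟨h0, h1⟩
  · exact hR1 h
  rcases lt_abs.1 h1 with h | h
  · exact key ({z | 0 < z 0} ∩ {z | 1 < z 1}) ((convex_coord_gt 0 0).inter (convex_coord_gt 1 1))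
      (fun y hy => ⟨hy.1, Or.inr (lt_abs.2 (Or.inl hy.2))⟩)
      ⟨!₂[2, 2], ⟨by show (0 : ℝ) < 2; norm_num, by show (1 : ℝ) < 2; norm_num⟩,
        hR1 (by show (1 : ℝ) < 2; norm_num)⟩ ⟨h0, h⟩
  · exact key ({z | 0 < z 0} ∩ {z | z 1 < -1})
      ((convex_coord_gt 0 0).inter (convex_coord_lt 1 (-1)))
      (fun y hy => ⟨hy.1, Or.inr (lt_abs.2 (Or.inr (by have : y 1 < -1 := hy.2; linarith)))⟩)
      ⟨!₂[2, -2], ⟨by show (0 : ℝ) < 2; norm_num, by show (-2 : ℝ) < -1; norm_num⟩,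
        hR1 (by show (1 : ℝ) < 2; norm_num)⟩ ⟨h0, by show z 1 < -1; linarith⟩

/-- The two sides of the wall touch only along the vertical half-lines. -/
lemma closure_sides_inter (hK : IsInclusionShape K) {q : Plane} (hl : q ∈ closure (leftSide K))
    (hr : q ∈ closure (rightSide K)) : q ∈ verticalRays := by
  by_contra hq
  have hLR : ∀ z, z ∈ leftSide K → z ∉ rightSide K := fun z h h' => h'.2 h
  have hqK : q ∈ K := by
    by_contra hqK
    have hqW : q ∉ wall K := fun h => h.elim hqK hq
    rcases left_or_right hqW with h | h
    · obtain ⟨z, h1, h2⟩ := mem_closure_iff.1 hr _ (isOpen_leftSide hK) h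
      exact hLR z h1 h2
    · obtain ⟨z, h1, h2⟩ := mem_closure_iff.1 hl _ (isOpen_rightSide hK) h
      exact hLR z h2 h1
  have hqf : q ∈ frontier K := by
    refine ⟨subset_closure hqK, fun hint => ?_⟩
    obtain ⟨z, h1, h2⟩ := mem_closure_iff.1 hl _ isOpen_interior hint
    exact leftSide_subset h2 (Or.inl (interior_subset h1))
  obtain ⟨τ, r, f, hτ, hrpos, hf, -, hgr⟩ := exists_local_graph hK hqf
  let e := frameHomeo q τ hτ
  have he0 : e (0, 0) = q := by
    show framePoint q τ (0, 0) = q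
    rw [← plane_eta q]; simp [framePoint]
  have hnear : e ⁻¹' verticalRaysᶜ ∈ 𝓝 ((0 : ℝ), (0 : ℝ)) :=
    e.continuous.continuousAt.preimage_mem_nhds
      (by rw [he0]; exact isClosed_verticalRays.isOpen_compl.mem_nhds hq)
  obtain ⟨ρ, hρ, hball⟩ := Metric.mem_nhds_iff.1 hnear
  set s := min r ρ with hs
  have hspos : 0 < s := lt_min hrpos hρ
  have hsr : s ≤ r := min_le_left _ _
  have hsρ : s ≤ ρ := min_le_right _ _
  have hbox : ∀ x : ℝ × ℝ, |x.1| < s → |x.2| < s → e x ∉ verticalRays := fun x h1 h2 =>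
    hball (by
      rw [Metric.mem_ball, Prod.dist_eq]
      simpa using ⟨h1.trans_le hsρ, h2.trans_le hsρ⟩)
  -- Near `q` the complement of the wall is the part above the graph. It is connected, so only one
  -- side can accumulate at `q`.
  set V := {x : ℝ × ℝ | |x.1| < s ∧ |x.2| < s ∧ f x.1 < x.2} with hV
  have hVpre : IsPreconnected (e '' V) :=
    ((isPathConnected_above hspos (fun a ha => (hf a (ha.le.trans hsr)).trans
      (by linarith))).isConnected.isPreconnected).image _ e.continuous.continuousOn
  have hVW : e '' V ⊆ (wall K)ᶜ := by
    rintro _ ⟨x, hx, rfl⟩ (h | h)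
    · exact not_le.2 hx.2.2
        ((hgr x.1 x.2 (hx.1.le.trans hsr) (hx.2.1.le.trans hsr)).1 h)
    · exact hbox x hx.1 hx.2.1 h
  have hU : e '' (Ioo (-s) s ×ˢ Ioo (-s) s) ∈ 𝓝 q := by
    refine (e.isOpenMap _ (isOpen_Ioo.prod isOpen_Ioo)).mem_nhds ⟨(0, 0), ?_, he0⟩
    exact ⟨⟨by linarith, hspos⟩, ⟨by linarith, hspos⟩⟩
  have hUV : ∀ z ∈ e '' (Ioo (-s) s ×ˢ Ioo (-s) s), z ∉ wall K → z ∈ e '' V := by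
    rintro _ ⟨x, hx, rfl⟩ hz
    have h1 : |x.1| < s := abs_lt.2 hx.1
    have h2 : |x.2| < s := abs_lt.2 hx.2
    refine ⟨x, ⟨h1, h2, ?_⟩, rfl⟩
    by_contra h
    exact hz (Or.inl ((hgr x.1 x.2 (h1.le.trans hsr) (h2.le.trans hsr)).2 (not_lt.1 h)))
  obtain ⟨z, hz1, hz2⟩ := mem_closure_iff_nhds.1 hl _ hU
  obtain ⟨w, hw1, hw2⟩ := mem_closure_iff_nhds.1 hr _ hU
  rcases subset_left_or_right hVpre hVW with h | h
  · exact hLR w (h (hUV w hw1 hw2.1)) hw2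
  · exact hLR z hz2 (h (hUV z hz1 (leftSide_subset hz2)))

/-- At a contact point `(0, ±1)`, the inclusion shape is the subgraph of a function with
vanishing derivative. -/
lemma exists_contact_graph (hK : IsInclusionShape K) {s : ℝ} (hs : s = 1 ∨ s = -1)
    (hq : !₂[(0 : ℝ), s] ∈ frontier K) : ∃ (r : ℝ) (f : ℝ → ℝ), 0 < r ∧
      (∀ e, 0 < e → ∃ ρ, 0 < ρ ∧ ∀ x, |x| ≤ r → |x| ≤ ρ → |f x| ≤ e * |x|) ∧
      ∀ x y, |x| ≤ r → |s * y - 1| ≤ r → (!₂[x, y] ∈ K ↔ s * y - 1 ≤ f x) := by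
  obtain ⟨τ, r, f, hτ, hr, hf, hfo, hgr⟩ := exists_local_graph hK hq
  have hss : s * s = 1 := by rcases hs with h | h <;> rw [h] <;> norm_num
  have hsabs : |s| = 1 := by rcases hs with h | h <;> rw [h] <;> norm_num
  have habs : ∀ x, |s * x| = |x| := fun x => by rw [abs_mul, hsabs, one_mul]
  -- No point of the subgraph may pass the contact point in the direction `s`, because `K` stays in
  -- `[-1, 1]²`.
  have hin : ∀ a b, |a| ≤ r → |b| ≤ r → b ≤ f a → s * (a * τ 1 + b * τ 0) ≤ 0 := by
    intro a b ha hb h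
    have := (hK.subset_square _ ((hgr a b ha hb).2 h)).2
    simp only [framePoint, PiLp.toLp_apply, Matrix.cons_val_one, Matrix.cons_val_fin_one] at this
    have h2 := (le_abs_self _).trans ((habs _).le.trans this)
    nlinarith
  -- A tilted tangent would push `K` past the contact point on one side or the other, since `f a =
  -- o(a)`.
  have hτ1 : τ 1 = 0 := by
    by_contra hne
    have hpos : 0 < |τ 1| := abs_pos.2 hne
    obtain ⟨ρ, hρ, hρf⟩ := hfo (|τ 1| / 2) (by positivity)
    have hτ0 : |τ 0| ≤ 1 := abs_le_one_iff_mul_self_le_one.2 (by nlinarith [sq_nonneg (τ 1)])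
    set m := min r ρ with hm
    have hmpos : 0 < m := lt_min hr hρ
    have hkey : ∀ a, |a| = m → s * (a * τ 1) ≤ m * (|τ 1| / 2) := by
      intro a ha
      have har : |a| ≤ r := ha.le.trans (min_le_left _ _)
      have h1 := hρf a har (ha.le.trans (min_le_right _ _))
      have h2 := hin a (f a) har ((hf a har).trans (by linarith [abs_nonneg a])) le_rfl
      have h3 : |s * (f a * τ 0)| ≤ |f a| := by
        rw [habs, abs_mul]; exact mul_le_of_le_one_right (abs_nonneg _) hτ0
      have h4 := (abs_le.1 h3).1
      rw [ha] at h1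
      nlinarith
    have h1 := hkey m (abs_of_pos hmpos)
    have h2 := hkey (-m) (by rw [abs_neg, abs_of_pos hmpos])
    have h3 : |s * (m * τ 1)| ≤ m * (|τ 1| / 2) := abs_le.2 ⟨by linarith, h1⟩
    rw [habs, abs_mul, abs_of_pos hmpos] at h3
    nlinarith
  -- The point `(0, -r)` of the frame belongs to `K`, so the second axis of the frame must point
  -- outwards.
  have hτ0 : τ 0 = s := by
    have h1 := hin 0 (-r) (by simpa using hr.le) (by rw [abs_neg, abs_of_pos hr]) (by
      have := hf 0 (by simpa using hr.le)
      rw [abs_zero, zero_div] at this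
      rw [abs_nonpos_iff.1 this]; linarith)
    rw [hτ1] at hτ
    have h2 : 0 ≤ s * τ 0 := by
      have : r * (s * τ 0) ≥ 0 := by nlinarith
      exact nonneg_of_mul_nonneg_right this hr
    have h3 : (s * τ 0 - 1) * (s * τ 0 + 1) = 0 := by
      linear_combination (τ 0) ^ 2 * hss + hτ
    have h4 : s * τ 0 = 1 := by
      rcases mul_eq_zero.1 h3 with h | h <;> linarith
    linear_combination s * h4 - τ 0 * hss
  refine ⟨r, fun x => f (s * x), hr, fun e he => ?_, fun x y hx hy => ?_⟩
  · obtain ⟨ρ, hρ, hρf⟩ := hfo e he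
    exact ⟨ρ, hρ, fun x h1 h2 => by
      have := hρf (s * x) (by rwa [habs]) (by rwa [habs])
      rwa [habs] at this⟩
  · rw [← hgr (s * x) (s * y - 1) (by rwa [habs]) hy]
    have : framePoint !₂[(0 : ℝ), s] τ (s * x, s * y - 1) = !₂[x, y] := by
      ext i
      fin_cases i
      · simp [framePoint, hτ1, hτ0]
        linear_combination x * hss
      · simp [framePoint, hτ1, hτ0]
        linear_combination y * hss
    rw [this]

end sides

end

/-! ### Smooth steps and the function of one cell -/

section

open scoped Manifold

/-- A smooth step, equal to `0` on `(-∞, -1]` and to `1` on `[1, ∞)`. -/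
def step (s : ℝ) : ℝ := Real.smoothTransition ((s + 1) / 2)

lemma contDiff_step : ContDiff ℝ ∞ step :=
  Real.smoothTransition.contDiff.comp (by fun_prop)

lemma step_nonneg (s : ℝ) : 0 ≤ step s := Real.smoothTransition.nonneg _

lemma step_le_one (s : ℝ) : step s ≤ 1 := Real.smoothTransition.le_one _

lemma step_of_le {s : ℝ} (h : s ≤ -1) : step s = 0 :=
  Real.smoothTransition.zero_of_nonpos (by linarith)

lemma step_of_ge {s : ℝ} (h : 1 ≤ s) : step s = 1 :=
  Real.smoothTransition.one_of_one_le (by linarith)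

/-- Extrema are critical points: a cut-off has zero gradient wherever it equals `0` or `1`, even
where it is not known to be locally constant. -/
lemma fderiv_eq_zero_of_extreme {E : Type*} [NormedAddCommGroup E] [NormedSpace ℝ E] {f : E → ℝ}
    (hf : ∀ x, f x ∈ Icc (0 : ℝ) 1) {z : E} (hz : f z = 0 ∨ f z = 1) : fderiv ℝ f z = 0 := by
  rcases hz with h | h
  · exact IsLocalMin.fderiv_eq_zero (Eventually.of_forall fun x => by rw [h]; exact (hf x).1)
  · exact IsLocalMax.fderiv_eq_zero (Eventually.of_forall fun x => by rw [h]; exact (hf x).2)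

lemma step_mem (s : ℝ) : step s ∈ Icc (0 : ℝ) 1 := ⟨step_nonneg s, step_le_one s⟩

lemma deriv_step_eq_zero {s : ℝ} (h : 1 ≤ |s|) : deriv step s = 0 := by
  have : fderiv ℝ step s = 0 := by
    refine fderiv_eq_zero_of_extreme step_mem ?_
    rcases le_abs.1 h with h | h
    · exact Or.inr (step_of_ge h)
    · exact Or.inl (step_of_le (by linarith))
  rw [← fderiv_apply_one_eq_deriv, this]; rfl

lemma exists_deriv_step_bound : ∃ M : ℝ, ∀ s, |deriv step s| ≤ M := by
  have hc : HasCompactSupport (deriv step) :=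
    HasCompactSupport.intro (isCompact_Icc (a := (-1 : ℝ)) (b := 1)) fun s hs =>
      deriv_step_eq_zero (not_lt.1 fun h => hs (abs_le.1 h.le))
  obtain ⟨M, hM⟩ := (contDiff_step.continuous_deriv (by simp)).bounded_above_of_compact_support hc
  exact ⟨M, hM⟩

/-- The coordinate functions as continuous linear maps. -/
abbrev coordL (i : Fin 2) : Plane →L[ℝ] ℝ := EuclideanSpace.proj i

lemma norm_proj_le (i : Fin 2) : ‖coordL i‖ ≤ 1 :=
  ContinuousLinearMap.opNorm_le_bound _ zero_le_one fun z => by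
    rw [one_mul]; exact PiLp.norm_apply_le z i

lemma contDiff_coord (i : Fin 2) : ContDiff ℝ ∞ fun z : Plane => z i :=
  (coordL i).contDiff

lemma contDiff_step_coord (i : Fin 2) (t : ℝ) : ContDiff ℝ ∞ fun z : Plane => step (z i / t) :=
  contDiff_step.comp ((contDiff_coord i).div_const t)

lemma norm_fderiv_comp_coord_le {g : ℝ → ℝ} (i : Fin 2) (z : Plane)
    (hg : DifferentiableAt ℝ g (z i)) :
    ‖fderiv ℝ (fun z : Plane => g (z i)) z‖ ≤ |deriv g (z i)| := by
  have h1 : HasFDerivAt (fun z : Plane => g (z i))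
      (deriv g (z i) • (coordL i)) z :=
    hg.hasDerivAt.comp_hasFDerivAt z
      (coordL i).hasFDerivAt
  rw [h1.fderiv, norm_smul, Real.norm_eq_abs]
  exact mul_le_of_le_one_right (abs_nonneg _) (norm_proj_le i)

lemma deriv_step_div (t x : ℝ) : deriv (fun s => step (s / t)) x = deriv step (x / t) / t := by
  have h : HasDerivAt (step ∘ fun s => s / t) (deriv step (x / t) * (1 / t)) x :=
    ((contDiff_step.differentiable (by simp) (x / t)).hasDerivAt).comp x
      ((hasDerivAt_id x).div_const t)
  change deriv (step ∘ fun s => s / t) x = _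
  rw [h.deriv]; ring

lemma norm_fderiv_step_coord_le {M : ℝ} (hM : ∀ s, |deriv step s| ≤ M) {t : ℝ} (ht : 0 < t)
    (i : Fin 2) (z : Plane) : ‖fderiv ℝ (fun z : Plane => step (z i / t)) z‖ ≤ M / t := by
  refine (norm_fderiv_comp_coord_le (g := fun s => step (s / t)) i z ?_).trans ?_
  · exact (contDiff_step.differentiable (by simp)).differentiableAt.comp _ (by fun_prop)
  · rw [deriv_step_div, abs_div, abs_of_pos ht]
    gcongr
    exact hM _

lemma exists_smooth_urysohn {A B : Set Plane} (hA : IsClosed A) (hB : IsClosed B)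
    (h : Disjoint A B) : ∃ f : Plane → ℝ, ContDiff ℝ ∞ f ∧ (∀ z ∈ A, f z = 0) ∧
      (∀ z ∈ B, f z = 1) ∧ ∀ z, f z ∈ Icc (0 : ℝ) 1 := by
  obtain ⟨f, h0, h1, h2⟩ := exists_contMDiffMap_zero_one_of_isClosed (n := (⊤ : ℕ∞)) 𝓘(ℝ, Plane) hA hB h
  exact ⟨f, f.contMDiff.contDiff, h0, h1, h2⟩

section cell

variable {K : Set Plane}

/-- Serves to pass from strict to large inequalities: a point on the boundary of the square `[-1,
1]²` is the limit of its dilates, which are strictly outside. -/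
lemma mem_closure_of_one_lt_smul {S : Set Plane} {z : Plane} (h : ∀ c : ℝ, 1 < c → c • z ∈ S) :
    z ∈ closure S := by
  have ht : Tendsto (fun c : ℝ => c • z) (𝓝[>] 1) (𝓝 z) := by
    have : Continuous fun c : ℝ => c • z := by fun_prop
    have := (this.tendsto 1).mono_left (nhdsWithin_le_nhds (s := Ioi 1))
    rwa [one_smul] at this
  exact mem_closure_of_tendsto ht (eventually_mem_nhdsWithin.mono fun c hc => h c hc)

/-- Near the two contact points `(0, ±1)`, the inclusion shape fills almost the whole strip, and
what remains is sorted by the sign of the first coordinate. -/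
lemma exists_contact_box (hK : IsInclusionShape K) (htop : !₂[(0 : ℝ), 1] ∈ frontier K)
    (hbot : !₂[(0 : ℝ), -1] ∈ frontier K) {e : ℝ} (he : 0 < e) :
    ∃ r₀, 0 < r₀ ∧ ∀ r, 0 < r → r ≤ r₀ → r ≤ 1 / 2 ∧
      (∀ z : Plane, |z 0| ≤ r → 1 - r ≤ |z 1| → |z 1| ≤ 1 - e * |z 0| → z ∈ K) ∧
      (∀ z : Plane, z ∉ K → |z 0| ≤ r → 1 - r ≤ |z 1| → z 0 < 0 → z ∈ leftSide K) ∧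
      (∀ z : Plane, z ∉ K → |z 0| ≤ r → 1 - r ≤ |z 1| → 0 < z 0 → z ∈ rightSide K) := by
  obtain ⟨r₁, f₁, hr₁, ho₁, hg₁⟩ := exists_contact_graph hK (Or.inl rfl) htop
  obtain ⟨r₂, f₂, hr₂, ho₂, hg₂⟩ := exists_contact_graph hK (Or.inr rfl) hbot
  obtain ⟨ρ₁, hρ₁, hf₁⟩ := ho₁ e he
  obtain ⟨ρ₂, hρ₂, hf₂⟩ := ho₂ e he
  refine ⟨min (min (min r₁ r₂) (min ρ₁ ρ₂)) (1 / 2),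
    lt_min (lt_min (lt_min hr₁ hr₂) (lt_min hρ₁ hρ₂)) (by norm_num), fun r hrpos hr => ?_⟩
  have hrm : r ≤ min (min r₁ r₂) (min ρ₁ ρ₂) := hr.trans (min_le_left _ _)
  have k1 : r ≤ r₁ := hrm.trans ((min_le_left _ _).trans (min_le_left _ _))
  have k2 : r ≤ r₂ := hrm.trans ((min_le_left _ _).trans (min_le_right _ _))
  have k3 : r ≤ ρ₁ := hrm.trans ((min_le_right _ _).trans (min_le_left _ _))
  have k4 : r ≤ ρ₂ := hrm.trans ((min_le_right _ _).trans (min_le_right _ _))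
  have hrh : r ≤ 1 / 2 := hr.trans (min_le_right _ _)
  have hgraph : ∀ s : ℝ, s = 1 ∨ s = -1 → ∃ f : ℝ → ℝ, (∀ x, |x| ≤ r → |f x| ≤ e * |x|) ∧
      ∀ x y, |x| ≤ r → |s * y - 1| ≤ r → (!₂[x, y] ∈ K ↔ s * y - 1 ≤ f x) := by
    rintro s (rfl | rfl)
    · exact ⟨f₁, fun x hx => hf₁ x (hx.trans k1) (hx.trans k3),
        fun x y hx hy => hg₁ x y (hx.trans k1) (hy.trans k1)⟩
    · exact ⟨f₂, fun x hx => hf₂ x (hx.trans k2) (hx.trans k4),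
        fun x y hx hy => hg₂ x y (hx.trans k2) (hy.trans k2)⟩
  have hsign : ∀ y : ℝ, ∃ s : ℝ, (s = 1 ∨ s = -1) ∧ s * y = |y| := by
    intro y
    rcases le_total 0 y with h | h
    · exact ⟨1, Or.inl rfl, by rw [abs_of_nonneg h, one_mul]⟩
    · exact ⟨-1, Or.inr rfl, by rw [abs_of_nonpos h]; ring⟩
  have hside : ∀ z : Plane, z ∉ K → |z 0| ≤ r → 1 - r ≤ |z 1| → z 0 ≠ 0 →
      ∃ w : Plane, w 0 = z 0 ∧ 1 < |w 1| ∧ (w ∈ leftSide K → z ∈ leftSide K) ∧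
        (w ∈ rightSide K → z ∈ rightSide K) := by
    intro z hz hx hy h0
    rcases lt_or_ge 1 |z 1| with h1 | h1
    · exact ⟨z, rfl, h1, id, id⟩
    obtain ⟨s, hs, hsy⟩ := hsign (z 1)
    obtain ⟨f, hf, hg⟩ := hgraph s hs
    have hss : s * s = 1 := by rcases hs with h | h <;> rw [h] <;> norm_num
    -- The vertical segment going outwards from `z` stays above the graph, hence off `K`, and off
    -- the half-lines since `z 0 ≠ 0`. It ends beyond height `1`, where the sides are known.
    set V : Set Plane := {w | w 0 = z 0 ∧ s * z 1 ≤ s * w 1 ∧ s * w 1 ≤ 1 + r} with hV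
    have hVc : Convex ℝ V := by
      intro a ha b hb c d hc hd hcd
      obtain ⟨a1, a2, a3⟩ := ha
      obtain ⟨b1, b2, b3⟩ := hb
      refine ⟨?_, ?_, ?_⟩
      · simp only [PiLp.add_apply, PiLp.smul_apply, smul_eq_mul, a1, b1]
        rw [← add_mul, hcd, one_mul]
      · simp only [PiLp.add_apply, PiLp.smul_apply, smul_eq_mul]
        calc s * z 1 = c * (s * z 1) + d * (s * z 1) := by rw [← add_mul, hcd, one_mul]
          _ ≤ c * (s * a 1) + d * (s * b 1) := by gcongr
          _ = _ := by ring
      · simp only [PiLp.add_apply, PiLp.smul_apply, smul_eq_mul]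
        calc s * (c * a 1 + d * b 1) = c * (s * a 1) + d * (s * b 1) := by ring
          _ ≤ c * (1 + r) + d * (1 + r) := by gcongr
          _ = 1 + r := by rw [← add_mul, hcd, one_mul]
    have hzK : ¬ (s * z 1 - 1 ≤ f (z 0)) := by
      rw [← hg (z 0) (z 1) hx (by rw [hsy]; exact abs_le.2 ⟨by linarith, by linarith⟩), plane_eta]
      exact hz
    have hVW : V ⊆ (wall K)ᶜ := by
      rintro w ⟨w1, w2, w3⟩ (h | h)
      · rw [← plane_eta w, w1] at h
        have := (hg (z 0) (w 1) hx (abs_le.2 ⟨by linarith, by linarith⟩)).1 h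
        exact hzK (by linarith)
      · exact h0 (by rw [← w1]; exact h.1)
    have hzV : z ∈ V := ⟨rfl, le_rfl, by linarith⟩
    have hwV : !₂[z 0, s * (1 + r)] ∈ V := by
      refine ⟨rfl, ?_, ?_⟩
      · show s * z 1 ≤ s * (s * (1 + r))
        rw [← mul_assoc, hss]; linarith
      · show s * (s * (1 + r)) ≤ 1 + r
        rw [← mul_assoc, hss]; linarith
    refine ⟨!₂[z 0, s * (1 + r)], rfl, ?_, ?_⟩
    · show 1 < |s * (1 + r)|
      have : |s| = 1 := by rcases hs with h | h <;> rw [h] <;> norm_num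
      rw [abs_mul, this, abs_of_pos (by linarith)]; linarith
    · rcases subset_left_or_right hVc.isPreconnected hVW with h | h
      · exact ⟨fun _ => h hzV, fun h' => absurd (h hwV) h'.2⟩
      · exact ⟨fun h' => absurd h' (h hwV).2, fun _ => h hzV⟩
  refine ⟨hrh, fun z hx hy hy2 => ?_, fun z hz hx hy h0 => ?_, fun z hz hx hy h0 => ?_⟩
  · obtain ⟨s, hs, hsy⟩ := hsign (z 1)
    obtain ⟨f, hf, hg⟩ := hgraph s hs
    have hp : 0 ≤ e * |z 0| := by positivity
    rw [← plane_eta z, hg _ _ hx (by rw [hsy]; exact abs_le.2 ⟨by linarith, by linarith⟩), hsy]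
    have := (abs_le.1 (hf _ hx)).1
    linarith
  · obtain ⟨w, w0, w1, hw, -⟩ := hside z hz hx hy h0.ne
    exact hw (outer_left hK (Or.inr ⟨by rwa [w0], w1⟩))
  · obtain ⟨w, w0, w1, -, hw⟩ := hside z hz hx hy h0.ne'
    exact hw (outer_right hK htop hbot (Or.inr ⟨by rwa [w0], w1⟩))

/-- A smooth function which is a step in the first coordinate outside the square `(-1, 1)²`, and
whose gradient vanishes off the inclusion shape except in thin rectangles at the contact points. -/
theorem exists_cell_function (hK : IsInclusionShape K) (htop : !₂[(0 : ℝ), 1] ∈ frontier K)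
    (hbot : !₂[(0 : ℝ), -1] ∈ frontier K) {M : ℝ} (hM : ∀ s, |deriv step s| ≤ M) {e : ℝ}
    (he : 0 < e) (he1 : e ≤ 1) : ∃ t₀ : ℝ, 0 < t₀ ∧ ∀ t, 0 < t → t ≤ t₀ → t ≤ 1 ∧
      ∃ Θ : Plane → ℝ, ContDiff ℝ ∞ Θ ∧
      (∀ z : Plane, 1 ≤ |z 0| ∨ 1 ≤ |z 1| → Θ z = step (z 0 / t)) ∧
      (∀ z ∉ K, ‖fderiv ℝ Θ z‖ ≤ M / t) ∧
      (∀ z ∉ K, t < |z 0| ∨ |z 1| < 1 - e * t → fderiv ℝ Θ z = 0) := by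
  obtain ⟨r₀, hr₀, hr₀b⟩ := exists_contact_box hK htop hbot he
  refine ⟨r₀ / 2, by linarith, fun t htpos htr => ?_⟩
  -- The explicit step varies only for `|z 0| < t`, while the contact boxes reach `r = 2 * t`; the
  -- cut-off `κ` varies in between.
  obtain ⟨r, hrt⟩ : ∃ r, r = 2 * t := ⟨_, rfl⟩
  have hr : 0 < r := by linarith
  obtain ⟨hr1, hbox, hboxL, hboxR⟩ := hr₀b r hr (by linarith)
  -- `Q` avoids the half-lines, so the closures of the two sides are disjoint in it and `Ψ` can be
  -- `0` on the left and `1` on the right.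
  set Q : Set Plane := {z | t ≤ |z 0|} ∪ {z | |z 1| ≤ 1 - t} with hQdef
  have hQ : IsClosed Q := (isClosed_le continuous_const (continuous_coord 0).abs).union
    (isClosed_le (continuous_coord 1).abs continuous_const)
  have hQrays : ∀ z ∈ Q, z ∉ verticalRays := by
    rintro z (h | h) ⟨h0, h1⟩
    · have h' : t ≤ |z 0| := h
      rw [h0, abs_zero] at h'; linarith
    · have h' : |z 1| ≤ 1 - t := h
      linarith
  obtain ⟨Ψ, hΨs, hΨL, hΨR, hΨ⟩ := exists_smooth_urysohn
    (A := closure (leftSide K) ∩ Q) (B := closure (rightSide K) ∩ Q)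
    (isClosed_closure.inter hQ) (isClosed_closure.inter hQ) (by
      rw [Set.disjoint_left]
      rintro z ⟨h1, h2⟩ ⟨h3, -⟩
      exact hQrays z h2 (closure_sides_inter hK h1 h3))
  -- `κ` replaces `Ψ` by the explicit step in the first coordinate near the contact points, where
  -- the two sides touch.
  obtain ⟨κ, hκs, hκ0, hκ1, hκ⟩ := exists_smooth_urysohn
    (A := {z : Plane | r ≤ |z 0|} ∪ {z | |z 1| ≤ 1 - r})
    (B := {z : Plane | |z 0| ≤ t} ∩ {z | 1 - t ≤ |z 1|})
    ((isClosed_le continuous_const (continuous_coord 0).abs).union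
      (isClosed_le (continuous_coord 1).abs continuous_const))
    ((isClosed_le (continuous_coord 0).abs continuous_const).inter
      (isClosed_le continuous_const (continuous_coord 1).abs)) (by
      rw [Set.disjoint_left]
      rintro z (h1 | h1) ⟨h3, h4⟩
      · have h1' : r ≤ |z 0| := h1
        have h3' : |z 0| ≤ t := h3
        linarith
      · have h1' : |z 1| ≤ 1 - r := h1
        have h4' : 1 - t ≤ |z 1| := h4
        linarith)
  have hM0 : 0 ≤ M := (abs_nonneg _).trans (hM 0)
  set E : Plane → ℝ := fun z => step (z 0 / t) with hE
  have hEs : ContDiff ℝ ∞ E := contDiff_step_coord 0 t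
  have hE1 : ∀ z : Plane, t ≤ z 0 → E z = 1 := fun z hz =>
    step_of_ge ((one_le_div htpos).2 hz)
  have hE0 : ∀ z : Plane, z 0 ≤ -t → E z = 0 := fun z hz =>
    step_of_le (by rw [div_le_iff₀ htpos]; linarith)
  have hdiff : ∀ z, HasFDerivAt (fun z => κ z * E z + (1 - κ z) * Ψ z)
      (κ z • fderiv ℝ E z + E z • fderiv ℝ κ z +
        ((1 - κ z) • fderiv ℝ Ψ z + Ψ z • -fderiv ℝ κ z)) z := fun z => by
    have d1 := (hκs.differentiable (by simp) z).hasFDerivAt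
    have d2 := (hEs.differentiable (by simp) z).hasFDerivAt
    have d3 := (hΨs.differentiable (by simp) z).hasFDerivAt
    exact (d1.mul d2).add ((d1.const_sub 1).mul d3)
  -- the gradient off the inclusion
  have hgradQ : ∀ z ∉ K, z ∈ Q →
      fderiv ℝ (fun z => κ z * E z + (1 - κ z) * Ψ z) z = 0 := by
    intro z hzK hzQ
    have hzW : z ∉ wall K := fun h => h.elim hzK (hQrays z hzQ)
    have hΨz : Ψ z = 0 ∨ Ψ z = 1 := (left_or_right hzW).imp
      (fun h => hΨL z ⟨subset_closure h, hzQ⟩) (fun h => hΨR z ⟨subset_closure h, hzQ⟩)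
    have dΨ := fderiv_eq_zero_of_extreme hΨ hΨz
    rw [(hdiff z).fderiv, dΨ]
    by_cases hb : |z 0| < r ∧ 1 - r < |z 1|
    · have hzt : t ≤ |z 0| := by
        by_contra h
        have h' : |z 0| < t := not_le.1 h
        refine hzK (hbox z hb.1.le hb.2.le ?_)
        have h2 : e * |z 0| ≤ 1 * t := by gcongr
        have h3 : |z 1| ≤ 1 - t := hzQ.resolve_left h
        linarith
      -- The two blended functions agree here, so the terms containing the derivative of `κ` cancel.
      have hEΨ : E z = Ψ z ∧ (E z = 0 ∨ E z = 1) := by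
        rcases le_abs.1 hzt with h | h
        · rw [hE1 z h, hΨR z ⟨subset_closure (hboxR z hzK hb.1.le hb.2.le (by linarith)), hzQ⟩]
          exact ⟨rfl, Or.inr rfl⟩
        · rw [hE0 z (by linarith),
            hΨL z ⟨subset_closure (hboxL z hzK hb.1.le hb.2.le (by linarith)), hzQ⟩]
          exact ⟨rfl, Or.inl rfl⟩
      have dE : fderiv ℝ E z = 0 := fderiv_eq_zero_of_extreme (fun z => step_mem _) hEΨ.2
      rw [dE, hEΨ.1]
      simp
    · have hκz : κ z = 0 := by
        refine hκ0 z ?_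
        rcases not_and_or.1 hb with h | h
        · exact Or.inl (not_lt.1 h)
        · exact Or.inr (not_lt.1 h)
      rw [fderiv_eq_zero_of_extreme hκ (Or.inl hκz), hκz]
      simp
  have hκz1 : ∀ z ∉ Q, κ z = 1 := fun z hzQ => by
    have h1 : |z 0| < t := not_le.1 fun h => hzQ (Or.inl h)
    have h2 : 1 - t < |z 1| := not_le.1 fun h => hzQ (Or.inr h)
    exact hκ1 z ⟨h1.le, h2.le⟩
  have hgradB : ∀ z ∉ Q, fderiv ℝ (fun z => κ z * E z + (1 - κ z) * Ψ z) z = fderiv ℝ E z := by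
    intro z hzQ
    have hκz := hκz1 z hzQ
    rw [(hdiff z).fderiv, fderiv_eq_zero_of_extreme hκ (Or.inr hκz), hκz]
    simp
  refine ⟨by linarith, fun z => κ z * E z + (1 - κ z) * Ψ z, by fun_prop,
    fun z hz => ?_, fun z hzK => ?_, fun z hzK hz => ?_⟩
  · change κ z * E z + (1 - κ z) * Ψ z = E z
    by_cases hzQ : z ∈ Q
    · have hzt : t ≤ |z 0| := by
        rcases hz with h | h
        · linarith
        · refine hzQ.resolve_right fun h' => ?_
          have h'' : |z 1| ≤ 1 - t := h'
          linarith
      have hout : ∀ c : ℝ, 1 < c → 1 < |(c • z) 0| ∨ 1 < |(c • z) 1| := by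
        intro c hc
        simp only [PiLp.smul_apply, smul_eq_mul, abs_mul, abs_of_pos (by linarith : 0 < c)]
        exact hz.imp (fun h => by nlinarith) (fun h => by nlinarith)
      have hEΨ : E z = Ψ z := by
        rcases le_abs.1 hzt with h | h
        · rw [hE1 z h, hΨR z ⟨mem_closure_of_one_lt_smul fun c hc => ?_, hzQ⟩]
          have h0 : 0 < (c • z) 0 := by
            simp only [PiLp.smul_apply, smul_eq_mul]
            exact mul_pos (by linarith) (by linarith)
          exact outer_right hK htop hbot ((hout c hc).imp (fun h => by rwa [abs_of_pos h0] at h)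
            (fun h => ⟨h0, h⟩))
        · rw [hE0 z (by linarith), hΨL z ⟨mem_closure_of_one_lt_smul fun c hc => ?_, hzQ⟩]
          have h0 : (c • z) 0 < 0 := by
            simp only [PiLp.smul_apply, smul_eq_mul]
            exact mul_neg_of_pos_of_neg (by linarith) (by linarith)
          exact outer_left hK ((hout c hc).imp
            (fun h => by rw [abs_of_neg h0] at h; linarith) (fun h => ⟨h0, h⟩))
      rw [hEΨ]; ring
    · rw [hκz1 z hzQ]; ring
  · by_cases hzQ : z ∈ Q
    · rw [hgradQ z hzK hzQ, norm_zero]; positivity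
    · rw [hgradB z hzQ]
      exact norm_fderiv_step_coord_le hM htpos 0 z
  · by_cases hzQ : z ∈ Q
    · exact hgradQ z hzK hzQ
    · exfalso
      have h1 : |z 0| < t := not_le.1 fun h => hzQ (Or.inl h)
      have h2 : 1 - t < |z 1| := not_le.1 fun h => hzQ (Or.inr h)
      refine hzK (hbox z (by linarith) (by linarith) ?_)
      rcases hz with h | h
      · linarith
      · have : e * |z 0| ≤ e * t := by gcongr
        linarith

end cell

end

/-! ### Pairings with fields bounded in `L²_loc` -/

lemma inner_gradient_eq (φ : Plane → ℝ) (z w : Plane) :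
    inner ℝ w (gradient φ z) = fderiv ℝ φ z w := by
  rw [real_inner_comm, gradient, InnerProductSpace.toDual_symm_apply]

/-- Fields bounded in `L²_loc` have integrals over a bounded set controlled by its area. -/
lemma exists_setIntegral_norm_le {v : ℕ → Plane → Plane} (hv : IsBoundedL2Loc v) (R : ℝ) :
    ∃ C : ℝ, 0 ≤ C ∧ ∀ n, ∀ A : Set Plane, MeasurableSet A → A ⊆ Metric.ball 0 R →
      IntegrableOn (v n) A ∧ ∫ z in A, ‖v n z‖ ≤ C * √(volume.real A) := by
  obtain ⟨C, hC⟩ := hv.2 R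
  refine ⟨C, C.2, fun n A hA hAR => ?_⟩
  have hfin : volume A < ⊤ := lt_of_le_of_lt (measure_mono hAR) measure_ball_lt_top
  have hsm : AEStronglyMeasurable (v n) (volume.restrict A) := (hv.1 n).restrict
  have h2 : eLpNorm (v n) 2 (volume.restrict A) ≤ C :=
    (eLpNorm_mono_measure _ (Measure.restrict_mono hAR le_rfl)).trans (hC n)
  have h1 : eLpNorm (v n) 1 (volume.restrict A) ≤ C * (volume A) ^ (1 / 2 : ℝ) := by
    refine (eLpNorm_le_eLpNorm_mul_rpow_measure_univ (p := 1) (q := 2) (by norm_num) hsm).trans ?_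
    rw [Measure.restrict_apply_univ]
    have : (1 / (1 : ℝ≥0∞).toReal - 1 / (2 : ℝ≥0∞).toReal) = 1 / 2 := by norm_num
    rw [this]
    gcongr
  have htop : C * (volume A) ^ (1 / 2 : ℝ) < ⊤ :=
    ENNReal.mul_lt_top ENNReal.coe_lt_top (ENNReal.rpow_lt_top_of_nonneg (by norm_num) hfin.ne)
  refine ⟨memLp_one_iff_integrable.1 ⟨hsm, h1.trans_lt htop⟩, ?_⟩
  rw [integral_norm_eq_lintegral_enorm hsm, ← eLpNorm_one_eq_lintegral_enorm]
  refine (ENNReal.toReal_mono htop.ne h1).trans (le_of_eq ?_)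
  rw [ENNReal.toReal_mul, ENNReal.coe_toReal, ← ENNReal.toReal_rpow, Real.sqrt_eq_rpow]
  rfl

/-- Integrability of the pairing of a field with a bounded form of bounded support. -/
lemma integrableOn_pairing {v : ℕ → Plane → Plane} (hv : IsBoundedL2Loc v) (n : ℕ)
    {Ω : Set Plane} (hΩ : MeasurableSet Ω) {ξ : Plane → Plane →L[ℝ] ℝ}
    (hξ : AEStronglyMeasurable ξ (volume.restrict Ω)) {c R : ℝ} (hc : ∀ z ∈ Ω, ‖ξ z‖ ≤ c)
    (hR : ∀ z ∈ Ω, R < ‖z‖ → ξ z = 0) : IntegrableOn (fun z => ξ z (v n z)) Ω := by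
  obtain ⟨C, -, hC⟩ := exists_setIntegral_norm_le hv (R + 1)
  have hint := (hC n (Metric.ball 0 (R + 1)) measurableSet_ball subset_rfl).1.norm
  have hint' : IntegrableOn (fun z => |c| * (Metric.ball 0 (R + 1)).indicator (fun z => ‖v n z‖) z)
      Ω := ((integrable_indicator_iff measurableSet_ball).2 hint).integrableOn.const_mul _
  refine hint'.mono' ((ContinuousLinearMap.id ℝ (Plane →L[ℝ] ℝ)).aestronglyMeasurable_comp₂ hξ (hv.1 n).restrict) ?_
  refine (ae_restrict_iff' hΩ).2 (Eventually.of_forall fun z hz => ?_)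
  by_cases hzR : z ∈ Metric.ball (0 : Plane) (R + 1)
  · rw [indicator_of_mem hzR]
    exact (ContinuousLinearMap.le_opNorm _ _).trans
      (mul_le_mul_of_nonneg_right ((hc z hz).trans (le_abs_self c)) (norm_nonneg _))
  · rw [hR z hz (by rw [mem_ball_zero_iff] at hzR; linarith)]
    rw [zero_apply, norm_zero]
    exact mul_nonneg (abs_nonneg _) (indicator_nonneg (fun _ _ => norm_nonneg _) _)

/-- Comparison of two pairings whose forms differ only on the small sets `A` and `B`. -/
lemma abs_pairing_sub_le {v : ℕ → Plane → Plane} {n : ℕ} {C R : ℝ}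
    (hC : ∀ A : Set Plane, MeasurableSet A → A ⊆ Metric.ball 0 R →
      IntegrableOn (v n) A ∧ ∫ z in A, ‖v n z‖ ≤ C * √(volume.real A))
    {Ω F : Set Plane} (hΩ : MeasurableSet Ω) (hF : MeasurableSet F)
    {ξ ζ : Plane → Plane →L[ℝ] ℝ} (hξ : IntegrableOn (fun z => ξ z (v n z)) Ω)
    (hζ : IntegrableOn (fun z => ζ z (v n z)) F) {A B : Set Plane} (hA : MeasurableSet A)
    (hB : MeasurableSet B) (hAR : A ⊆ Metric.ball 0 R) (hBR : B ⊆ Metric.ball 0 R) {a b : ℝ}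
    (ha : 0 ≤ a) (hb : 0 ≤ b)
    (h : ∀ z, ‖Ω.indicator ξ z - F.indicator ζ z‖ ≤
      A.indicator (fun _ => a) z + B.indicator (fun _ => b) z) :
    |(∫ z in Ω, ξ z (v n z)) - ∫ z in F, ζ z (v n z)| ≤
      C * (a * √(volume.real A) + b * √(volume.real B)) := by
  rw [← integral_indicator hΩ, ← integral_indicator hF,
    ← integral_sub ((integrable_indicator_iff hΩ).2 hξ) ((integrable_indicator_iff hF).2 hζ),
    ← Real.norm_eq_abs]
  have iA := (integrable_indicator_iff hA).2 (hC A hA hAR).1.norm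
  have iB := (integrable_indicator_iff hB).2 (hC B hB hBR).1.norm
  have hbound := (iA.const_mul a).add (iB.const_mul b)
  refine (norm_integral_le_of_norm_le hbound (Eventually.of_forall fun z => ?_)).trans ?_
  · have e1 : Ω.indicator (fun z => ξ z (v n z)) z - F.indicator (fun z => ζ z (v n z)) z =
        (Ω.indicator ξ z - F.indicator ζ z) (v n z) := by
      by_cases h1 : z ∈ Ω <;> by_cases h2 : z ∈ F <;> simp [h1, h2]
    rw [e1]
    refine (ContinuousLinearMap.le_opNorm _ _).trans
      ((mul_le_mul_of_nonneg_right (h z) (norm_nonneg _)).trans (le_of_eq ?_))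
    by_cases h1 : z ∈ A <;> by_cases h2 : z ∈ B <;> simp [h1, h2, add_mul]
  · rw [integral_add' (iA.const_mul a) (iB.const_mul b), integral_const_mul, integral_const_mul,
      integral_indicator hA, integral_indicator hB, mul_add]
    have h1 := mul_le_mul_of_nonneg_left (hC A hA hAR).2 ha
    have h2 := mul_le_mul_of_nonneg_left (hC B hB hBR).2 hb
    linarith

/-- Data of a function which is smooth on the open set `U`, bounded there with its gradient, and
zero at large. -/
structure IsTameOn (U : Set Plane) (q : Plane → ℝ) (C R : ℝ) : Prop where
  smooth : ContDiffOn ℝ ∞ q U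
  bound : ∀ z ∈ U, |q z| ≤ C
  bound_fderiv : ∀ z ∈ U, ‖fderiv ℝ q z‖ ≤ C
  zero_at_large : ∀ z ∈ U, R < ‖z‖ → q z = 0

lemma IsTameOn.fderiv_zero_at_large {U : Set Plane} {q : Plane → ℝ} {C R : ℝ}
    (h : IsTameOn U q C R) (hU : IsOpen U) {z : Plane} (hz : z ∈ U) (hR : R < ‖z‖) :
    fderiv ℝ q z = 0 := by
  have : q =ᶠ[𝓝 z] fun _ => 0 := by
    filter_upwards [hU.mem_nhds hz, continuous_norm.continuousAt.eventually_const_lt hR] with y h1 h2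
    exact h.zero_at_large y h1 h2
  rw [this.fderiv_eq]; simp

lemma IsTameOn.differentiableAt {U : Set Plane} {q : Plane → ℝ} {C R : ℝ}
    (h : IsTameOn U q C R) (hU : IsOpen U) {z : Plane} (hz : z ∈ U) : DifferentiableAt ℝ q z :=
  (h.smooth.contDiffAt (hU.mem_nhds hz)).differentiableAt (by simp)

lemma IsTameOn.mono {U V : Set Plane} {q : Plane → ℝ} {C R : ℝ}
    (h : IsTameOn U q C R) (hVU : V ⊆ U) : IsTameOn V q C R :=
  ⟨h.smooth.mono hVU, fun z hz => h.bound z (hVU hz), fun z hz => h.bound_fderiv z (hVU hz),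
    fun z hz => h.zero_at_large z (hVU hz)⟩

lemma IsTameOn.aestronglyMeasurable {U : Set Plane} {q : Plane → ℝ} {C R : ℝ}
    (h : IsTameOn U q C R) (hU : IsOpen U) :
    AEStronglyMeasurable (fderiv ℝ q) (volume.restrict U) :=
  (h.smooth.continuousOn_fderiv_of_isOpen hU (by simp)).aestronglyMeasurable hU.measurableSet

lemma IsTameOn.integrableOn {U : Set Plane} {q : Plane → ℝ} {C R : ℝ}
    (h : IsTameOn U q C R) (hU : IsOpen U) {v : ℕ → Plane → Plane} (hv : IsBoundedL2Loc v) (n : ℕ) :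
    IntegrableOn (fun z => fderiv ℝ q z (v n z)) U :=
  integrableOn_pairing hv n hU.measurableSet (h.aestronglyMeasurable hU)
    h.bound_fderiv (fun _ hz hR => h.fderiv_zero_at_large hU hz hR)

/-! ### Reduction to dilated test functions -/

/-- Dilation with centre `m` and ratio `l`. -/
def dilate (m : Plane) (l : ℝ) (z : Plane) : Plane := m + l • (z - m)

lemma contDiff_dilate (m : Plane) (l : ℝ) : ContDiff ℝ ∞ (dilate m l) := by
  unfold dilate; fun_prop

lemma hasFDerivAt_dilate (m : Plane) (l : ℝ) (z : Plane) :
    HasFDerivAt (dilate m l) (l • ContinuousLinearMap.id ℝ Plane) z :=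
  (((hasFDerivAt_id z).sub_const m).const_smul l).const_add m

lemma fderiv_comp_dilate {p : Plane → ℝ} {m z : Plane} {l : ℝ}
    (h : DifferentiableAt ℝ p (dilate m l z)) :
    fderiv ℝ (p ∘ dilate m l) z = l • fderiv ℝ p (dilate m l z) := by
  rw [(h.hasFDerivAt.comp z (hasFDerivAt_dilate m l z)).fderiv]
  ext w; simp

/-- The bound on the second derivative makes the gradient Lipschitz along segments of `Ω`, which
controls the error made by a dilation. -/
lemma IsTestFunction.exists_bounds {Ω : Set Plane} (hΩ : IsOpen Ω) {p : Plane → ℝ}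
    (hp : IsTestFunction Ω p) : ∃ C R : ℝ, 0 ≤ C ∧ 0 ≤ R ∧ IsTameOn Ω p C R ∧
      (∀ z ∈ Ω, DifferentiableAt ℝ (fderiv ℝ p) z) ∧
      ∀ z ∈ Ω, ‖fderiv ℝ (fderiv ℝ p) z‖ ≤ C := by
  obtain ⟨C₀, h0⟩ := hp.bounded 0
  obtain ⟨C₁, h1⟩ := hp.bounded 1
  obtain ⟨C₂, h2⟩ := hp.bounded 2
  obtain ⟨R, hR⟩ := hp.zero_at_large
  set C := max (max C₀ C₁) (max C₂ 0) with hC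
  have k0 : C₀ ≤ C := (le_max_left _ _).trans (le_max_left _ _)
  have k1 : C₁ ≤ C := (le_max_right _ _).trans (le_max_left _ _)
  have k2 : C₂ ≤ C := (le_max_left _ _).trans (le_max_right _ _)
  have k3 : 0 ≤ C := (le_max_right _ _).trans (le_max_right _ _)
  refine ⟨C, max R 0, k3, le_max_right _ _, ⟨hp.smooth, fun z hz => ?_, fun z hz => ?_,
    fun z hz h => hR z hz (lt_of_le_of_lt (le_max_left _ _) h)⟩, fun z hz => ?_, fun z hz => ?_⟩
  · have := (h0 z hz).trans k0
    rwa [norm_iteratedFDeriv_zero, Real.norm_eq_abs] at this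
  · have := (h1 z hz).trans k1
    rwa [norm_iteratedFDeriv_one] at this
  · exact ((hp.smooth.contDiffAt (hΩ.mem_nhds hz)).fderiv_right (m := 1)
      (WithTop.coe_le_coe.2 le_top)).differentiableAt (by simp)
  · have := (h2 z hz).trans k2
    rwa [← norm_iteratedFDeriv_fderiv (n := 1), norm_iteratedFDeriv_one] at this

/-- It suffices to test against the dilations of a test function. -/
theorem tendsto_pairing_of_dilations {v : ℕ → Plane → Plane} (hv : IsBoundedL2Loc v)
    {Ω : Set Plane} (hΩ : IsOpen Ω) {m : Plane}
    (hstar : ∀ z ∈ Ω, ∀ l : ℝ, 1 ≤ l → dilate m l z ∈ Ω) {p : Plane → ℝ}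
    (hp : IsTestFunction Ω p)
    (h : ∀ l : ℝ, 1 < l → ∀ C R : ℝ, 0 ≤ C → 0 ≤ R →
      IsTameOn (dilate m l ⁻¹' Ω) (p ∘ dilate m l) C R →
      Tendsto (fun n => ∫ z in Ω, fderiv ℝ (p ∘ dilate m l) z (v n z)) atTop (𝓝 0)) :
    Tendsto (fun n => ∫ z in Ω, inner ℝ (v n z) (gradient p z)) atTop (𝓝 0) := by
  simp only [inner_gradient_eq]
  obtain ⟨C, R, hC, hR, htame, hd2, hb2⟩ := hp.exists_bounds hΩ
  -- Beyond this radius `p` and all its dilated versions with `l ≥ 1` vanish, as `‖dilate m l z‖ ≥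
  -- ‖z‖ - 2 * ‖m‖` there.
  set R' := R + 2 * ‖m‖ with hR'
  have hm := norm_nonneg m
  have hnorm : ∀ z l, (1 : ℝ) ≤ l → R' < ‖z‖ → R < ‖dilate m l z‖ := by
    intro z l hl hz
    have e1 : ‖z‖ - ‖m‖ ≤ ‖z - m‖ := norm_sub_norm_le z m
    have e2 : ‖l • (z - m)‖ = l * ‖z - m‖ := by
      rw [norm_smul, Real.norm_of_nonneg (by linarith)]
    have e3 : ‖l • (z - m)‖ - ‖m‖ ≤ ‖dilate m l z‖ := by
      have := norm_sub_norm_le (l • (z - m)) (-m)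
      rw [norm_neg, sub_neg_eq_add, add_comm (l • (z - m)) m] at this
      exact this
    nlinarith [norm_nonneg (z - m)]
  have htl : ∀ l : ℝ, 1 < l → IsTameOn (dilate m l ⁻¹' Ω) (p ∘ dilate m l) (l * C) R' := by
    intro l hl
    refine ⟨htame.smooth.comp (contDiff_dilate m l).contDiffOn (fun z hz => hz), fun z hz => ?_,
      fun z hz => ?_, fun z hz hzR => htame.zero_at_large _ hz (hnorm z l hl.le hzR)⟩
    · exact (htame.bound _ hz).trans (by nlinarith)
    · rw [fderiv_comp_dilate (htame.differentiableAt hΩ hz), norm_smul,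
        Real.norm_of_nonneg (by linarith)]
      exact mul_le_mul_of_nonneg_left (htame.bound_fderiv _ hz) (by linarith)
  obtain ⟨C', hC', hpair⟩ := exists_setIntegral_norm_le hv (R' + 1)
  -- The second term bounds the variation of the gradient over the displacement `(l - 1) • (z - m)`;
  -- the first accounts for the factor `l` of the chain rule.
  set D := C + C * (R' + 1 + ‖m‖) with hD
  have hDpos : 0 ≤ D := by positivity
  set W := √(volume.real (Metric.ball (0 : Plane) (R' + 1))) with hW
  have hclose : ∀ l : ℝ, 1 < l → ∀ n, |(∫ z in Ω, fderiv ℝ p z (v n z)) -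
      ∫ z in Ω, fderiv ℝ (p ∘ dilate m l) z (v n z)| ≤ (l - 1) * (C' * (D * W)) := by
    intro l hl n
    have hsub : Ω ⊆ dilate m l ⁻¹' Ω := fun z hz => hstar z hz l hl.le
    have htl' := (htl l hl).mono hsub
    have hl0 : 0 ≤ l - 1 := by linarith
    have := abs_pairing_sub_le (hpair n) hΩ.measurableSet hΩ.measurableSet
      (htame.integrableOn hΩ hv n) (htl'.integrableOn hΩ hv n)
      (A := Metric.ball 0 (R' + 1)) (B := ∅) measurableSet_ball MeasurableSet.empty subset_rfl
      (empty_subset _) (a := (l - 1) * D) (b := 0) (by positivity) le_rfl (fun z => ?_)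
    · refine this.trans (le_of_eq ?_)
      rw [zero_mul, add_zero]; ring
    · rw [indicator_empty, add_zero]
      by_cases hz : z ∈ Ω
      swap
      · rw [indicator_of_notMem hz, indicator_of_notMem hz, sub_zero, norm_zero]
        exact indicator_nonneg (fun _ _ => by positivity) _
      rw [indicator_of_mem hz, indicator_of_mem hz]
      by_cases hzR : z ∈ Metric.ball (0 : Plane) (R' + 1)
      · rw [indicator_of_mem hzR]
        rw [mem_ball_zero_iff] at hzR
        -- The segment from `z` to its dilate stays in `Ω`, so the mean value inequality applies
        -- even if `p` jumps across the obstacle.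
        have hseg : segment ℝ z (dilate m l z) ⊆ Ω := by
          rintro y ⟨s, t, hs, ht, hst, rfl⟩
          have : s • z + t • dilate m l z = dilate m (1 + t * (l - 1)) z := by
            have hs' : s = 1 - t := by linarith
            rw [hs']
            simp only [dilate]
            module
          rw [this]
          exact hstar z hz _ (by nlinarith)
        have hmv := (convex_segment z (dilate m l z)).norm_image_sub_le_of_norm_fderiv_le
          (fun y hy => hd2 y (hseg hy)) (fun y hy => hb2 y (hseg hy))
          (left_mem_segment ℝ _ _) (right_mem_segment ℝ _ _)
        have hdz : dilate m l z - z = (l - 1) • (z - m) := by simp only [dilate]; module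
        rw [hdz, norm_smul, Real.norm_of_nonneg hl0] at hmv
        have hzm : ‖z - m‖ ≤ R' + 1 + ‖m‖ := (norm_sub_le z m).trans (by linarith)
        rw [fderiv_comp_dilate (htame.differentiableAt hΩ (hsub hz))]
        set g1 := fderiv ℝ p z
        set g2 := fderiv ℝ p (dilate m l z) with hg2
        have e : g1 - l • g2 = -(g2 - g1) - (l - 1) • g2 := by module
        rw [e]
        have hg2b : ‖g2‖ ≤ C := htame.bound_fderiv _ (hsub hz)
        calc ‖-(g2 - g1) - (l - 1) • g2‖ ≤ ‖-(g2 - g1)‖ + ‖(l - 1) • g2‖ := norm_sub_le _ _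
          _ = ‖g2 - g1‖ + (l - 1) * ‖g2‖ := by
            rw [norm_neg, norm_smul, Real.norm_of_nonneg hl0]
          _ ≤ C * ((l - 1) * (R' + 1 + ‖m‖)) + (l - 1) * C := by
            refine add_le_add (hmv.trans ?_) (mul_le_mul_of_nonneg_left hg2b hl0)
            gcongr
          _ = (l - 1) * D := by rw [hD]; ring
      · rw [mem_ball_zero_iff, not_lt] at hzR
        rw [htame.fderiv_zero_at_large hΩ hz (by rw [hR'] at hzR; linarith),
          htl'.fderiv_zero_at_large hΩ hz (by linarith), sub_zero, norm_zero]
        exact indicator_nonneg (fun _ _ => by positivity) _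
  rw [Metric.tendsto_atTop]
  intro e he
  set l := 1 + e / (2 * (C' * (D * W) + 1)) with hl
  have hCDW : 0 ≤ C' * (D * W) := by positivity
  have hl1 : 1 < l := by rw [hl]; linarith [show 0 < e / (2 * (C' * (D * W) + 1)) by positivity]
  have hsmall : (l - 1) * (C' * (D * W)) < e / 2 := by
    have : (l - 1) * (C' * (D * W) + 1) = e / 2 := by 
      have hX : C' * (D * W) + 1 ≠ 0 := by positivity
      rw [hl]
      generalize C' * (D * W) + 1 = X at hX
      field_simp; ring
    nlinarith
  obtain ⟨N, hN⟩ := Metric.tendsto_atTop.1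
    (h l hl1 (l * C) R' (by positivity) (by positivity) (htl l hl1)) (e / 2) (by positivity)
  refine ⟨N, fun n hn => ?_⟩
  have h1 := hN n hn
  have h2 := hclose l hl1 n
  rw [Real.dist_eq, sub_zero] at h1 ⊢
  have h3 := abs_sub_abs_le_abs_sub (∫ z in Ω, fderiv ℝ p z (v n z))
    (∫ z in Ω, fderiv ℝ (p ∘ dilate m l) z (v n z))
  linarith

/-! ### Rectangles, ramps and interpolation across a slit -/

lemma norm_le_abs_add_abs (z : Plane) : ‖z‖ ≤ |z 0| + |z 1| := by
  rw [EuclideanSpace.norm_eq, Fin.sum_univ_two, Real.norm_eq_abs, Real.norm_eq_abs]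
  refine Real.sqrt_le_iff.2 ⟨by positivity, ?_⟩
  nlinarith [abs_nonneg (z 0), abs_nonneg (z 1)]

/-- A closed rectangle with sides parallel to the axes. -/
def rect (a b c d : ℝ) : Set Plane := {z | z 0 ∈ Icc a b ∧ z 1 ∈ Icc c d}

lemma isClosed_rect (a b c d : ℝ) : IsClosed (rect a b c d) :=
  (isClosed_Icc.preimage (continuous_coord 0)).inter (isClosed_Icc.preimage (continuous_coord 1))

lemma volume_rect (a b c d : ℝ) :
    volume (rect a b c d) = ENNReal.ofReal (b - a) * ENNReal.ofReal (d - c) := by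
  have h : rect a b c d = (WithLp.ofLp : Plane → Fin 2 → ℝ) ⁻¹' Icc ![a, c] ![b, d] := by
    ext z
    simp only [rect, mem_ofPred_eq, mem_Icc, mem_preimage, Pi.le_def, Fin.forall_fin_two,
      Matrix.cons_val_zero, Matrix.cons_val_one]
    tauto
  rw [h, (PiLp.volume_preserving_ofLp (Fin 2)).measure_preimage
    measurableSet_Icc.nullMeasurableSet, Real.volume_Icc_pi, Fin.prod_univ_two]
  simp

lemma volume_real_rect_le {a b c d : ℝ} (hab : a ≤ b) (hcd : c ≤ d) :
    volume.real (rect a b c d) = (b - a) * (d - c) := by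
  rw [measureReal_def, volume_rect, ENNReal.toReal_mul, ENNReal.toReal_ofReal (by linarith),
    ENNReal.toReal_ofReal (by linarith)]

/-- A smooth function equal to the identity on `[1, ∞)` and bounded below by `1 / 2`. -/
def ramp (s : ℝ) : ℝ := 1 + step (4 * s - 3) * (s - 1)

lemma contDiff_ramp : ContDiff ℝ ∞ ramp := by
  have : ContDiff ℝ ∞ fun s : ℝ => step (4 * s - 3) := contDiff_step.comp (by fun_prop)
  unfold ramp; fun_prop

lemma ramp_of_ge {s : ℝ} (h : 1 ≤ s) : ramp s = s := by
  rw [ramp, step_of_ge (by linarith)]; ring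

lemma half_le_ramp (s : ℝ) : 1 / 2 ≤ ramp s := by
  rw [ramp]
  have h0 := step_nonneg (4 * s - 3)
  have h1 := step_le_one (4 * s - 3)
  rcases le_total s (1 / 2) with h | h
  · rw [step_of_le (by linarith)]; norm_num
  · nlinarith

lemma ramp_le_one {s : ℝ} (h : s ≤ 1) : ramp s ≤ 1 := by
  rw [ramp]
  nlinarith [step_nonneg (4 * s - 3)]

lemma abs_deriv_ramp_le {M : ℝ} (hM : ∀ s, |deriv step s| ≤ M) (s : ℝ) :
    |deriv ramp s| ≤ 2 * M + 1 := by
  have h1 : HasDerivAt (fun s : ℝ => 4 * s - 3) 4 s := by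
    simpa using ((hasDerivAt_id s).const_mul 4).sub_const 3
  have h2 : HasDerivAt (step ∘ fun s : ℝ => 4 * s - 3) (deriv step (4 * s - 3) * 4) s :=
    (contDiff_step.differentiable (by simp) _).hasDerivAt.comp s h1
  have h3 : HasDerivAt ramp (deriv step (4 * s - 3) * 4 * (s - 1) + step (4 * s - 3) * 1) s :=
    (h2.mul ((hasDerivAt_id s).sub_const 1)).const_add 1
  rw [h3.deriv]
  have h4 : |step (4 * s - 3) * 1| ≤ 1 := by
    rw [mul_one, abs_of_nonneg (step_nonneg _)]; exact step_le_one _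
  have h5 : |deriv step (4 * s - 3) * 4 * (s - 1)| ≤ 2 * M := by
    have hM0 : 0 ≤ M := (abs_nonneg _).trans (hM 0)
    by_cases h : 1 ≤ |4 * s - 3|
    · rw [deriv_step_eq_zero h]; simpa using hM0
    · have := abs_lt.1 (not_le.1 h)
      have hs : |s - 1| ≤ 1 / 2 := abs_le.2 ⟨by linarith, by linarith⟩
      rw [abs_mul, abs_mul, abs_of_pos (by norm_num : (0 : ℝ) < 4)]
      nlinarith [hM (4 * s - 3), abs_nonneg (s - 1), abs_nonneg (deriv step (4 * s - 3))]
  exact (abs_add_le _ _).trans (by linarith)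

/-- The unit vertical vector. -/
def vert : Plane := EuclideanSpace.single 1 1

lemma norm_vert : ‖vert‖ = 1 := by simp [vert]

/-- The vertical shear `(x, y) ↦ (x, g y)`. -/
def reheight (g : ℝ → ℝ) (z : Plane) : Plane := z + (g (z 1) - z 1) • vert

lemma reheight_zero (g : ℝ → ℝ) (z : Plane) : reheight g z 0 = z 0 := by
  simp [reheight, vert]

lemma reheight_one (g : ℝ → ℝ) (z : Plane) : reheight g z 1 = g (z 1) := by
  simp [reheight, vert]

lemma contDiff_reheight {g : ℝ → ℝ} (hg : ContDiff ℝ ∞ g) : ContDiff ℝ ∞ (reheight g) := by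
  have h1 := contDiff_coord 1
  have : ContDiff ℝ ∞ fun z : Plane => g (z 1) := hg.comp h1
  unfold reheight; fun_prop

lemma norm_fderiv_reheight_le {g : ℝ → ℝ} (hg : ContDiff ℝ ∞ g) {L : ℝ}
    (hL : ∀ s, |deriv g s| ≤ L) (z : Plane) : ‖fderiv ℝ (reheight g) z‖ ≤ L + 2 := by
  have hd : Differentiable ℝ fun s => g s - s := (hg.differentiable (by simp)).sub differentiable_id
  have h0 : Differentiable ℝ fun z : Plane => g (z 1) - z 1 :=
    hd.comp ((contDiff_coord 1).differentiable (by simp))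
  have h1 : HasFDerivAt (reheight g) _ z :=
    (hasFDerivAt_id z).add ((h0 z).hasFDerivAt.smul_const vert)
  rw [h1.fderiv]
  have h2 : ‖fderiv ℝ (fun z : Plane => g (z 1) - z 1) z‖ ≤ L + 1 := by
    refine (norm_fderiv_comp_coord_le (g := fun s => g s - s) 1 z hd.differentiableAt).trans ?_
    have h3 : deriv (fun s => g s - s) (z 1) = deriv g (z 1) - 1 :=
      (((hg.differentiable (by simp)) (z 1)).hasDerivAt.sub (hasDerivAt_id _)).deriv
    rw [h3]
    have := abs_sub (deriv g (z 1)) 1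
    rw [abs_one] at this
    linarith [hL (z 1)]
  refine (norm_add_le _ _).trans ?_
  rw [ContinuousLinearMap.norm_smulRight_apply, norm_vert, mul_one]
  linarith [ContinuousLinearMap.norm_id_le (𝕜 := ℝ) (E := Plane)]

/-- The exterior of the shortened segment `[δ, 1 - δ] × {0}`. -/
def slitExterior (δ : ℝ) : Set Plane := {z | z 0 ∈ Icc δ (1 - δ) ∧ z 1 = 0}ᶜ

lemma isOpen_slitExterior (δ : ℝ) : IsOpen (slitExterior δ) :=
  ((isClosed_Icc.preimage (continuous_coord 0)).inter
    (isClosed_eq (continuous_coord 1) continuous_const)).isOpen_compl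

lemma mem_slitExterior_of_ne {δ : ℝ} {z : Plane} (h : z 1 ≠ 0) : z ∈ slitExterior δ :=
  fun hz => h hz.2

lemma mem_slitExterior_of_notMem {δ : ℝ} {z : Plane} (h : z 0 ∉ Icc δ (1 - δ)) :
    z ∈ slitExterior δ := fun hz => h hz.1

/-- Interpolation, in a thin strip, between the traces of a function on the two sides of a slit. -/
lemma exists_interpolation {q : Plane → ℝ} {C R δ : ℝ} (hC : 0 ≤ C)
    (hq : IsTameOn (slitExterior δ) q C R) : ∃ C' : ℝ, 0 ≤ C' ∧ ∀ h : ℝ, 0 < h → ∃ φ : Plane → ℝ,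
      ContDiff ℝ ∞ φ ∧ (∀ z, R + 2 * h < ‖z‖ → φ z = 0) ∧
      (∀ z, h < |z 1| → fderiv ℝ φ z = fderiv ℝ q z) ∧
      (∀ z, |z 1| ≤ h → z 0 ∉ Icc δ (1 - δ) → ‖fderiv ℝ φ z‖ ≤ C') ∧
      (∀ z, |z 1| ≤ h → ‖fderiv ℝ φ z‖ ≤ C' + C' / h) := by
  obtain ⟨M, hM⟩ := exists_deriv_step_bound
  have hM0 : 0 ≤ M := (abs_nonneg _).trans (hM 0)
  set L := 2 * M + 1 with hL
  have hU := isOpen_slitExterior δ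
  refine ⟨C * (L + 2) + 2 * C * M, by positivity, fun h hh => ?_⟩
  -- `g` is positive, and is the identity above `h`: `reheight g` folds the plane into the upper
  -- half-plane, so that `u` continues the upper branch of `q` smoothly below the slit. Its mirror
  -- image `k` does the same for the lower branch.
  set g : ℝ → ℝ := fun y => h * ramp (y / h) with hg
  have hgs : ContDiff ℝ ∞ g := contDiff_const.mul (contDiff_ramp.comp (by fun_prop))
  have hgpos : ∀ y, 0 < g y := fun y => mul_pos hh (by linarith [half_le_ramp (y / h)])
  have hgid : ∀ y, h ≤ y → g y = y := fun y hy => by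
    simp only [hg]; rw [ramp_of_ge ((one_le_div hh).2 hy)]; field_simp
  have hgle : ∀ y, y ≤ h → g y ≤ h := fun y hy => by
    simp only [hg]
    exact mul_le_of_le_one_right hh.le (ramp_le_one ((div_le_one hh).2 hy))
  have hgd : ∀ y, |deriv g y| ≤ L := fun y => by
    have h1 : HasDerivAt (fun y : ℝ => y / h) (1 / h) y := (hasDerivAt_id y).div_const h
    have h2 : HasDerivAt (ramp ∘ fun y : ℝ => y / h) (deriv ramp (y / h) * (1 / h)) y :=
      (contDiff_ramp.differentiable (by simp) _).hasDerivAt.comp y h1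
    have h3 : HasDerivAt g (h * (deriv ramp (y / h) * (1 / h))) y := h2.const_mul h
    rw [h3.deriv, show h * (deriv ramp (y / h) * (1 / h)) = deriv ramp (y / h) by field_simp]
    exact abs_deriv_ramp_le hM _
  set k : ℝ → ℝ := fun y => -g (-y) with hk
  have hks : ContDiff ℝ ∞ k := (hgs.comp contDiff_neg).neg
  have hkd : ∀ y, |deriv k y| ≤ L := fun y => by
    have h1 : HasDerivAt k (-(deriv g (-y) * -1)) y :=
      ((hgs.differentiable (by simp) (-y)).hasDerivAt.comp y (hasDerivAt_neg y)).neg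
    rw [h1.deriv]; simpa using hgd (-y)
  have hmem1 : ∀ z, reheight g z ∈ slitExterior δ := fun z =>
    mem_slitExterior_of_ne (by rw [reheight_one]; exact (hgpos _).ne')
  have hmem2 : ∀ z, reheight k z ∈ slitExterior δ := fun z =>
    mem_slitExterior_of_ne (by
      rw [reheight_one]; simp only [hk]; exact neg_ne_zero.2 (hgpos _).ne')
  set u : Plane → ℝ := q ∘ reheight g with hu
  set w : Plane → ℝ := q ∘ reheight k with hw
  have hus : ContDiff ℝ ∞ u := hq.smooth.comp_contDiff (contDiff_reheight hgs) hmem1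
  have hws : ContDiff ℝ ∞ w := hq.smooth.comp_contDiff (contDiff_reheight hks) hmem2
  have hcomp : ∀ {f : ℝ → ℝ}, ContDiff ℝ ∞ f → (∀ y, |deriv f y| ≤ L) →
      (∀ z, reheight f z ∈ slitExterior δ) → ∀ z,
      ‖fderiv ℝ (q ∘ reheight f) z‖ ≤ C * (L + 2) := by
    intro f hf hfd hfm z
    have h1 := (hq.differentiableAt hU (hfm z)).hasFDerivAt.comp z
      ((contDiff_reheight hf).differentiable (by simp) z).hasFDerivAt
    rw [h1.fderiv]
    refine (ContinuousLinearMap.opNorm_comp_le _ _).trans ?_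
    exact mul_le_mul (hq.bound_fderiv _ (hfm z)) (norm_fderiv_reheight_le hf hfd z)
      (norm_nonneg _) hC
  have hub := hcomp hgs hgd hmem1
  have hwb := hcomp hks hkd hmem2
  set θ : Plane → ℝ := fun z => step (z 1 / h) with hθ
  have hθs : ContDiff ℝ ∞ θ := contDiff_step_coord 1 h
  have hθb : ∀ z, ‖fderiv ℝ θ z‖ ≤ M / h := norm_fderiv_step_coord_le hM hh 1
  have hθ1 : ∀ z : Plane, h ≤ z 1 → θ z = 1 := fun z hz => step_of_ge ((one_le_div hh).2 hz)
  have hθ0 : ∀ z : Plane, z 1 ≤ -h → θ z = 0 := fun z hz =>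
    step_of_le (by rw [div_le_iff₀ hh]; linarith)
  have hre : ∀ (f : ℝ → ℝ) (z : Plane), f (z 1) = z 1 → reheight f z = z := fun f z hf => by
    simp [reheight, hf]
  set φ : Plane → ℝ := fun z => w z + θ z * (u z - w z) with hφ
  have hφq : ∀ z : Plane, h ≤ |z 1| → φ z = q z := by
    intro z hz
    rcases le_abs.1 hz with h1 | h1
    · simp only [hφ, hθ1 z h1, hu, Function.comp, hre g z (hgid _ h1)]; ring
    · have : k (z 1) = z 1 := by simp only [hk]; rw [hgid _ h1]; ring
      simp only [hφ, hθ0 z (by linarith), hw, Function.comp, hre k z this]; ring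
  have hφd : ∀ z, ‖fderiv ℝ φ z‖ ≤ C * (L + 2) + |u z - w z| * (M / h) := by
    intro z
    have d1 := (hus.differentiable (by simp) z).hasFDerivAt
    have d2 := (hws.differentiable (by simp) z).hasFDerivAt
    have d3 := (hθs.differentiable (by simp) z).hasFDerivAt
    have d4 : HasFDerivAt φ (fderiv ℝ w z + (θ z • (fderiv ℝ u z - fderiv ℝ w z) +
        (u z - w z) • fderiv ℝ θ z)) z := d2.add (d3.mul (d1.sub d2))
    rw [d4.fderiv]
    have e : fderiv ℝ w z + (θ z • (fderiv ℝ u z - fderiv ℝ w z) + (u z - w z) • fderiv ℝ θ z) =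
        ((1 - θ z) • fderiv ℝ w z + θ z • fderiv ℝ u z) + (u z - w z) • fderiv ℝ θ z := by module
    rw [e]
    have t0 := step_nonneg (z 1 / h)
    have t1 := step_le_one (z 1 / h)
    have hn1 : ‖(1 - θ z) • fderiv ℝ w z‖ ≤ (1 - θ z) * (C * (L + 2)) := by
      rw [norm_smul, Real.norm_of_nonneg (by simp only [hθ]; linarith)]
      exact mul_le_mul_of_nonneg_left (hwb z) (by simp only [hθ]; linarith)
    have hn2 : ‖θ z • fderiv ℝ u z‖ ≤ θ z * (C * (L + 2)) := by
      rw [norm_smul, Real.norm_of_nonneg t0]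
      exact mul_le_mul_of_nonneg_left (hub z) t0
    have hn3 : ‖(u z - w z) • fderiv ℝ θ z‖ ≤ |u z - w z| * (M / h) := by
      rw [norm_smul, Real.norm_eq_abs]
      exact mul_le_mul_of_nonneg_left (hθb z) (abs_nonneg _)
    have hn4 := norm_add_le ((1 - θ z) • fderiv ℝ w z) (θ z • fderiv ℝ u z)
    refine (norm_add_le _ _).trans ?_
    linarith
  have hvz : ∀ z, reheight g z - reheight k z = (g (z 1) + g (-z 1)) • vert := fun z => by
    simp only [reheight, hk]; module
  refine ⟨φ, by fun_prop, fun z hz => ?_, fun z hz => ?_, fun z hz hz0 => ?_, fun z hz => ?_⟩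
  · rcases le_total h |z 1| with h1 | h1
    · rw [hφq z h1]
      exact hq.zero_at_large z (mem_slitExterior_of_ne fun h0 => by
        rw [h0, abs_zero] at h1; linarith) (by linarith)
    · have h1' := abs_le.1 h1
      have hlarge : ∀ f : ℝ → ℝ, |f (z 1)| ≤ h → R < ‖reheight f z‖ := by
        intro f hf
        have e1 : ‖(f (z 1) - z 1) • vert‖ ≤ 2 * h := by
          rw [norm_smul, norm_vert, mul_one, Real.norm_eq_abs]
          exact (abs_sub _ _).trans (by linarith)
        have e2 := norm_sub_le (reheight f z) ((f (z 1) - z 1) • vert)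
        rw [show reheight f z - (f (z 1) - z 1) • vert = z by simp [reheight]] at e2
        linarith
      have hu0 : u z = 0 := hq.zero_at_large _ (hmem1 z)
        (hlarge g (by rw [abs_of_pos (hgpos _)]; exact hgle _ h1'.2))
      have hw0 : w z = 0 := hq.zero_at_large _ (hmem2 z)
        (hlarge k (by
          simp only [hk]; rw [abs_neg, abs_of_pos (hgpos _)]; exact hgle _ (by linarith)))
      simp [hφ, hu0, hw0]
  · have : φ =ᶠ[𝓝 z] q := by
      filter_upwards [(continuous_coord 1).abs.continuousAt.eventually_const_lt hz] with y hy
      exact hφq y hy.le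
    exact this.fderiv_eq
  · have hz' := abs_le.1 hz
    -- Away from the abscissae of the slit, a vertical segment of length at most `2 * h` joins the
    -- two points without meeting it; the jump `O(h)` compensates the slope `1 / h` of the step.
    have hseg : segment ℝ (reheight k z) (reheight g z) ⊆ slitExterior δ := by
      rintro y ⟨s, t, hs, ht, hst, rfl⟩
      refine mem_slitExterior_of_notMem ?_
      simp only [PiLp.add_apply, PiLp.smul_apply, reheight_zero, smul_eq_mul]
      rwa [← add_mul, hst, one_mul]
    have hmv := (convex_segment (reheight k z) (reheight g z)).norm_image_sub_le_of_norm_fderiv_le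
      (fun y hy => hq.differentiableAt hU (hseg hy)) (fun y hy => hq.bound_fderiv y (hseg hy))
      (left_mem_segment ℝ _ _) (right_mem_segment ℝ _ _)
    rw [hvz, norm_smul, norm_vert, mul_one, Real.norm_eq_abs, Real.norm_eq_abs,
      abs_of_pos (add_pos (hgpos _) (hgpos _))] at hmv
    have hjump : |u z - w z| ≤ C * (2 * h) := hmv.trans (mul_le_mul_of_nonneg_left
      (by linarith [hgle _ hz'.2, hgle (-z 1) (by linarith)]) hC)
    refine (hφd z).trans ?_
    have : |u z - w z| * (M / h) ≤ C * (2 * h) * (M / h) :=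
      mul_le_mul_of_nonneg_right hjump (by positivity)
    rw [show C * (2 * h) * (M / h) = 2 * C * M by field_simp] at this
    linarith
  -- Across the slit the jump is only bounded, which costs the term in `1 / h`.
  · have hjump : |u z - w z| ≤ 2 * C :=
      (abs_sub _ _).trans (by
        have h1 : |u z| ≤ C := hq.bound _ (hmem1 z)
        have h2 : |w z| ≤ C := hq.bound _ (hmem2 z)
        linarith)
    refine (hφd z).trans ?_
    have h1 : |u z - w z| * (M / h) ≤ 2 * C * (M / h) :=
      mul_le_mul_of_nonneg_right hjump (by positivity)
    have h2 : 2 * C * (M / h) ≤ (C * (L + 2) + 2 * C * M) / h := by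
      rw [← mul_div_assoc]
      gcongr
      have : 0 ≤ C * (L + 2) := by positivity
      linarith
    have : 0 ≤ 2 * C * M := by positivity
    linarith

/-! ### The row of inclusions, its gaps, and the segment limit -/

lemma isCompact_inclusion {K : Set Plane} (hK : IsCompact K) (ε d : ℝ) (i j : ℕ) :
    IsCompact (inclusion K ε d i j) :=
  hK.image (by fun_prop)

lemma isOpen_segmentFluidDomain {K : Set Plane} (hK : IsCompact K) (ε d : ℝ) :
    IsOpen (segmentFluidDomain K ε d) :=
  (isClosed_biUnion_finset fun i _ => (isCompact_inclusion hK ε d i 1).isClosed).isOpen_compl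

lemma isOpen_squareFluidDomain {K : Set Plane} (hK : IsCompact K) (ε d : ℝ) :
    IsOpen (squareFluidDomain K ε d) :=
  (isClosed_biUnion_finset fun i _ => isClosed_biUnion_finset fun j _ =>
    (isCompact_inclusion hK ε d i j).isClosed).isOpen_compl

lemma isOpen_segmentExterior : IsOpen segmentExterior :=
  ((isClosed_Icc.preimage (continuous_coord 0)).inter
    (isClosed_eq (continuous_coord 1) continuous_const)).isOpen_compl

/-- The coordinates of a point relative to the inclusion `(i, j)`. -/
def cellCoord (ε d : ℝ) (i j : ℕ) (z : Plane) : Plane := (2 / ε) • (z - centre ε d i j)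

lemma cellCoord_zero (ε d : ℝ) (i j : ℕ) (z : Plane) :
    cellCoord ε d i j z 0 = 2 / ε * (z 0 - (ε / 2 + ((i : ℝ) - 1) * (ε + d))) := by
  simp [cellCoord, centre]

lemma cellCoord_one (ε d : ℝ) (i j : ℕ) (z : Plane) :
    cellCoord ε d i j z 1 = 2 / ε * (z 1 - ((j : ℝ) - 1) * (ε + d)) := by
  simp [cellCoord, centre]

lemma mem_inclusion_iff {K : Set Plane} {ε : ℝ} (hε : 0 < ε) (d : ℝ) (i j : ℕ) (z : Plane) :
    z ∈ inclusion K ε d i j ↔ cellCoord ε d i j z ∈ K := by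
  constructor
  · rintro ⟨k, hk, rfl⟩
    have : cellCoord ε d i j (centre ε d i j + (ε / 2) • k) = k := by
      simp only [cellCoord, add_sub_cancel_left, smul_smul]
      rw [show 2 / ε * (ε / 2) = 1 by field_simp, one_smul]
    simpa only [this] using hk
  · intro h
    refine ⟨_, h, ?_⟩
    simp only [cellCoord, smul_smul]
    rw [show ε / 2 * (2 / ε) = 1 by field_simp, one_smul, add_sub_cancel]

lemma numInclusions_mul_le {ε d : ℝ} (hε : 0 < ε) (hd : 0 < d) :
    (numInclusions ε d : ℝ) * (ε + d) ≤ 1 + d := by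
  have := Nat.floor_le (a := (1 + d) / (ε + d)) (by positivity)
  rwa [le_div_iff₀ (by positivity)] at this

/-- The floor loses less than one period `ε + d`, so the row of cells reaches beyond `1 - ε`. -/
lemma lt_numInclusions_mul {ε d : ℝ} (hε : 0 < ε) (hd : 0 < d) :
    1 - ε < (numInclusions ε d : ℝ) * (ε + d) := by
  have := Nat.lt_floor_add_one ((1 + d) / (ε + d))
  rw [div_lt_iff₀ (by positivity)] at this
  change 1 + d < ((numInclusions ε d : ℝ) + 1) * (ε + d) at this
  linarith

lemma absPow_nonneg (γ : ℝ≥0∞) (s : ℝ) : 0 ≤ absPow γ s := by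
  unfold absPow; split_ifs <;> positivity

lemma absPow_le {γ : ℝ≥0∞} {s t : ℝ} (h : |s| ≤ t) : absPow γ s ≤ absPow γ t := by
  unfold absPow
  split_ifs
  · exact le_rfl
  · exact Real.rpow_le_rpow (abs_nonneg _) (h.trans (le_abs_self _)) (by positivity)

/-- The thin rectangles that cover the gaps between the inclusions, near the segment. -/
def gaps (ε d κ h : ℝ) : Set Plane :=
  ⋃ i ∈ Finset.range (numInclusions ε d + 1),
    rect (i * (ε + d) - d - κ) (i * (ε + d) + κ) (-h) h

lemma isClosed_gaps (ε d κ h : ℝ) : IsClosed (gaps ε d κ h) :=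
  isClosed_biUnion_finset fun _ _ => isClosed_rect _ _ _ _

lemma volume_real_gaps_le {ε d κ h : ℝ} (hd : 0 < d) (hκ : 0 ≤ κ) (hh : 0 ≤ h) :
    volume.real (gaps ε d κ h) ≤ (numInclusions ε d + 1) * ((d + 2 * κ) * (2 * h)) := by
  refine (measureReal_biUnion_finset_le _ _).trans ?_
  rw [Finset.sum_congr rfl fun i _ => volume_real_rect_le (by linarith) (by linarith)]
  rw [Finset.sum_congr rfl fun i _ => show _ = (d + 2 * κ) * (2 * h) by ring]
  simp

/-- The floor of `z 0 / (ε + d)` selects a cell, in which the rescaled height is at most `t`. Off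
the inclusion, the rescaled abscissa exceeds `1 - ρ₁ * absPow γ t` in absolute value, so the point
is in the gap on the left or on the right of this inclusion. -/
lemma mem_gaps {K : Set Plane} {γ : ℝ≥0∞} {ρ₀ ρ₁ : ℝ} (hρ₁ : 0 < ρ₁)
    (hin : ∀ s : ℝ, |s| ≤ ρ₀ → ∀ x : ℝ, |x| ≤ 1 - ρ₁ * absPow γ s → !₂[x, s] ∈ K)
    {ε d t : ℝ} (hε : 0 < ε) (hd : 0 < d) (htρ : t ≤ ρ₀) {z : Plane}
    (hz : z ∈ segmentFluidDomain K ε d) (hz1 : |z 1| ≤ ε * t / 2) (h0 : 0 ≤ z 0)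
    (h1 : z 0 ≤ 1 - ε) : z ∈ gaps ε d (ε / 2 * (ρ₁ * absPow γ t)) (ε * t / 2) := by
  set l := ε + d with hl
  have hlpos : 0 < l := by positivity
  set i := ⌊z 0 / l⌋₊ with hi
  have hi1 : (i : ℝ) * l ≤ z 0 := by
    rw [← le_div_iff₀ hlpos]; exact Nat.floor_le (by positivity)
  have hi2 : z 0 < (i + 1) * l := by
    rw [← div_lt_iff₀ hlpos]; exact Nat.lt_floor_add_one _
  have hiN : i < numInclusions ε d := by
    have h2 := lt_numInclusions_mul hε hd
    have h3 : (i : ℝ) * l < numInclusions ε d * l := by linarith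
    exact_mod_cast lt_of_mul_lt_mul_right h3 hlpos.le
  have hk : cellCoord ε d (i + 1) 1 z ∉ K := by
    rw [← mem_inclusion_iff hε]
    intro h
    refine hz (mem_biUnion (x := i + 1) ?_ h)
    exact Finset.mem_coe.2 (Finset.mem_Icc.2 ⟨by omega, by omega⟩)
  have c0 := cellCoord_zero ε d (i + 1) 1 z
  have c1 := cellCoord_one ε d (i + 1) 1 z
  rw [← plane_eta (cellCoord ε d (i + 1) 1 z)] at hk
  rw [c0, c1] at hk
  push_cast at hk
  set s := 2 / ε * (z 1 - (1 - 1) * (ε + d)) with hs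
  have hst : |s| ≤ t := by
    rw [hs, abs_mul, abs_of_pos (by positivity)]
    rw [sub_self, zero_mul, sub_zero]
    calc 2 / ε * |z 1| ≤ 2 / ε * (ε * t / 2) := by gcongr
      _ = t := by field_simp
  have hx := not_le.1 (mt (hin s (hst.trans htρ) _) hk)
  have hap : ρ₁ * absPow γ s ≤ ρ₁ * absPow γ t :=
    mul_le_mul_of_nonneg_left (absPow_le hst) hρ₁.le
  set x := 2 / ε * (z 0 - (ε / 2 + ((i : ℝ) + 1 - 1) * (ε + d))) with hxdef
  have hz0 : z 0 = i * l + ε / 2 + ε / 2 * x := by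
    rw [hxdef]; field_simp; ring
  have hz1' := abs_le.1 hz1
  set P := ρ₁ * absPow γ t with hP
  have hPn : 0 ≤ P := mul_nonneg hρ₁.le (absPow_nonneg _ _)
  have hx' : 1 - P < |x| := by linarith
  rcases lt_abs.1 hx' with h | h
  · refine mem_biUnion (x := i + 1) (Finset.mem_coe.2 (Finset.mem_range.2 (by omega))) ?_
    have : ε / 2 * (1 - P) < ε / 2 * x := by gcongr
    refine ⟨⟨?_, ?_⟩, ⟨by linarith, hz1'.2⟩⟩
    · push_cast; linarith
    · push_cast
      have : 0 ≤ ε / 2 * P := by positivity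
      linarith
  · refine mem_biUnion (x := i) (Finset.mem_coe.2 (Finset.mem_range.2 (by omega))) ?_
    have : ε / 2 * (1 - P) < ε / 2 * -x := by gcongr
    have h3 : 0 ≤ ε / 2 * P := by positivity
    refine ⟨⟨by linarith, by linarith⟩, ⟨by linarith, hz1'.2⟩⟩

lemma mem_segmentFluidDomain_of_lt {K : Set Plane} (hK : IsInclusionShape K) {ε d : ℝ}
    (hε : 0 < ε) {z : Plane} (hz : ε / 2 < |z 1|) : z ∈ segmentFluidDomain K ε d := by
  simp only [segmentFluidDomain, mem_compl_iff, mem_iUnion, not_exists]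
  intro i _ h
  rw [mem_inclusion_iff hε] at h
  have h1 := (hK.subset_square _ h).2
  rw [cellCoord_one, Nat.cast_one, sub_self, zero_mul, sub_zero, abs_mul,
    abs_of_pos (by positivity)] at h1
  have h2 : 2 / ε * (ε / 2) < 2 / ε * |z 1| := by gcongr
  rw [show 2 / ε * (ε / 2) = 1 by field_simp] at h2
  linarith

/-- The height of the transition layer in the gaps can be chosen so that the energy vanishes. -/
lemma exists_layer_heights {ε d : ℕ → ℝ} (hε : ∀ n, 0 < ε n) (hd : ∀ n, 0 < d n)
    (hε0 : Tendsto ε atTop (𝓝 0)) {γ : ℝ≥0∞} (hγ : 0 < γ)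
    (h : Tendsto (fun n => d n / ε n ^ (2 + (γ⁻¹).toReal)) atTop (𝓝 0)) {ρ₀ : ℝ} (hρ₀ : 0 < ρ₀)
    (ρ₁ : ℝ) : ∃ t : ℕ → ℝ, (∀ᶠ n in atTop, 0 < t n ∧ t n ≤ ρ₀) ∧
      Tendsto (fun n => (d n + ε n * (ρ₁ * absPow γ (t n))) / (ε n ^ 2 * t n)) atTop (𝓝 0) := by
  by_cases htop : γ = ⊤
  -- For `γ = ∞` the sides are vertical near the contact points, and a fixed height is enough.
  · refine ⟨fun _ => ρ₀, Eventually.of_forall fun _ => ⟨hρ₀, le_rfl⟩, ?_⟩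
    have := h.div_const ρ₀
    rw [zero_div] at this
    refine this.congr fun n => ?_
    simp only [htop, absPow, if_true, ENNReal.inv_top, ENNReal.toReal_zero, add_zero, mul_zero,
      Real.rpow_ofNat, div_div]
  · set g := γ.toReal with hg
    have hgpos : 0 < g := ENNReal.toReal_pos hγ.ne' htop
    rw [ENNReal.toReal_inv, ← hg] at h
    set a : ℕ → ℝ := fun n => d n / ε n ^ (2 + g⁻¹) with ha
    have hapos : ∀ n, 0 < a n := fun n => div_pos (hd n) (Real.rpow_pos_of_pos (hε n) _)
    set b : ℕ → ℝ := fun n => √(a n) with hb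
    have hbpos : ∀ n, 0 < b n := fun n => Real.sqrt_pos.2 (hapos n)
    have hb0 : Tendsto b atTop (𝓝 0) := by
      have := (Real.continuous_sqrt.tendsto 0).comp h
      rwa [Real.sqrt_zero] at this
    have hpow : Tendsto (fun n => ε n ^ g⁻¹) atTop (𝓝 0) := by
      have := hε0.rpow_const (p := g⁻¹) (Or.inr (by positivity))
      rwa [Real.zero_rpow (by positivity)] at this
    -- With `d = b² ε^(2 + 1/γ)`, the two parts of the quotient become `b` and `ρ₁ b^γ`: `t` is the
    -- geometric mean of `d / ε²` and `ε^(1/γ)`.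
    set t : ℕ → ℝ := fun n => ε n ^ g⁻¹ * b n with ht
    have htpos : ∀ n, 0 < t n := fun n => mul_pos (Real.rpow_pos_of_pos (hε n) _) (hbpos n)
    have ht0 : Tendsto t atTop (𝓝 0) := by simpa using hpow.mul hb0
    refine ⟨t, ?_, ?_⟩
    · filter_upwards [ht0.eventually_lt_const hρ₀] with n hn
      exact ⟨htpos n, hn.le⟩
    · have hbg : Tendsto (fun n => ρ₁ * b n ^ g) atTop (𝓝 0) := by
        have := (hb0.rpow_const (p := g) (Or.inr hgpos.le)).const_mul ρ₁
        rwa [Real.zero_rpow hgpos.ne', mul_zero] at this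
      have hsum := hb0.add hbg
      rw [add_zero] at hsum
      refine hsum.congr fun n => ?_
      have he := hε n
      have hE : 0 < ε n ^ g⁻¹ := Real.rpow_pos_of_pos he _
      have hd' : d n = b n ^ 2 * (ε n ^ 2 * ε n ^ g⁻¹) := by
        have h1 : b n ^ 2 = a n := Real.sq_sqrt (hapos n).le
        rw [h1, ha]
        simp only
        rw [Real.rpow_add he, Real.rpow_ofNat]
        field_simp
      have habs : absPow γ (t n) = t n * (ε n * b n ^ g) := by
        rw [absPow, if_neg htop, abs_of_pos (htpos n), ← hg, Real.rpow_add (htpos n),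
          Real.rpow_one]
        congr 1
        rw [ht]
        simp only
        rw [Real.mul_rpow hE.le (hbpos n).le, ← Real.rpow_mul he.le, inv_mul_cancel₀ hgpos.ne',
          Real.rpow_one]
      rw [habs, hd']
      have htE : t n = ε n ^ g⁻¹ * b n := rfl
      have hbn := hbpos n
      rw [htE]
      generalize ε n ^ g⁻¹ = E at hE
      field_simp

/-- The pairing with the gradient of a function smooth off a shortened segment tends to zero. -/
theorem tendsto_segment_pairing {K : Set Plane} (hK : IsInclusionShape K)
    {ε d : ℕ → ℝ} (hε : ∀ n, 0 < ε n) (hd : ∀ n, 0 < d n) (hε0 : Tendsto ε atTop (𝓝 0))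
    {v : ℕ → Plane → Plane} (hv : IsBoundedL2Loc v)
    (hdiv : ∀ n, IsDivFreeTangent (segmentFluidDomain K (ε n) (d n)) (v n))
    {γ : ℝ≥0∞} (hγ : HasTangencyExponent K γ)
    (h : Tendsto (fun n => d n / ε n ^ (2 + (γ⁻¹).toReal)) atTop (𝓝 0))
    {q : Plane → ℝ} {C R δ : ℝ} (hC : 0 ≤ C) (hR : 0 ≤ R) (hδ : 0 < δ)
    (hq : IsTameOn (slitExterior δ) q C R) :
    Tendsto (fun n => ∫ z in segmentExterior, fderiv ℝ q z (v n z)) atTop (𝓝 0) := by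
  obtain ⟨hγ0, ρ₀, ρ₁, ρ₂, hρ₀, hρ₀1, hρ₁, -, hin, -⟩ := hγ
  obtain ⟨t, ht, htend⟩ := exists_layer_heights hε hd hε0 hγ0 h hρ₀ ρ₁
  obtain ⟨C', hC', hφ⟩ := exists_interpolation hC hq
  obtain ⟨D, hD, hpair⟩ := exists_setIntegral_norm_le hv (R + 4)
  have hsub : segmentExterior ⊆ slitExterior δ := fun z hz h =>
    hz ⟨⟨by linarith [h.1.1], by linarith [h.1.2]⟩, h.2⟩
  set Q : ℕ → ℝ := fun n => (d n + ε n * (ρ₁ * absPow γ (t n))) / (ε n ^ 2 * t n) with hQ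
  -- The first term comes from a strip of thickness `ε n`, where gradients are bounded. The second
  -- comes from the gaps: their area is at most `12 * hh ^ 2 * Q n`, which the square of the
  -- gradient `C' / hh` turns into `Q n`.
  set bnd : ℕ → ℝ := fun n => D * ((2 * C + C') * √(2 * (R + 2) * ε n) + 2 * C' * √(3 * Q n)) with hbnd
  have hbnd0 : Tendsto bnd atTop (𝓝 0) := by
    have h1 : Tendsto (fun n => √(2 * (R + 2) * ε n)) atTop (𝓝 0) := by
      have := (Real.continuous_sqrt.tendsto _).comp (hε0.const_mul (2 * (R + 2)))
      rwa [mul_zero, Real.sqrt_zero] at this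
    have h2 : Tendsto (fun n => √(3 * Q n)) atTop (𝓝 0) := by
      have := (Real.continuous_sqrt.tendsto _).comp (htend.const_mul 3)
      rwa [mul_zero, Real.sqrt_zero] at this
    have := ((h1.const_mul (2 * C + C')).add (h2.const_mul (2 * C'))).const_mul D
    simpa only [mul_zero, add_zero] using this
  refine squeeze_zero_norm' ?_ hbnd0
  filter_upwards [ht, hε0.eventually_lt_const (show (0 : ℝ) < min δ (1 / 2) by positivity)]
    with n htn hεn
  obtain ⟨htpos, htρ⟩ := htn
  have he := hε n
  have hdn := hd n
  have heδ : ε n < δ := hεn.trans_le (min_le_left _ _)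
  have he2 : ε n < 1 / 2 := hεn.trans_le (min_le_right _ _)
  set hh := ε n * t n / 2 with hhdef
  have hhpos : 0 < hh := by positivity
  have hhe : hh ≤ ε n / 2 := by rw [hhdef]; nlinarith
  set κ := ε n / 2 * (ρ₁ * absPow γ (t n)) with hκdef
  have hκ : 0 ≤ κ := by have := absPow_nonneg γ (t n); positivity
  obtain ⟨φ, hφs, hφ0, hφq, hφout, hφin⟩ := hφ hh hhpos
  set F := segmentFluidDomain K (ε n) (d n) with hF
  have hFo : IsOpen F := isOpen_segmentFluidDomain hK.isCompact _ _
  have hφfar : ∀ z, R + 2 * hh < ‖z‖ → fderiv ℝ φ z = 0 := fun z hz => by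
    have : φ =ᶠ[𝓝 z] fun _ => 0 := by
      filter_upwards [continuous_norm.continuousAt.eventually_const_lt hz] with y hy
      exact hφ0 y hy
    rw [this.fderiv_eq]; simp
  have hφc : HasCompactSupport φ :=
    HasCompactSupport.intro (isCompact_closedBall 0 (R + 2 * hh)) fun z hz =>
      hφ0 z (by simpa using hz)
  have hφint : IntegrableOn (fun z => fderiv ℝ φ z (v n z)) F := by
    obtain ⟨c, hc⟩ := (hφs.continuous_fderiv (by simp)).bounded_above_of_compact_support
      (hφc.fderiv ℝ)
    exact integrableOn_pairing hv n hFo.measurableSet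
      (hφs.continuous_fderiv (by simp)).aestronglyMeasurable (fun z _ => hc z)
      (fun z _ hz => hφfar z hz)
  have hzero : ∫ z in F, fderiv ℝ φ z (v n z) = 0 := by
    have := hdiv n φ hφs hφc
    simpa only [inner_gradient_eq] using this
  have key := abs_pairing_sub_le (hpair n) isOpen_segmentExterior.measurableSet hFo.measurableSet
    ((hq.mono hsub).integrableOn isOpen_segmentExterior hv n) hφint
    (A := rect (-(R + 2)) (R + 2) (-(ε n / 2)) (ε n / 2))
    (B := gaps (ε n) (d n) κ hh ∩ rect (-(R + 2)) (R + 2) (-(ε n / 2)) (ε n / 2))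
    (isClosed_rect _ _ _ _).measurableSet
    ((isClosed_gaps _ _ _ _).inter (isClosed_rect _ _ _ _)).measurableSet
    (a := 2 * C + C') (b := C' / hh) ?_ ?_ (by positivity) (by positivity) ?_
  · rw [hzero, sub_zero] at key
    rw [Real.norm_eq_abs]
    refine key.trans ?_
    rw [hbnd]
    simp only
    refine mul_le_mul_of_nonneg_left (add_le_add ?_ ?_) hD
    · rw [volume_real_rect_le (by linarith) (by linarith)]
      refine mul_le_mul_of_nonneg_left (Real.sqrt_le_sqrt (le_of_eq (by ring))) (by positivity)
    · have hN : (numInclusions (ε n) (d n) + 1 : ℝ) * ε n ≤ 3 := by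
        have h1 := numInclusions_mul_le he hdn
        have h2 : (numInclusions (ε n) (d n) : ℝ) * (ε n + d n) ≤ 1 + d n := h1
        have h3 : (numInclusions (ε n) (d n) : ℝ) * ε n ≤ 1 := by
          rcases Nat.eq_zero_or_pos (numInclusions (ε n) (d n)) with h0 | h0
          · rw [h0]; simp
          · have : (1 : ℝ) ≤ numInclusions (ε n) (d n) := by exact_mod_cast h0
            nlinarith
        linarith
      have hvol : volume.real (gaps (ε n) (d n) κ hh ∩
          rect (-(R + 2)) (R + 2) (-(ε n / 2)) (ε n / 2)) ≤ 4 * hh ^ 2 * (3 * Q n) := by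
        have hfin : volume (gaps (ε n) (d n) κ hh) ≠ ⊤ := by
          refine (measure_biUnion_lt_top (Finset.finite_toSet _) fun i _ => ?_).ne
          rw [volume_rect]
          exact ENNReal.mul_lt_top ENNReal.ofReal_lt_top ENNReal.ofReal_lt_top
        refine (measureReal_mono inter_subset_left hfin).trans
          ((volume_real_gaps_le hdn hκ hhpos.le).trans ?_)
        have e1 : (d n + 2 * κ) * (2 * hh) = ε n * (4 * hh ^ 2 * Q n) := by
          rw [hQ, hκdef, hhdef]
          field_simp
          ring
        rw [e1, ← mul_assoc]
        have hQn : 0 ≤ Q n := by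
          have := absPow_nonneg γ (t n)
          rw [hQ]; positivity
        calc _ ≤ 3 * (4 * hh ^ 2 * Q n) := mul_le_mul_of_nonneg_right hN (by positivity)
          _ = _ := by ring
      calc C' / hh * √_ ≤ C' / hh * √(4 * hh ^ 2 * (3 * Q n)) :=
            mul_le_mul_of_nonneg_left (Real.sqrt_le_sqrt hvol) (by positivity)
        _ = C' / hh * (2 * hh * √(3 * Q n)) := by
            rw [show 4 * hh ^ 2 * (3 * Q n) = (2 * hh) ^ 2 * (3 * Q n) by ring,
              Real.sqrt_mul (by positivity), Real.sqrt_sq (by positivity)]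
        _ = 2 * C' * √(3 * Q n) := by field_simp
  · intro z hz
    rw [mem_ball_zero_iff]
    have h1 := abs_le.2 hz.1
    have h2 := abs_le.2 hz.2
    exact (norm_le_abs_add_abs z).trans_lt (by linarith)
  · intro z hz
    rw [mem_ball_zero_iff]
    have h1 := abs_le.2 hz.2.1
    have h2 := abs_le.2 hz.2.2
    exact (norm_le_abs_add_abs z).trans_lt (by linarith)
  · intro z
    set A := rect (-(R + 2)) (R + 2) (-(ε n / 2)) (ε n / 2) with hA
    set B := gaps (ε n) (d n) κ hh ∩ A with hB
    have hBn : 0 ≤ B.indicator (fun _ => C' / hh) z := indicator_nonneg (fun _ _ => by positivity) _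
    have hAn : 0 ≤ A.indicator (fun _ => 2 * C + C') z := indicator_nonneg (fun _ _ => by positivity) _
    by_cases hfar : R + 1 < ‖z‖
    · have h1 : segmentExterior.indicator (fderiv ℝ q) z = 0 := by
        by_cases hz : z ∈ segmentExterior
        · rw [indicator_of_mem hz]
          exact (hq.mono hsub).fderiv_zero_at_large isOpen_segmentExterior hz (by linarith)
        · rw [indicator_of_notMem hz]
      have h2 : F.indicator (fderiv ℝ φ) z = 0 := by
        by_cases hz : z ∈ F
        · rw [indicator_of_mem hz]; exact hφfar z (by linarith)
        · rw [indicator_of_notMem hz]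
      rw [h1, h2, sub_zero, norm_zero]
      positivity
    have hz0 : |z 0| ≤ R + 2 := by
      have := PiLp.norm_apply_le z 0
      rw [Real.norm_eq_abs] at this
      linarith [not_lt.1 hfar]
    rcases lt_or_ge (ε n / 2) |z 1| with hz1 | hz1
    · have hzΩ : z ∈ segmentExterior := fun h => by
        rw [h.2, abs_zero] at hz1; linarith
      rw [indicator_of_mem hzΩ, indicator_of_mem (mem_segmentFluidDomain_of_lt hK he hz1),
        hφq z (by linarith), sub_self, norm_zero]
      positivity
    have hzA : z ∈ A := ⟨abs_le.1 hz0, abs_le.1 hz1⟩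
    rw [indicator_of_mem hzA]
    have h1 : ‖segmentExterior.indicator (fderiv ℝ q) z‖ ≤ C := by
      by_cases hz : z ∈ segmentExterior
      · rw [indicator_of_mem hz]; exact hq.bound_fderiv z (hsub hz)
      · rw [indicator_of_notMem hz, norm_zero]; exact hC
    have hstrip : ‖segmentExterior.indicator (fderiv ℝ q) z‖ +
        ‖F.indicator (fderiv ℝ φ) z‖ ≤ 2 * C + C' + B.indicator (fun _ => C' / hh) z := by
      by_cases hzF : z ∈ F
      swap
      · rw [indicator_of_notMem hzF, norm_zero]; linarith
      rw [indicator_of_mem hzF]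
      rcases lt_or_ge hh |z 1| with hzh | hzh
      · have hne : z 1 ≠ 0 := fun h0 => by rw [h0, abs_zero] at hzh; linarith
        rw [hφq z hzh]
        linarith [hq.bound_fderiv z (mem_slitExterior_of_ne hne)]
      -- Over the slit, `ε n < δ` ensures that the row of inclusions is complete, so low fluid
      -- points lie in the gaps. Elsewhere the interpolation has a bounded gradient.
      by_cases hzδ : z 0 ∈ Icc δ (1 - δ)
      · have hzB : z ∈ B := ⟨mem_gaps hρ₁ hin he hdn htρ hzF hzh (by linarith [hzδ.1])
          (by linarith [hzδ.2]), hzA⟩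
        rw [indicator_of_mem hzB]
        linarith [hφin z hzh]
      · linarith [hφout z hzh hzδ]
    exact (norm_sub_le _ _).trans hstrip

/-! ### Exchange of coordinates and staircases -/

/-- The exchange of the two coordinates. -/
def swapL : Plane ≃ₗᵢ[ℝ] Plane := LinearIsometryEquiv.piLpCongrLeft 2 ℝ ℝ (Equiv.swap 0 1)

lemma swapL_zero (z : Plane) : swapL z 0 = z 1 := by
  simp [swapL, LinearIsometryEquiv.piLpCongrLeft_apply, Equiv.piCongrLeft']

lemma swapL_one (z : Plane) : swapL z 1 = z 0 := by
  simp [swapL, LinearIsometryEquiv.piLpCongrLeft_apply, Equiv.piCongrLeft']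

lemma swapL_mk (x y : ℝ) : swapL !₂[x, y] = !₂[y, x] := by
  rw [← plane_eta (swapL _), swapL_zero, swapL_one]; rfl

lemma image_swapL_frontier (K : Set Plane) : swapL '' frontier K = frontier (swapL '' K) :=
  swapL.toHomeomorph.image_frontier K

/-- The hypotheses on the shape are symmetric in the two coordinates. -/
lemma IsInclusionShape.swap {K : Set Plane} (hK : IsInclusionShape K) :
    IsInclusionShape (swapL '' K) where
  subset_square := by
    rintro _ ⟨x, hx, rfl⟩
    rw [swapL_zero, swapL_one]
    exact (hK.subset_square x hx).symm
  isCompact := hK.isCompact.image swapL.continuous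
  simplyConnected := by
    have := hK.simplyConnected
    exact (swapL.toHomeomorph.image K).symm.toHomotopyEquiv.simplyConnectedSpace
  jordan := by
    obtain ⟨β, C, c, hβ, hβ1, hc, hper, hinj, hd, hh, hr⟩ := hK.jordan
    have hder : deriv (fun t => swapL (c t)) = fun t => swapL (deriv c t) := by
      funext t
      exact (swapL.toContinuousLinearEquiv.hasFDerivAt.comp_hasDerivAt t
        (hc.differentiable one_ne_zero t).hasDerivAt).deriv
    refine ⟨β, C, fun t => swapL (c t), hβ, hβ1, swapL.contDiff.comp hc, fun t => ?_,
      fun s hs t ht h => hinj hs ht (swapL.injective h), fun t h => ?_, ?_, ?_⟩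
    · simp only [hper t]
    · rw [hder] at h
      exact hd t (swapL.map_eq_zero_iff.1 h)
    · rw [hder]
      intro s t
      rw [swapL.edist_map]
      exact hh s t
    · rw [← image_swapL_frontier, ← hr, ← range_comp]; rfl

/-- The cell functions in both coordinates. -/
theorem exists_cell_function_coord {K : Set Plane} (hK : IsInclusionShape K)
    (h1 : !₂[(1 : ℝ), 0] ∈ frontier K) (h2 : !₂[(-1 : ℝ), 0] ∈ frontier K)
    (h3 : !₂[(0 : ℝ), 1] ∈ frontier K) (h4 : !₂[(0 : ℝ), -1] ∈ frontier K)
    {M : ℝ} (hM : ∀ s, |deriv step s| ≤ M) {e : ℝ} (he : 0 < e) (he1 : e ≤ 1) (i : Fin 2) :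
    ∃ t₀ : ℝ, 0 < t₀ ∧ ∀ t, 0 < t → t ≤ t₀ → t ≤ 1 ∧ ∃ Θ : Plane → ℝ, ContDiff ℝ ∞ Θ ∧
      (∀ z : Plane, 1 ≤ |z 0| ∨ 1 ≤ |z 1| → Θ z = step (z i / t)) ∧
      (∀ z ∉ K, ‖fderiv ℝ Θ z‖ ≤ M / t) ∧
      (∀ z ∉ K, t < |z i| ∨ |z (1 - i)| < 1 - e * t → fderiv ℝ Θ z = 0) := by
  -- In `Fin 2`, `1 - i` is the other coordinate; the case `i = 1` is the case `i = 0` for the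
  -- reflected shape.
  fin_cases i
  · exact exists_cell_function hK h3 h4 hM he he1
  · have g1 : !₂[(0 : ℝ), 1] ∈ frontier (swapL '' K) := by
      rw [← image_swapL_frontier]; exact ⟨_, h1, swapL_mk _ _⟩
    have g2 : !₂[(0 : ℝ), -1] ∈ frontier (swapL '' K) := by
      rw [← image_swapL_frontier]; exact ⟨_, h2, swapL_mk _ _⟩
    obtain ⟨t₀, ht₀, h⟩ := exists_cell_function hK.swap g1 g2 hM he he1
    refine ⟨t₀, ht₀, fun t ht htt => ?_⟩
    obtain ⟨ht1, Θ, hs, ho, hb, hz⟩ := h t ht htt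
    have hmem : ∀ z ∉ K, swapL z ∉ swapL '' K := fun z hz hz' => by
      obtain ⟨w, hw, hwz⟩ := hz'
      exact hz (swapL.injective hwz ▸ hw)
    have hder : ∀ z, fderiv ℝ (Θ ∘ swapL) z =
        (fderiv ℝ Θ (swapL z)).comp (swapL.toContinuousLinearEquiv : Plane →L[ℝ] Plane) :=
      fun z => ((hs.differentiable (by simp) (swapL z)).hasFDerivAt.comp z
        swapL.toContinuousLinearEquiv.hasFDerivAt).fderiv
    refine ⟨ht1, Θ ∘ swapL, hs.comp swapL.contDiff, fun z hz' => ?_, fun z hzK => ?_,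
      fun z hzK hz' => ?_⟩
    · have := ho (swapL z) (by rw [swapL_zero, swapL_one]; exact hz'.symm)
      rwa [swapL_zero] at this
    · rw [hder]
      refine (ContinuousLinearMap.opNorm_le_bound _ (norm_nonneg (fderiv ℝ Θ (swapL z)))
        fun w => ?_).trans (hb _ (hmem z hzK))
      refine (ContinuousLinearMap.le_opNorm (fderiv ℝ Θ (swapL z)) (swapL w)).trans ?_
      rw [swapL.norm_map]
    · rw [hder, hz _ (hmem z hzK) (by rw [swapL_zero, swapL_one]; exact hz'),
        ContinuousLinearMap.zero_comp]

/-- Contributions of different cells are never nonzero at the same point, so sums over cells are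
bounded independently of their number. -/
lemma norm_sum_le_of_subsingleton {ι E : Type*} [SeminormedAddCommGroup E] {s : Finset ι}
    {f : ι → E} {M : ℝ} (hM : 0 ≤ M) (hf : ∀ a ∈ s, ‖f a‖ ≤ M)
    (h : ∀ a ∈ s, ∀ b ∈ s, f a ≠ 0 → f b ≠ 0 → a = b) : ‖∑ a ∈ s, f a‖ ≤ M := by
  by_cases h0 : ∃ a ∈ s, f a ≠ 0
  · obtain ⟨a, ha, hfa⟩ := h0
    rw [Finset.sum_eq_single_of_mem a ha fun b hb hba => by
      by_contra hfb
      exact hba (h b hb a ha hfb hfa)]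
    exact hf a ha
  · push Not at h0
    rw [Finset.sum_eq_zero h0, norm_zero]; exact hM

/-- A sum of steps located near the multiples of `l` approximates the identity. -/
lemma sum_steps_bounds {l w : ℝ} (hl : 0 < l) {f : ℕ → ℝ} (hf : ∀ a, f a ∈ Icc (0 : ℝ) 1)
    (h0 : ∀ a : ℕ, w ≤ ((a : ℝ) - 2) * l → f a = 0) (h1 : ∀ a : ℕ, a * l ≤ w → f a = 1) (N : ℕ) :
    l * ∑ a ∈ Finset.Icc 1 N, f a ≤ max 0 (w + 2 * l) ∧
      min (w - l) (N * l) ≤ l * ∑ a ∈ Finset.Icc 1 N, f a := by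
  induction N with
  | zero => simp
  | succ N ih =>
    rw [Finset.sum_Icc_succ_top (by omega), mul_add]
    have hN := hf (N + 1)
    constructor
    · rcases le_total w (((N + 1 : ℕ) - 2 : ℝ) * l) with h | h
      · rw [h0 _ h, mul_zero, add_zero]; exact ih.1
      · refine le_trans ?_ (le_max_right _ _)
        have hS : ∑ a ∈ Finset.Icc 1 N, f a ≤ N := by
          refine (Finset.sum_le_sum fun a _ => (hf a).2).trans ?_
          simp
        push_cast at h
        nlinarith [hN.2]
    · rcases le_total (((N + 1 : ℕ) : ℝ) * l) w with h | h
      · rw [h1 _ h, mul_one]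
        push_cast at h ⊢
        have h2 := ih.2
        have h3 : min (w - l) (N * l) = N * l := min_eq_right (by linarith)
        rw [h3] at h2
        exact (min_le_right _ _).trans (by linarith)
      · push_cast at h ⊢
        have h2 := ih.2
        have h3 : min (w - l) (N * l) = w - l := min_eq_left (by linarith)
        rw [h3] at h2
        refine (min_le_left _ _).trans ?_
        have := mul_nonneg hl.le hN.1
        linarith

/-- The staircase in the coordinate `i`, corrected in each cell by the function `D`. -/
def staircase (ε d t : ℝ) (i : Fin 2) (D : Plane → ℝ) (z : Plane) : ℝ :=
  -- The `i`-th coordinate relative to the cell `(a, a)` depends only on the index in direction `i`,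
  -- so the diagonal cells serve for columns and for rows alike.
  (ε + d) * (∑ a ∈ Finset.Icc 1 (numInclusions ε d), step (cellCoord ε d a a z i / t) +
    ∑ p ∈ Finset.Icc 1 (numInclusions ε d) ×ˢ Finset.Icc 1 (numInclusions ε d),
      D (cellCoord ε d p.1 p.2 z))

lemma contDiff_cellCoord (ε d : ℝ) (a b : ℕ) : ContDiff ℝ ∞ (cellCoord ε d a b) := by
  unfold cellCoord; fun_prop

lemma hasFDerivAt_cellCoord (ε d : ℝ) (a b : ℕ) (z : Plane) :
    HasFDerivAt (cellCoord ε d a b) ((2 / ε) • ContinuousLinearMap.id ℝ Plane) z :=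
  ((hasFDerivAt_id z).sub_const (centre ε d a b)).const_smul (2 / ε)

lemma fderiv_comp_cellCoord {f : Plane → ℝ} (hf : ContDiff ℝ ∞ f) (ε d : ℝ) (a b : ℕ)
    (z : Plane) : fderiv ℝ (fun z => f (cellCoord ε d a b z)) z =
      (2 / ε) • fderiv ℝ f (cellCoord ε d a b z) := by
  have h : HasFDerivAt (fun z => f (cellCoord ε d a b z)) _ z :=
    (hf.differentiable (by simp) _).hasFDerivAt.comp z (hasFDerivAt_cellCoord ε d a b z)
  rw [h.fderiv]
  ext w; simp

lemma contDiff_staircase {D : Plane → ℝ} (hD : ContDiff ℝ ∞ D) (ε d t : ℝ) (i : Fin 2) :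
    ContDiff ℝ ∞ (staircase ε d t i D) := by
  unfold staircase
  refine contDiff_const.mul (ContDiff.add ?_ ?_)
  · exact ContDiff.sum fun a _ => (contDiff_step_coord i t).comp (contDiff_cellCoord ε d a a)
  · exact ContDiff.sum fun p _ => hD.comp (contDiff_cellCoord ε d p.1 p.2)

lemma fderiv_staircase {D : Plane → ℝ} (hD : ContDiff ℝ ∞ D) (ε d t : ℝ) (i : Fin 2)
    (z : Plane) : fderiv ℝ (staircase ε d t i D) z =
      ((ε + d) * (2 / ε)) • (∑ a ∈ Finset.Icc 1 (numInclusions ε d),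
        fderiv ℝ (fun z : Plane => step (z i / t)) (cellCoord ε d a a z) +
      ∑ p ∈ Finset.Icc 1 (numInclusions ε d) ×ˢ Finset.Icc 1 (numInclusions ε d),
        fderiv ℝ D (cellCoord ε d p.1 p.2 z)) := by
  have hs := contDiff_step_coord i t
  have e1 : ∀ a : ℕ, HasFDerivAt (fun z => step (cellCoord ε d a a z i / t))
      ((2 / ε) • fderiv ℝ (fun z : Plane => step (z i / t)) (cellCoord ε d a a z)) z := fun a => by
    rw [← fderiv_comp_cellCoord hs]
    exact ((hs.comp (contDiff_cellCoord ε d a a)).differentiable (by simp) z).hasFDerivAt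
  have e2 : ∀ p : ℕ × ℕ, HasFDerivAt (fun z => D (cellCoord ε d p.1 p.2 z))
      ((2 / ε) • fderiv ℝ D (cellCoord ε d p.1 p.2 z)) z := fun p => by
    rw [← fderiv_comp_cellCoord hD]
    exact ((hD.comp (contDiff_cellCoord ε d p.1 p.2)).differentiable (by simp) z).hasFDerivAt
  have h : HasFDerivAt (staircase ε d t i D) _ z :=
    ((HasFDerivAt.fun_sum (u := Finset.Icc 1 (numInclusions ε d)) fun a _ => e1 a).add
      (HasFDerivAt.fun_sum (u := Finset.Icc 1 (numInclusions ε d) ×ˢ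
        Finset.Icc 1 (numInclusions ε d)) fun p _ => e2 p)).const_mul (ε + d)
  rw [h.fderiv, ← Finset.smul_sum, ← Finset.smul_sum, ← smul_add, smul_smul]

/-- Coordinates relative to two different cells of the same row or column. -/
lemma cellCoord_sub {ε d : ℝ} (hε : 0 < ε) (a b a' b' : ℕ) (z : Plane) :
    cellCoord ε d a b z 0 - cellCoord ε d a' b' z 0 = ((a' : ℝ) - a) * (2 + 2 * d / ε) ∧
    cellCoord ε d a b z 1 - cellCoord ε d a' b' z 1 = ((b' : ℝ) - b) * (2 + 2 * d / ε) := by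
  rw [cellCoord_zero, cellCoord_zero, cellCoord_one, cellCoord_one]
  constructor <;> (field_simp; ring)

lemma nat_eq_of_abs_mul_lt {a b : ℕ} {s x : ℝ} (hs : 2 ≤ s) (h : x = ((b : ℝ) - a) * s)
    (hx : |x| < 2) : a = b := by
  by_contra hne
  have h1 : (1 : ℝ) ≤ |(b : ℝ) - a| := by
    have : (1 : ℤ) ≤ |(b : ℤ) - a| := Int.one_le_abs (by omega)
    exact_mod_cast this
  rw [h, abs_mul, abs_of_pos (by linarith : (0 : ℝ) < s)] at hx
  nlinarith

/-- In rescaled coordinates, the centres of distinct columns or rows are more than `2` apart. -/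
lemma cellCoord_index_eq {ε d : ℝ} (hε : 0 < ε) (hd : 0 < d) {a b a' b' : ℕ} {z : Plane} :
    (|cellCoord ε d a b z 0| < 1 → |cellCoord ε d a' b' z 0| < 1 → a = a') ∧
    (|cellCoord ε d a b z 1| < 1 → |cellCoord ε d a' b' z 1| < 1 → b = b') := by
  obtain ⟨h0, h1⟩ := cellCoord_sub (d := d) hε a b a' b' z
  have hs : 2 ≤ 2 + 2 * d / ε := by have : 0 < 2 * d / ε := by positivity
                                    linarith
  exact ⟨fun u v => nat_eq_of_abs_mul_lt hs h0 ((abs_sub _ _).trans_lt (by linarith)),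
    fun u v => nat_eq_of_abs_mul_lt hs h1 ((abs_sub _ _).trans_lt (by linarith))⟩

lemma fderiv_step_coord_eq_zero {t : ℝ} (ht : 0 < t) (ht1 : t ≤ 1) {i : Fin 2} {z : Plane}
    (h : 1 ≤ |z i|) : fderiv ℝ (fun z : Plane => step (z i / t)) z = 0 := by
  refine fderiv_eq_zero_of_extreme (fun z => step_mem _) ?_
  rcases le_abs.1 h with h | h
  · exact Or.inr (step_of_ge ((one_le_div ht).2 (by linarith)))
  · exact Or.inl (step_of_le (by rw [div_le_iff₀ ht]; linarith))

/-- The gradient vanishes in the open exterior of the square, and by continuity on its boundary,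
where `D` need not vanish locally. -/
lemma fderiv_eq_zero_of_square_support {D : Plane → ℝ} (hD : ContDiff ℝ ∞ D)
    (hD0 : ∀ z : Plane, 1 ≤ |z 0| ∨ 1 ≤ |z 1| → D z = 0) {z : Plane}
    (hz : 1 ≤ |z 0| ∨ 1 ≤ |z 1|) : fderiv ℝ D z = 0 := by
  have hcl : z ∈ closure {w : Plane | 1 < |w 0| ∨ 1 < |w 1|} := by
    refine mem_closure_of_one_lt_smul fun c hc => ?_
    simp only [mem_ofPred_eq, PiLp.smul_apply, smul_eq_mul, abs_mul,
      abs_of_pos (by linarith : 0 < c)]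
    exact hz.imp (fun h => by nlinarith) (fun h => by nlinarith)
  have hop : IsOpen {w : Plane | 1 < |w 0| ∨ 1 < |w 1|} :=
    (isOpen_lt continuous_const (continuous_coord 0).abs).union
      (isOpen_lt continuous_const (continuous_coord 1).abs)
  have hsub : {w : Plane | 1 < |w 0| ∨ 1 < |w 1|} ⊆ {w | fderiv ℝ D w = 0} := by
    intro w hw
    have : D =ᶠ[𝓝 w] fun _ => 0 := by
      filter_upwards [hop.mem_nhds hw] with y hy
      exact hD0 y (hy.imp le_of_lt le_of_lt)
    show fderiv ℝ D w = 0
    rw [this.fderiv_eq]; simp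
  exact closure_minimal hsub (isClosed_eq (hD.continuous_fderiv (by simp)) continuous_const) hcl

/-- The centres start at `ε / 2` horizontally and at `0` vertically; a common bound on this offset
lets both directions be treated together. -/
lemma exists_cellCoord_offset (ε d : ℝ) (hε : 0 < ε) (i : Fin 2) : ∃ o, 0 ≤ o ∧ o ≤ ε / 2 ∧
    ∀ (a : ℕ) (z : Plane), cellCoord ε d a a z i = 2 / ε * (z i - (o + ((a : ℝ) - 1) * (ε + d))) := by
  fin_cases i
  · exact ⟨ε / 2, by positivity, le_rfl, fun a z => cellCoord_zero ε d a a z⟩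
  · exact ⟨0, le_rfl, by positivity, fun a z => by rw [zero_add]; exact cellCoord_one ε d a a z⟩

/-- The staircase is close to the coordinate. -/
lemma abs_staircase_sub_le {ε d t : ℝ} (hε : 0 < ε) (hd : 0 < d) (hdε : d ≤ ε) (ht : 0 < t)
    (ht1 : t ≤ 1) (i : Fin 2) {D : Plane → ℝ} {m : ℝ} (hm : ∀ z, |D z| ≤ m)
    (hD0 : ∀ z : Plane, 1 ≤ |z 0| ∨ 1 ≤ |z 1| → D z = 0) {z : Plane} (hz : -(3 * ε) ≤ z i)
    (hz1 : z i ≤ 1 + 3 * ε) : |staircase ε d t i D z - z i| ≤ (9 + 2 * m) * ε := by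
  have hm0 : 0 ≤ m := (abs_nonneg _).trans (hm 0)
  obtain ⟨o, ho0, ho1, ho⟩ := exists_cellCoord_offset ε d hε i
  set l := ε + d with hl
  have hlpos : 0 < l := by positivity
  set N := numInclusions ε d with hN
  have hNl := lt_numInclusions_mul hε hd
  have hstep := sum_steps_bounds (w := z i - o) hlpos
    (f := fun a => step (cellCoord ε d a a z i / t)) (fun a => step_mem _)
    (fun a ha => step_of_le (by
      rw [div_le_iff₀ ht, ho]
      have h1 : z i - (o + ((a : ℝ) - 1) * l) ≤ -(ε / 2) := by linarith
      have h2 : 2 / ε * (z i - (o + ((a : ℝ) - 1) * l)) ≤ 2 / ε * -(ε / 2) := by gcongr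
      rw [show 2 / ε * -(ε / 2) = -1 by field_simp] at h2
      linarith))
    (fun a ha => step_of_ge (by
      rw [one_le_div ht, ho]
      have h1 : ε / 2 ≤ z i - (o + ((a : ℝ) - 1) * l) := by linarith
      have h2 : 2 / ε * (ε / 2) ≤ 2 / ε * (z i - (o + ((a : ℝ) - 1) * l)) := by gcongr
      rw [show 2 / ε * (ε / 2) = 1 by field_simp] at h2
      linarith)) N
  have hsum : |∑ p ∈ Finset.Icc 1 N ×ˢ Finset.Icc 1 N, D (cellCoord ε d p.1 p.2 z)| ≤ m := by
    refine norm_sum_le_of_subsingleton (f := fun p : ℕ × ℕ => D (cellCoord ε d p.1 p.2 z)) hm0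
      (fun p _ => hm _) fun p _ q _ hp hq => ?_
    have hp' := mt (hD0 _) hp
    have hq' := mt (hD0 _) hq
    push Not at hp' hq'
    exact Prod.ext ((cellCoord_index_eq hε hd).1 hp'.1 hq'.1)
      ((cellCoord_index_eq hε hd).2 hp'.2 hq'.2)
  have hD := abs_le.1 hsum
  rw [staircase, mul_add]
  set S := l * ∑ a ∈ Finset.Icc 1 N, step (cellCoord ε d a a z i / t) with hS
  set T := ∑ p ∈ Finset.Icc 1 N ×ˢ Finset.Icc 1 N, D (cellCoord ε d p.1 p.2 z) with hT
  have hlT : |l * T| ≤ 2 * ε * m := by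
    rw [abs_mul, abs_of_pos hlpos]
    exact mul_le_mul (by linarith) hsum (abs_nonneg _) (by positivity)
  have hlT' := abs_le.1 hlT
  -- The error gathers the offset, at most two periods `ε + d ≤ 2 * ε`, and the distance, at most `4
  -- * ε`, from `z i` to `[0, 1 - ε]`; the constant `9` is generous.
  have hup : S ≤ z i + 9 * ε := hstep.1.trans (max_le (by linarith) (by linarith))
  have hlo : z i - 9 * ε ≤ S := (le_min (by linarith) (by
    change z i - 9 * ε ≤ N * l
    linarith)).trans hstep.2
  exact abs_le.2 ⟨by linarith, by linarith⟩

lemma fderiv_step_coord (t : ℝ) (i : Fin 2) (z : Plane) :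
    fderiv ℝ (fun z : Plane => step (z i / t)) z = (deriv step (z i / t) / t) • coordL i := by
  have h0 : DifferentiableAt ℝ (fun s => step (s / t)) (z i) :=
    (contDiff_step.differentiable (by simp)).differentiableAt.comp _ (by fun_prop)
  have h1 : ∀ g : ℝ → ℝ, DifferentiableAt ℝ g (z i) →
      fderiv ℝ (fun z : Plane => g (z i)) z = deriv g (z i) • coordL i := fun g hg =>
    (hg.hasDerivAt.comp_hasFDerivAt z (coordL i).hasFDerivAt).fderiv
  exact (h1 _ h0).trans (by rw [deriv_step_div])

lemma scale_le_four {ε d : ℝ} (hε : 0 < ε) (hdε : d ≤ ε) : (ε + d) * (2 / ε) ≤ 4 := by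
  rw [mul_div_assoc', div_le_iff₀ hε]; linarith

/-- The gradient of the staircase is bounded, uniformly in the scale. -/
lemma norm_fderiv_staircase_le {M : ℝ} (hM : ∀ s, |deriv step s| ≤ M) {ε d t : ℝ} (hε : 0 < ε)
    (hd : 0 < d) (hdε : d ≤ ε) (ht : 0 < t) (ht1 : t ≤ 1) (i : Fin 2) {D : Plane → ℝ}
    (hD : ContDiff ℝ ∞ D) {m : ℝ} (hm : ∀ z, ‖fderiv ℝ D z‖ ≤ m)
    (hD0 : ∀ z : Plane, 1 ≤ |z 0| ∨ 1 ≤ |z 1| → D z = 0) (z : Plane) :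
    ‖fderiv ℝ (staircase ε d t i D) z‖ ≤ 4 * (M / t + m) := by
  have hm0 : 0 ≤ m := (norm_nonneg _).trans (hm 0)
  have hM0 : 0 ≤ M := (abs_nonneg _).trans (hM 0)
  rw [fderiv_staircase hD, norm_smul, Real.norm_of_nonneg (by positivity)]
  refine mul_le_mul (scale_le_four hε hdε) ((norm_add_le _ _).trans (add_le_add ?_ ?_))
    (norm_nonneg _) (by norm_num)
  · refine norm_sum_le_of_subsingleton (by positivity)
      (fun a _ => norm_fderiv_step_coord_le hM ht i _) fun a _ b _ ha hb => ?_
    have ha' := not_le.1 (mt (fderiv_step_coord_eq_zero ht ht1) ha)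
    have hb' := not_le.1 (mt (fderiv_step_coord_eq_zero ht ht1) hb)
    fin_cases i
    · exact (cellCoord_index_eq hε hd).1 ha' hb'
    · exact (cellCoord_index_eq hε hd).2 ha' hb'
  · refine norm_sum_le_of_subsingleton hm0 (fun p _ => hm _) fun p _ q _ hp hq => ?_
    have hp' := mt (fderiv_eq_zero_of_square_support hD hD0) hp
    have hq' := mt (fderiv_eq_zero_of_square_support hD hD0) hq
    push Not at hp' hq'
    exact Prod.ext ((cellCoord_index_eq hε hd).1 hp'.1 hq'.1)
      ((cellCoord_index_eq hε hd).2 hp'.2 hq'.2)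

/-- `[-1, s - 1]` is one full period, an inclusion and the space that follows it; a shift by a
nonzero multiple of `s` takes it off `(-1, 1)`. -/
lemma one_le_abs_of_shift {a b : ℕ} (hab : a ≠ b) {s x y : ℝ} (hs : 2 ≤ s) (hx : -1 ≤ x) (hxs : x ≤ s - 1)
    (h : x - y = ((b : ℝ) - a) * s) : 1 ≤ |y| := by
  rcases lt_or_gt_of_ne hab with h1 | h1
  · have : (1 : ℝ) ≤ (b : ℝ) - a := by
      have : (a : ℝ) + 1 ≤ b := by exact_mod_cast h1
      linarith
    exact le_abs.2 (Or.inr (by nlinarith))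
  · have : (1 : ℝ) ≤ (a : ℝ) - b := by
      have : (b : ℝ) + 1 ≤ a := by exact_mod_cast h1
      linarith
    exact le_abs.2 (Or.inl (by nlinarith))

/-- Inside a cell, the gradient of the staircase is the rescaled gradient of the cell function. -/
lemma norm_fderiv_staircase_cell_le {ε d t : ℝ} (hε : 0 < ε) (hd : 0 < d) (hdε : d ≤ ε)
    (ht : 0 < t) (ht1 : t ≤ 1) (i : Fin 2) {Θ : Plane → ℝ} (hΘ : ContDiff ℝ ∞ Θ)
    (hΘ0 : ∀ z : Plane, 1 ≤ |z 0| ∨ 1 ≤ |z 1| → Θ z = step (z i / t)) {a b : ℕ}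
    (ha : a ∈ Finset.Icc 1 (numInclusions ε d)) (hb : b ∈ Finset.Icc 1 (numInclusions ε d))
    {z : Plane} (h0 : cellCoord ε d a b z 0 ∈ Icc (-1) (1 + 2 * d / ε))
    (h1 : cellCoord ε d a b z 1 ∈ Icc (-1) (1 + 2 * d / ε)) :
    ‖fderiv ℝ (staircase ε d t i (fun z => Θ z - step (z i / t))) z‖ ≤
      4 * ‖fderiv ℝ Θ (cellCoord ε d a b z)‖ := by
  have hsc : 2 ≤ 2 + 2 * d / ε := by
    have : 0 < 2 * d / ε := by positivity
    linarith
  have hs := contDiff_step_coord i t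
  have hD : ContDiff ℝ ∞ fun z : Plane => Θ z - step (z i / t) := hΘ.sub hs
  have hD0 : ∀ z : Plane, 1 ≤ |z 0| ∨ 1 ≤ |z 1| → Θ z - step (z i / t) = 0 := fun z hz => by
    rw [hΘ0 z hz, sub_self]
  -- A single step can vary in this cell: that of its column if `i = 0`, that of its row if `i = 1`.
  obtain ⟨c, hc, hci, hother⟩ : ∃ c ∈ Finset.Icc 1 (numInclusions ε d),
      cellCoord ε d c c z i = cellCoord ε d a b z i ∧
      ∀ c' : ℕ, c' ≠ c → 1 ≤ |cellCoord ε d c' c' z i| := by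
    fin_cases i
    · refine ⟨a, ha, ?_, fun c' hc' => ?_⟩
      · have := (cellCoord_sub (d := d) hε a a a b z).1
        simp only [sub_self, zero_mul] at this
        exact sub_eq_zero.1 this
      · exact one_le_abs_of_shift hc'.symm hsc h0.1 (by linarith [h0.2])
          (cellCoord_sub (d := d) hε a b c' c' z).1
    · refine ⟨b, hb, ?_, fun c' hc' => ?_⟩
      · have := (cellCoord_sub (d := d) hε b b a b z).2
        simp only [sub_self, zero_mul] at this
        exact sub_eq_zero.1 this
      · exact one_le_abs_of_shift hc'.symm hsc h1.1 (by linarith [h1.2])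
          (cellCoord_sub (d := d) hε a b c' c' z).2
  rw [fderiv_staircase hD]
  rw [Finset.sum_eq_single_of_mem c hc fun c' _ hne =>
    fderiv_step_coord_eq_zero ht ht1 (hother c' hne)]
  rw [Finset.sum_eq_single_of_mem (a, b) (Finset.mem_product.2 ⟨ha, hb⟩) fun p _ hne => by
    refine fderiv_eq_zero_of_square_support hD hD0 ?_
    by_cases hpa : p.1 = a
    · have hpb : p.2 ≠ b := fun h => hne (Prod.ext hpa h)
      exact Or.inr (one_le_abs_of_shift hpb.symm hsc h1.1 (by linarith [h1.2])
        (cellCoord_sub (d := d) hε a b p.1 p.2 z).2)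
    · exact Or.inl (one_le_abs_of_shift (Ne.symm hpa) hsc h0.1 (by linarith [h0.2])
        (cellCoord_sub (d := d) hε a b p.1 p.2 z).1)]
  -- This step cancels the one subtracted from `Θ`, leaving only the gradient of `Θ`.
  have e1 : fderiv ℝ (fun z : Plane => step (z i / t)) (cellCoord ε d c c z) =
      fderiv ℝ (fun z : Plane => step (z i / t)) (cellCoord ε d a b z) := by
    rw [fderiv_step_coord, fderiv_step_coord, hci]
  have e2 : fderiv ℝ (fun z : Plane => Θ z - step (z i / t)) (cellCoord ε d a b z) =
      fderiv ℝ Θ (cellCoord ε d a b z) -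
        fderiv ℝ (fun z : Plane => step (z i / t)) (cellCoord ε d a b z) :=
    ((hΘ.differentiable (by simp) _).hasFDerivAt.sub
      (hs.differentiable (by simp) _).hasFDerivAt).fderiv
  simp only at e1 e2 ⊢
  rw [e1, e2, add_sub_cancel, norm_smul, Real.norm_of_nonneg (by positivity)]
  exact mul_le_mul_of_nonneg_right (scale_le_four hε hdε) (norm_nonneg _)

lemma norm_fderiv_mul_le {f g : Plane → ℝ} (hf : Differentiable ℝ f) (hg : Differentiable ℝ g)
    (hf1 : ∀ z, f z ∈ Icc (0 : ℝ) 1) (hg1 : ∀ z, g z ∈ Icc (0 : ℝ) 1) {A B : ℝ}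
    (hA : ∀ z, ‖fderiv ℝ f z‖ ≤ A) (hB : ∀ z, ‖fderiv ℝ g z‖ ≤ B) (z : Plane) :
    ‖fderiv ℝ (fun z => f z * g z) z‖ ≤ A + B := by
  have h : HasFDerivAt (fun z => f z * g z) _ z := (hf z).hasFDerivAt.mul (hg z).hasFDerivAt
  rw [h.fderiv]
  refine (norm_add_le _ _).trans ?_
  rw [norm_smul, norm_smul, Real.norm_of_nonneg (hf1 z).1, Real.norm_of_nonneg (hg1 z).1]
  have h1 : f z * ‖fderiv ℝ g z‖ ≤ 1 * B :=
    mul_le_mul (hf1 z).2 (hB z) (norm_nonneg _) zero_le_one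
  have h2 : g z * ‖fderiv ℝ f z‖ ≤ 1 * A :=
    mul_le_mul (hg1 z).2 (hA z) (norm_nonneg _) zero_le_one
  linarith

/-- A cut-off equal to `1` near the unit square and supported at distance `3 ε`. -/
lemma exists_square_cutoff {M : ℝ} (hM : ∀ s, |deriv step s| ≤ M) {ε : ℝ} (hε : 0 < ε) :
    ∃ χ : Plane → ℝ, ContDiff ℝ ∞ χ ∧ (∀ z, χ z ∈ Icc (0 : ℝ) 1) ∧
      (∀ z, ‖fderiv ℝ χ z‖ ≤ 4 * (M / ε)) ∧
      (∀ z : Plane, (∀ i, z i ∈ Icc (-ε) (1 + ε)) → χ z = 1) ∧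
      (∀ z : Plane, (∃ i, z i ∉ Icc (-(3 * ε)) (1 + 3 * ε)) → χ z = 0) := by
  have key : ∀ i : Fin 2, ∃ χ : Plane → ℝ, ContDiff ℝ ∞ χ ∧ (∀ z, χ z ∈ Icc (0 : ℝ) 1) ∧
      (∀ z, ‖fderiv ℝ χ z‖ ≤ M / ε + M / ε) ∧
      (∀ z : Plane, z i ∈ Icc (-ε) (1 + ε) → χ z = 1) ∧
      (∀ z : Plane, z i ∉ Icc (-(3 * ε)) (1 + 3 * ε) → χ z = 0) := by
    intro i
    have hstep : ∀ c s : ℝ, (s = 1 ∨ s = -1) →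
        ContDiff ℝ ∞ (fun z : Plane => step ((c + s * z i) / ε)) ∧
        ∀ z, ‖fderiv ℝ (fun z : Plane => step ((c + s * z i) / ε)) z‖ ≤ M / ε := by
      intro c s hs
      have hg : ContDiff ℝ ∞ fun x : ℝ => step ((c + s * x) / ε) :=
        contDiff_step.comp (by fun_prop)
      refine ⟨hg.comp (contDiff_coord i), fun z => ?_⟩
      refine (norm_fderiv_comp_coord_le (g := fun x : ℝ => step ((c + s * x) / ε)) i z
        (hg.differentiable (by simp) _)).trans ?_
      have h1 : HasDerivAt (fun x : ℝ => (c + s * x) / ε) (s * 1 / ε) (z i) :=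
        (((hasDerivAt_id (z i)).const_mul s).const_add c).div_const ε
      have h2 : HasDerivAt (step ∘ fun x : ℝ => (c + s * x) / ε)
          (deriv step ((c + s * z i) / ε) * (s * 1 / ε)) (z i) :=
        (contDiff_step.differentiable (by simp) _).hasDerivAt.comp _ h1
      have h3 : deriv (fun x : ℝ => step ((c + s * x) / ε)) (z i) = _ := h2.deriv
      rw [h3, mul_one, abs_mul, abs_div, abs_of_pos hε]
      have : |s| = 1 := by rcases hs with h | h <;> rw [h] <;> norm_num
      rw [this, mul_one_div]
      gcongr
      exact hM _
    -- The two steps vary on `[-3ε, -ε]` and on `[1 + ε, 1 + 3ε]`.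
    obtain ⟨s1, b1⟩ := hstep (2 * ε) 1 (Or.inl rfl)
    obtain ⟨s2, b2⟩ := hstep (1 + 2 * ε) (-1) (Or.inr rfl)
    refine ⟨_, s1.mul s2, fun z => ?_, norm_fderiv_mul_le (s1.differentiable (by simp))
      (s2.differentiable (by simp)) (fun z => step_mem _) (fun z => step_mem _) b1 b2,
      fun z hz => ?_, fun z hz => ?_⟩
    · exact ⟨mul_nonneg (step_nonneg _) (step_nonneg _),
        mul_le_one₀ (step_le_one _) (step_nonneg _) (step_le_one _)⟩
    · rw [step_of_ge ((one_le_div hε).2 (by linarith [hz.1])),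
        step_of_ge ((one_le_div hε).2 (by linarith [hz.2])), one_mul]
    · rcases not_and_or.1 hz with h | h
      · rw [step_of_le (s := (2 * ε + 1 * z i) / ε) (by
          rw [div_le_iff₀ hε]; linarith [not_le.1 h]), zero_mul]
      · rw [step_of_le (s := (1 + 2 * ε + -1 * z i) / ε) (by
          rw [div_le_iff₀ hε]; linarith [not_le.1 h]), mul_zero]
  obtain ⟨χ₀, a0, b0, c0, d0, e0⟩ := key 0
  obtain ⟨χ₁, a1, b1, c1, d1, e1⟩ := key 1
  refine ⟨_, a0.mul a1, fun z => ⟨mul_nonneg (b0 z).1 (b1 z).1,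
    mul_le_one₀ (b0 z).2 (b1 z).1 (b1 z).2⟩, fun z => ?_, fun z hz => ?_, fun z hz => ?_⟩
  · exact (norm_fderiv_mul_le (a0.differentiable (by simp)) (a1.differentiable (by simp))
      b0 b1 c0 c1 z).trans (le_of_eq (by ring))
  · rw [d0 z (hz 0), d1 z (hz 1), one_mul]
  · obtain ⟨i, hi⟩ := hz
    fin_cases i
    · rw [e0 z hi, zero_mul]
    · rw [e1 z hi, mul_zero]

lemma isOpen_squareExterior : IsOpen squareExterior :=
  ((isClosed_Icc.preimage (continuous_coord 0)).inter
    (isClosed_Icc.preimage (continuous_coord 1))).isOpen_compl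

/-- The map of the plane with given components. -/
def planeMap (X Y : Plane → ℝ) (z : Plane) : Plane :=
  X z • EuclideanSpace.single 0 (1 : ℝ) + Y z • EuclideanSpace.single 1 (1 : ℝ)

lemma contDiff_planeMap {X Y : Plane → ℝ} (hX : ContDiff ℝ ∞ X) (hY : ContDiff ℝ ∞ Y) :
    ContDiff ℝ ∞ (planeMap X Y) :=
  (hX.smul contDiff_const).add (hY.smul contDiff_const)

lemma norm_planeMap_sub_le (X Y : Plane → ℝ) (z : Plane) :
    ‖planeMap X Y z - z‖ ≤ |X z - z 0| + |Y z - z 1| := by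
  refine (norm_le_abs_add_abs _).trans (le_of_eq ?_)
  simp [planeMap]

lemma norm_fderiv_comp_planeMap_le {P X Y : Plane → ℝ} (hP : Differentiable ℝ P) {C : ℝ}
    (hC : ∀ z, ‖fderiv ℝ P z‖ ≤ C) {z : Plane} (hX : DifferentiableAt ℝ X z)
    (hY : DifferentiableAt ℝ Y z) :
    ‖fderiv ℝ (fun z => P (planeMap X Y z)) z‖ ≤ C * (‖fderiv ℝ X z‖ + ‖fderiv ℝ Y z‖) := by
  have h1 : HasFDerivAt (planeMap X Y)
      ((fderiv ℝ X z).smulRight (EuclideanSpace.single 0 (1 : ℝ)) +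
        (fderiv ℝ Y z).smulRight (EuclideanSpace.single 1 (1 : ℝ))) z :=
    (hX.hasFDerivAt.smul_const _).add (hY.hasFDerivAt.smul_const _)
  have h2 : HasFDerivAt (fun z => P (planeMap X Y z)) _ z := (hP _).hasFDerivAt.comp z h1
  rw [h2.fderiv]
  refine (ContinuousLinearMap.opNorm_comp_le _ _).trans ?_
  refine mul_le_mul (hC _) ((norm_add_le _ _).trans (le_of_eq ?_)) (norm_nonneg _)
    ((norm_nonneg _).trans (hC z))
  rw [ContinuousLinearMap.norm_smulRight_apply, ContinuousLinearMap.norm_smulRight_apply]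
  simp

lemma abs_comp_planeMap_sub_le {P : Plane → ℝ} (X Y : Plane → ℝ) (hP : Differentiable ℝ P) {C : ℝ}
    (hC : ∀ z, ‖fderiv ℝ P z‖ ≤ C) (z : Plane) :
    |P (planeMap X Y z) - P z| ≤ C * (|X z - z 0| + |Y z - z 1|) := by
  have h := convex_univ.norm_image_sub_le_of_norm_fderiv_le (f := P) (𝕜 := ℝ)
    (fun x _ => hP x) (fun x _ => hC x) (mem_univ z) (mem_univ (planeMap X Y z))
  exact h.trans (mul_le_mul_of_nonneg_left (norm_planeMap_sub_le X Y z)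
    ((norm_nonneg _).trans (hC z)))

lemma hasFDerivAt_blend {P Q χ : Plane → ℝ} (hP : Differentiable ℝ P) (hQ : Differentiable ℝ Q)
    (hχ : Differentiable ℝ χ) (z : Plane) :
    HasFDerivAt (fun z => P z + χ z * (Q z - P z))
      (fderiv ℝ P z + (χ z • (fderiv ℝ Q z - fderiv ℝ P z) + (Q z - P z) • fderiv ℝ χ z)) z :=
  (hP z).hasFDerivAt.add
    ((hχ z).hasFDerivAt.mul ((hQ z).hasFDerivAt.sub (hP z).hasFDerivAt))

/-! ### Gaps of the lattice and the competitor for the square -/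

/-- The parts of the cell `(a, b)` outside the inclusion where the gradient may be large. -/
def cellGaps (ε d e t : ℝ) (a b : ℕ) : Set Plane :=
  {z | cellCoord ε d a b z 0 ∈ Icc (-1) (1 + 2 * d / ε) ∧
      cellCoord ε d a b z 1 ∈ Icc (-1) (1 + 2 * d / ε) ∧
      ((|cellCoord ε d a b z 0| ≤ t ∧ 1 - e * t ≤ |cellCoord ε d a b z 1|) ∨
        (|cellCoord ε d a b z 1| ≤ t ∧ 1 - e * t ≤ |cellCoord ε d a b z 0|))}

lemma isClosed_cellGaps (ε d e t : ℝ) (a b : ℕ) : IsClosed (cellGaps ε d e t a b) := by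
  have hc : ∀ i, Continuous fun z => cellCoord ε d a b z i := fun i =>
    (continuous_coord i).comp (contDiff_cellCoord ε d a b).continuous
  have h1 : ∀ i, IsClosed {z | |cellCoord ε d a b z i| ≤ t} := fun i =>
    isClosed_le (hc i).abs continuous_const
  have h2 : ∀ i, IsClosed {z | 1 - e * t ≤ |cellCoord ε d a b z i|} := fun i =>
    isClosed_le continuous_const (hc i).abs
  exact (isClosed_Icc.preimage (hc 0)).inter ((isClosed_Icc.preimage (hc 1)).inter
    (((h1 0).inter (h2 1)).union ((h1 1).inter (h2 0))))

lemma volume_rect_ne_top (a b c d : ℝ) : volume (rect a b c d) ≠ ⊤ := by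
  rw [volume_rect]
  exact ENNReal.mul_ne_top ENNReal.ofReal_ne_top ENNReal.ofReal_ne_top

/-- A cell has four contact rectangles of width `ε * t` and depth `ε * e * t / 2`; the right and
upper ones are deeper by `d`, the free space before the next cell. -/
lemma volume_real_cellGaps_le {ε d e t : ℝ} (hε : 0 < ε) (hd : 0 < d) (he : 0 ≤ e) (ht : 0 ≤ t)
    (a b : ℕ) : volume (cellGaps ε d e t a b) ≠ ⊤ ∧
      volume.real (cellGaps ε d e t a b) ≤ ε ^ 2 * (2 * t * (e * t + d / ε)) := by
  set x := ε / 2 + ((a : ℝ) - 1) * (ε + d) with hx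
  set y := ((b : ℝ) - 1) * (ε + d) with hy
  set τ := ε / 2 * t with hτ
  set η := ε / 2 * (e * t) with hη
  have hτ0 : 0 ≤ τ := by positivity
  have hη0 : 0 ≤ η := by positivity
  have hsub : cellGaps ε d e t a b ⊆
      (rect (x - τ) (x + τ) (y + ε / 2 - η) (y + ε / 2 + d) ∪
        rect (x - τ) (x + τ) (y - ε / 2) (y - ε / 2 + η)) ∪
      (rect (x + ε / 2 - η) (x + ε / 2 + d) (y - τ) (y + τ) ∪
        rect (x - ε / 2) (x - ε / 2 + η) (y - τ) (y + τ)) := by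
    rintro z ⟨h0, h1, h⟩
    have c0 : z 0 = x + ε / 2 * cellCoord ε d a b z 0 := by
      rw [cellCoord_zero, ← hx]; field_simp; ring
    have c1 : z 1 = y + ε / 2 * cellCoord ε d a b z 1 := by
      rw [cellCoord_one, ← hy]; field_simp; ring
    generalize cellCoord ε d a b z 0 = k at *
    generalize cellCoord ε d a b z 1 = l at *
    have key : ∀ {s r : ℝ}, s ≤ r → ε / 2 * s ≤ ε / 2 * r := fun h =>
      mul_le_mul_of_nonneg_left h (by positivity)
    have hdd : ε / 2 * (1 + 2 * d / ε) = ε / 2 + d := by field_simp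
    have m1 : ε / 2 * -1 = -(ε / 2) := by ring
    have a0 := key h0.1
    have a1 := key h0.2
    have b0 := key h1.1
    have b1 := key h1.2
    rw [hdd] at a1 b1
    rw [m1] at a0 b0
    have e1 : ε / 2 * (1 - e * t) = ε / 2 - η := by rw [hη]; ring
    have e2 : ε / 2 * -t = -τ := by rw [hτ]; ring
    rcases h with ⟨hk, hl⟩ | ⟨hl, hk⟩
    · left
      have p1 := key (abs_le.1 hk).1
      have p2 := key (abs_le.1 hk).2
      rw [e2] at p1
      rcases le_abs.1 hl with hl | hl
      · have p3 := key hl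
        rw [e1] at p3
        exact Or.inl ⟨⟨by linarith, by linarith⟩, ⟨by linarith, by linarith⟩⟩
      · have p3 := key hl
        rw [e1] at p3
        exact Or.inr ⟨⟨by linarith, by linarith⟩, ⟨by linarith, by linarith⟩⟩
    · right
      have p1 := key (abs_le.1 hl).1
      have p2 := key (abs_le.1 hl).2
      rw [e2] at p1
      rcases le_abs.1 hk with hk | hk
      · have p3 := key hk
        rw [e1] at p3
        exact Or.inl ⟨⟨by linarith, by linarith⟩, ⟨by linarith, by linarith⟩⟩
      · have p3 := key hk
        rw [e1] at p3
        exact Or.inr ⟨⟨by linarith, by linarith⟩, ⟨by linarith, by linarith⟩⟩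
  have hfin := fun p q r s => volume_rect_ne_top p q r s
  have hfinU : ∀ p q r s p' q' r' s', volume (rect p q r s ∪ rect p' q' r' s') ≠ ⊤ :=
    fun p q r s p' q' r' s' => measure_union_ne_top (hfin _ _ _ _) (hfin _ _ _ _)
  have htop := measure_union_ne_top (hfinU (x - τ) (x + τ) (y + ε / 2 - η) (y + ε / 2 + d) (x - τ) (x + τ) (y - ε / 2) (y - ε / 2 + η))
    (hfinU (x + ε / 2 - η) (x + ε / 2 + d) (y - τ) (y + τ) (x - ε / 2) (x - ε / 2 + η) (y - τ) (y + τ))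
  refine ⟨ne_top_of_le_ne_top htop (measure_mono hsub), ?_⟩
  refine (measureReal_mono hsub htop).trans ((measureReal_union_le _ _).trans
    ((add_le_add (measureReal_union_le _ _) (measureReal_union_le _ _)).trans (le_of_eq ?_)))
  rw [volume_real_rect_le (by linarith) (by linarith), volume_real_rect_le (by linarith) (by linarith),
    volume_real_rect_le (by linarith) (by linarith), volume_real_rect_le (by linarith) (by linarith),
    hτ, hη]
  field_simp
  ring

/-- The union of the gaps of all the cells. -/
def latticeGaps (ε d e t : ℝ) : Set Plane :=
  ⋃ p ∈ Finset.Icc 1 (numInclusions ε d) ×ˢ Finset.Icc 1 (numInclusions ε d),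
    cellGaps ε d e t p.1 p.2

lemma isClosed_latticeGaps (ε d e t : ℝ) : IsClosed (latticeGaps ε d e t) :=
  isClosed_biUnion_finset fun _ _ => isClosed_cellGaps _ _ _ _ _ _

lemma numInclusions_mul_scale_le {ε d : ℝ} (hε : 0 < ε) (hd : 0 < d) :
    (numInclusions ε d : ℝ) * ε ≤ 1 := by
  have h2 := numInclusions_mul_le hε hd
  rcases Nat.eq_zero_or_pos (numInclusions ε d) with h0 | h0
  · rw [h0]; simp
  · have : (1 : ℝ) ≤ numInclusions ε d := by exact_mod_cast h0
    nlinarith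

lemma volume_real_latticeGaps_le {ε d e t : ℝ} (hε : 0 < ε) (hd : 0 < d) (he : 0 ≤ e)
    (ht : 0 ≤ t) : volume (latticeGaps ε d e t) ≠ ⊤ ∧
      volume.real (latticeGaps ε d e t) ≤ 2 * t * (e * t + d / ε) := by
  have hc := volume_real_cellGaps_le hε hd he ht
  refine ⟨(measure_biUnion_lt_top (Finset.finite_toSet _) fun p _ =>
    (hc p.1 p.2).1.lt_top).ne, ?_⟩
  refine (measureReal_biUnion_finset_le _ _).trans
    ((Finset.sum_le_sum fun p _ => (hc p.1 p.2).2).trans ?_)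
  rw [Finset.sum_const, Finset.card_product, Nat.card_Icc, add_tsub_cancel_right, nsmul_eq_mul]
  push_cast
  have hN := numInclusions_mul_scale_le hε hd
  set N := (numInclusions ε d : ℝ)
  have hN0 : 0 ≤ N * ε := by positivity
  calc N * N * (ε ^ 2 * (2 * t * (e * t + d / ε)))
      = (N * ε) ^ 2 * (2 * t * (e * t + d / ε)) := by ring
    _ ≤ 1 * (2 * t * (e * t + d / ε)) :=
        mul_le_mul_of_nonneg_right (pow_le_one₀ hN0 hN) (by positivity)
    _ = _ := one_mul _

/-- The points of the square away from its sides lie in a cell of the lattice. -/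
lemma exists_cell {ε d : ℝ} (hε : 0 < ε) (hd : 0 < d) {z : Plane}
    (hz : ∀ i, z i ∈ Ioo 0 (1 - 3 * ε)) : ∃ a ∈ Finset.Icc 1 (numInclusions ε d),
      ∃ b ∈ Finset.Icc 1 (numInclusions ε d),
        cellCoord ε d a b z 0 ∈ Icc (-1) (1 + 2 * d / ε) ∧
        cellCoord ε d a b z 1 ∈ Icc (-1) (1 + 2 * d / ε) := by
  have key : ∀ w : ℝ, 0 ≤ w → w < 1 - ε → ∃ a ∈ Finset.Icc 1 (numInclusions ε d),
      2 / ε * (w - (ε / 2 + ((a : ℝ) - 1) * (ε + d))) ∈ Icc (-1) (1 + 2 * d / ε) := by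
    intro w hw hw1
    have hlpos : 0 < ε + d := by positivity
    set i := ⌊w / (ε + d)⌋₊ with hi
    have hi1 : (i : ℝ) * (ε + d) ≤ w := by
      rw [← le_div_iff₀ hlpos]; exact Nat.floor_le (by positivity)
    have hi2 : w < (i + 1) * (ε + d) := by
      rw [← div_lt_iff₀ hlpos]; exact Nat.lt_floor_add_one _
    have hiN : i < numInclusions ε d := by
      have h2 := lt_numInclusions_mul hε hd
      have h3 : (i : ℝ) * (ε + d) < numInclusions ε d * (ε + d) := by linarith
      exact_mod_cast lt_of_mul_lt_mul_right h3 hlpos.le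
    refine ⟨i + 1, Finset.mem_Icc.2 ⟨by omega, by omega⟩, ?_⟩
    push_cast
    have h1 : -1 = 2 / ε * -(ε / 2) := by field_simp
    have h2 : 1 + 2 * d / ε = 2 / ε * (ε / 2 + d) := by field_simp
    rw [h1, h2]
    exact ⟨mul_le_mul_of_nonneg_left (by linarith) (by positivity),
      mul_le_mul_of_nonneg_left (by linarith) (by positivity)⟩
  obtain ⟨a, ha, h0⟩ := key (z 0) (hz 0).1.le (by linarith [(hz 0).2])
  -- The rows start at height `-ε / 2`, hence the shift that reduces the vertical count to the
  -- horizontal one.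
  obtain ⟨b, hb, h1⟩ := key (z 1 + ε / 2) (by linarith [(hz 1).1]) (by linarith [(hz 1).2])
  refine ⟨a, ha, b, hb, by rwa [cellCoord_zero], ?_⟩
  rw [cellCoord_one]
  rwa [show z 1 - ((b : ℝ) - 1) * (ε + d) =
    z 1 + ε / 2 - (ε / 2 + ((b : ℝ) - 1) * (ε + d)) by ring]

lemma mem_squareFluidDomain_iff {K : Set Plane} {ε d : ℝ} (hε : 0 < ε) {z : Plane} :
    z ∈ squareFluidDomain K ε d ↔ ∀ a ∈ Finset.Icc 1 (numInclusions ε d),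
      ∀ b ∈ Finset.Icc 1 (numInclusions ε d), cellCoord ε d a b z ∉ K := by
  simp only [squareFluidDomain, mem_compl_iff, mem_iUnion, not_exists, mem_inclusion_iff hε]

lemma exists_bounds_of_square_support {D : Plane → ℝ} (hD : ContDiff ℝ ∞ D)
    (hD0 : ∀ z : Plane, 1 ≤ |z 0| ∨ 1 ≤ |z 1| → D z = 0) :
    ∃ m, (∀ z, |D z| ≤ m) ∧ ∀ z, ‖fderiv ℝ D z‖ ≤ m := by
  have hc : HasCompactSupport D :=
    HasCompactSupport.intro (isCompact_closedBall 0 2) fun z hz => hD0 z <| by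
      by_contra! h
      exact hz (mem_closedBall_zero_iff.2 ((norm_le_abs_add_abs z).trans (by linarith [h.1, h.2])))
  obtain ⟨m₁, h1⟩ := hD.continuous.bounded_above_of_compact_support hc
  obtain ⟨m₂, h2⟩ := (hD.continuous_fderiv (by simp)).bounded_above_of_compact_support (hc.fderiv ℝ)
  exact ⟨max m₁ m₂, fun z => (h1 z).trans (le_max_left _ _), fun z => (h2 z).trans (le_max_right _ _)⟩

/-- A smooth competitor which agrees with `P` away from the square and is locally constant in the
fluid inside the square, except in thin gaps. -/
theorem exists_square_competitor {K : Set Plane} (hK : IsInclusionShape K)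
    (h1 : !₂[(1 : ℝ), 0] ∈ frontier K) (h2 : !₂[(-1 : ℝ), 0] ∈ frontier K)
    (h3 : !₂[(0 : ℝ), 1] ∈ frontier K) (h4 : !₂[(0 : ℝ), -1] ∈ frontier K)
    {M : ℝ} (hM : ∀ s, |deriv step s| ≤ M) {P : Plane → ℝ} (hP : ContDiff ℝ ∞ P) {C : ℝ}
    (hPc : HasCompactSupport P) (hC : ∀ z, ‖fderiv ℝ P z‖ ≤ C) {e : ℝ} (he : 0 < e) (he1 : e ≤ 1) :
    ∃ t C' : ℝ, 0 < t ∧ 0 ≤ C' ∧ ∀ ε d, 0 < ε → 0 < d → d ≤ ε → ∃ φ : Plane → ℝ,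
      ContDiff ℝ ∞ φ ∧ HasCompactSupport φ ∧ (∀ z, ‖fderiv ℝ φ z‖ ≤ C') ∧
      (∀ z : Plane, (∃ i, z i ∉ Icc (-(3 * ε)) (1 + 3 * ε)) → fderiv ℝ φ z = fderiv ℝ P z) ∧
      ∀ z ∈ squareFluidDomain K ε d, (∀ i, z i ∈ Ioo 0 (1 - 3 * ε)) →
        ‖fderiv ℝ φ z‖ ≤ (latticeGaps ε d e t).indicator (fun _ => 8 * C * M / t) z := by
  have hM0 : 0 ≤ M := (abs_nonneg _).trans (hM 0)
  have hC0 : 0 ≤ C := (norm_nonneg _).trans (hC 0)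
  obtain ⟨t₀, ht₀, H0⟩ := exists_cell_function_coord hK h1 h2 h3 h4 hM he he1 0
  obtain ⟨t₁, ht₁, H1⟩ := exists_cell_function_coord hK h1 h2 h3 h4 hM he he1 1
  set t := min t₀ t₁ with htdef
  have ht : 0 < t := lt_min ht₀ ht₁
  obtain ⟨ht1, Θ₀, hs0, ho0, hb0, hz0⟩ := H0 t ht (min_le_left _ _)
  obtain ⟨-, Θ₁, hs1, ho1, hb1, hz1⟩ := H1 t ht (min_le_right _ _)
  have hD₀ : ContDiff ℝ ∞ fun z : Plane => Θ₀ z - step (z 0 / t) := hs0.sub (contDiff_step_coord 0 t)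
  have hD₁ : ContDiff ℝ ∞ fun z : Plane => Θ₁ z - step (z 1 / t) := hs1.sub (contDiff_step_coord 1 t)
  have hD₀0 : ∀ z : Plane, 1 ≤ |z 0| ∨ 1 ≤ |z 1| → Θ₀ z - step (z 0 / t) = 0 := fun z hz => by
    rw [ho0 z hz, sub_self]
  have hD₁0 : ∀ z : Plane, 1 ≤ |z 0| ∨ 1 ≤ |z 1| → Θ₁ z - step (z 1 / t) = 0 := fun z hz => by
    rw [ho1 z hz, sub_self]
  obtain ⟨m₀, hm₀, hm₀'⟩ := exists_bounds_of_square_support hD₀ hD₀0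
  obtain ⟨m₁, hm₁, hm₁'⟩ := exists_bounds_of_square_support hD₁ hD₁0
  have hm₀0 : 0 ≤ m₀ := (abs_nonneg _).trans (hm₀ 0)
  have hm₁0 : 0 ≤ m₁ := (abs_nonneg _).trans (hm₁ 0)
  set C' := C + (C * (4 * (M / t + m₀) + 4 * (M / t + m₁)) + C) +
    C * ((9 + 2 * m₀) + (9 + 2 * m₁)) * (4 * M) with hC'
  refine ⟨t, C', ht, by positivity, fun ε d hε hd hdε => ?_⟩
  set X := staircase ε d t 0 fun z => Θ₀ z - step (z 0 / t) with hX
  set Y := staircase ε d t 1 fun z => Θ₁ z - step (z 1 / t) with hY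
  have hXs : ContDiff ℝ ∞ X := contDiff_staircase hD₀ ε d t 0
  have hYs : ContDiff ℝ ∞ Y := contDiff_staircase hD₁ ε d t 1
  have hXd := hXs.differentiable (by simp)
  have hYd := hYs.differentiable (by simp)
  have hPd := hP.differentiable (by simp)
  obtain ⟨χ, hχ, hχ1, hχb, hχin, hχout⟩ := exists_square_cutoff hM hε
  have hχd := hχ.differentiable (by simp)
  -- Since `X` and `Y` are flat in the fluid off the gaps and close to the coordinates, `Q` is flat
  -- there and close to `P`.
  set Q : Plane → ℝ := fun z => P (planeMap X Y z) with hQ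
  have hQs : ContDiff ℝ ∞ Q := hP.comp (contDiff_planeMap hXs hYs)
  have hQd := hQs.differentiable (by simp)
  have hder := fun z => (hasFDerivAt_blend hPd hQd hχd z).fderiv
  have hQb : ∀ z, ‖fderiv ℝ Q z‖ ≤ C * (‖fderiv ℝ X z‖ + ‖fderiv ℝ Y z‖) := fun z =>
    norm_fderiv_comp_planeMap_le hPd hC (hXd z) (hYd z)
  have hout : ∀ z : Plane, (∃ i, z i ∉ Icc (-(3 * ε)) (1 + 3 * ε)) →
      fderiv ℝ (fun z => P z + χ z * (Q z - P z)) z = fderiv ℝ P z := fun z hz => by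
    rw [hder, hχout z hz, fderiv_eq_zero_of_extreme hχ1 (Or.inl (hχout z hz)), zero_smul,
      smul_zero, add_zero, add_zero]
  refine ⟨fun z => P z + χ z * (Q z - P z), hP.add (hχ.mul (hQs.sub hP)), ?_, fun z => ?_, hout,
    fun z hzF hz => ?_⟩
  · have hχc : HasCompactSupport χ :=
      HasCompactSupport.intro (isCompact_closedBall 0 (2 * (1 + 3 * ε))) fun z hz => hχout z <| by
        by_contra! h
        refine hz (mem_closedBall_zero_iff.2 ((norm_le_abs_add_abs z).trans ?_))
        have a0 := abs_le.2 ⟨by linarith [(h 0).1], (h 0).2⟩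
        have a1 := abs_le.2 ⟨by linarith [(h 1).1], (h 1).2⟩
        linarith
    exact hPc.add hχc.mul_right
  · by_cases hz : ∃ i, z i ∉ Icc (-(3 * ε)) (1 + 3 * ε)
    · rw [hout z hz]
      refine (hC z).trans ?_
      have : 0 ≤ (C * (4 * (M / t + m₀) + 4 * (M / t + m₁)) + C) +
        C * ((9 + 2 * m₀) + (9 + 2 * m₁)) * (4 * M) := by positivity
      rw [hC']; linarith
    push Not at hz
    rw [hder, hC', add_assoc]
    refine (norm_add_le _ _).trans (add_le_add (hC z) ((norm_add_le _ _).trans (add_le_add ?_ ?_)))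
    · rw [norm_smul, Real.norm_of_nonneg (hχ1 z).1]
      refine (mul_le_of_le_one_left (norm_nonneg _) (hχ1 z).2).trans ((norm_sub_le _ _).trans
        (add_le_add ((hQb z).trans ?_) (hC z)))
      exact mul_le_mul_of_nonneg_left (add_le_add
        (norm_fderiv_staircase_le hM hε hd hdε ht ht1 0 hD₀ hm₀' hD₀0 z)
        (norm_fderiv_staircase_le hM hε hd hdε ht ht1 1 hD₁ hm₁' hD₁0 z)) hC0
    · rw [norm_smul, Real.norm_eq_abs]
      -- This `O(ε)` closeness compensates the gradient `4 * (M / ε)` of the cut-off, so `C'` does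
      -- not depend on the scale.
      have hQP : |Q z - P z| ≤ C * ((9 + 2 * m₀) * ε + (9 + 2 * m₁) * ε) :=
        (abs_comp_planeMap_sub_le X Y hPd hC z).trans (mul_le_mul_of_nonneg_left (add_le_add
          (abs_staircase_sub_le hε hd hdε ht ht1 0 hm₀ hD₀0 (hz 0).1 (hz 0).2)
          (abs_staircase_sub_le hε hd hdε ht ht1 1 hm₁ hD₁0 (hz 1).1 (hz 1).2)) hC0)
      refine (mul_le_mul hQP (hχb z) (norm_nonneg _) (by positivity)).trans (le_of_eq ?_)
      field_simp
  · have hz' : ∀ i, z i ∈ Icc (-ε) (1 + ε) := fun i =>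
      ⟨by linarith [(hz i).1], by linarith [(hz i).2]⟩
    rw [hder, hχin z hz', fderiv_eq_zero_of_extreme hχ1 (Or.inr (hχin z hz')), smul_zero,
      add_zero, one_smul, add_sub_cancel]
    obtain ⟨a, ha, b, hb, hk0, hk1⟩ := exists_cell hε hd hz
    have hk := (mem_squareFluidDomain_iff hε).1 hzF a ha b hb
    have hX' := norm_fderiv_staircase_cell_le hε hd hdε ht ht1 0 hs0 ho0 ha hb hk0 hk1
    have hY' := norm_fderiv_staircase_cell_le hε hd hdε ht ht1 1 hs1 ho1 ha hb hk0 hk1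
    rw [← hX] at hX'
    rw [← hY] at hY'
    refine (hQb z).trans ?_
    by_cases hzB : z ∈ latticeGaps ε d e t
    · rw [indicator_of_mem hzB]
      calc C * (‖fderiv ℝ X z‖ + ‖fderiv ℝ Y z‖) ≤ C * (4 * (M / t) + 4 * (M / t)) :=
            mul_le_mul_of_nonneg_left (by linarith [hb0 _ hk, hb1 _ hk]) hC0
        _ = _ := by ring
    · rw [indicator_of_notMem hzB]
      have hzc : z ∉ cellGaps ε d e t a b := fun h =>
        hzB (mem_biUnion (x := (a, b)) (Finset.mem_coe.2 (Finset.mem_product.2 ⟨ha, hb⟩)) h)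
      -- Outside the contact rectangles, both cell functions have zero gradient.
      have hno : ¬ _ := fun h => hzc ⟨hk0, hk1, h⟩
      rw [not_or, not_and_or, not_and_or, not_le, not_le, not_le, not_le] at hno
      have e0 := hz0 _ hk hno.1
      have e1 := hz1 _ hk hno.2
      rw [e0, norm_zero, mul_zero] at hX'
      rw [e1, norm_zero, mul_zero] at hY'
      exact (mul_le_mul_of_nonneg_left (add_le_add hX' hY') hC0).trans (by simp)

/-! ### Passage to the limit for the square -/

lemma mem_squareFluidDomain_of_notMem {K : Set Plane} (hK : IsInclusionShape K) {ε d : ℝ}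
    (hε : 0 < ε) (hd : 0 < d) {z : Plane} (hz : ∃ i, z i ∉ Icc (-(3 * ε)) (1 + 3 * ε)) :
    z ∈ squareFluidDomain K ε d := by
  refine (mem_squareFluidDomain_iff hε).2 fun a ha b hb h => ?_
  have hN := numInclusions_mul_le hε hd
  have key : ∀ (a : ℕ), a ∈ Finset.Icc 1 (numInclusions ε d) → ∀ o w : ℝ, 0 ≤ o → o ≤ ε / 2 →
      |2 / ε * (w - (o + ((a : ℝ) - 1) * (ε + d)))| ≤ 1 → w ∈ Icc (-(3 * ε)) (1 + 3 * ε) := by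
    intro a ha o w ho ho' hw
    obtain ⟨ha1, haN⟩ := Finset.mem_Icc.1 ha
    have ha1' : (1 : ℝ) ≤ a := by exact_mod_cast ha1
    have haN' : (a : ℝ) ≤ numInclusions ε d := by exact_mod_cast haN
    have hlo : 0 ≤ ((a : ℝ) - 1) * (ε + d) := mul_nonneg (by linarith) (by positivity)
    have hup : (a : ℝ) * (ε + d) ≤ numInclusions ε d * (ε + d) :=
      mul_le_mul_of_nonneg_right haN' (by positivity)
    rw [abs_mul, abs_of_pos (by positivity), div_mul_eq_mul_div, div_le_one hε] at hw
    have hw' := abs_le.1 (show |w - (o + ((a : ℝ) - 1) * (ε + d))| ≤ ε / 2 by linarith)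
    exact ⟨by linarith, by linarith⟩
  have hk := hK.subset_square _ h
  rw [cellCoord_zero, cellCoord_one] at hk
  obtain ⟨i, hi⟩ := hz
  fin_cases i
  · exact hi (key a ha _ _ (by positivity) le_rfl hk.1)
  · exact hi (key b hb 0 _ le_rfl (by positivity) (by rw [zero_add]; exact hk.2))

/-- A neighbourhood of the boundary of the unit square. -/
def squareLayer (ε : ℝ) : Set Plane :=
  (rect (-(3 * ε)) 0 (-(3 * ε)) (1 + 3 * ε) ∪
    rect (1 - 3 * ε) (1 + 3 * ε) (-(3 * ε)) (1 + 3 * ε)) ∪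
  (rect (-(3 * ε)) (1 + 3 * ε) (-(3 * ε)) 0 ∪
    rect (-(3 * ε)) (1 + 3 * ε) (1 - 3 * ε) (1 + 3 * ε))

lemma isClosed_squareLayer (ε : ℝ) : IsClosed (squareLayer ε) :=
  ((isClosed_rect _ _ _ _).union (isClosed_rect _ _ _ _)).union
    ((isClosed_rect _ _ _ _).union (isClosed_rect _ _ _ _))

lemma squareLayer_subset {ε : ℝ} (hε : 0 < ε) (hε1 : ε ≤ 1 / 6) :
    squareLayer ε ⊆ rect (-(3 * ε)) (1 + 3 * ε) (-(3 * ε)) (1 + 3 * ε) := by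
  rintro z ((h | h) | (h | h))
  · exact ⟨⟨h.1.1, by linarith [h.1.2]⟩, h.2⟩
  · exact ⟨⟨by linarith [h.1.1], h.1.2⟩, h.2⟩
  · exact ⟨h.1, ⟨h.2.1, by linarith [h.2.2]⟩⟩
  · exact ⟨h.1, ⟨by linarith [h.2.1], h.2.2⟩⟩

lemma volume_real_squareLayer_le {ε : ℝ} (hε : 0 < ε) (hε1 : ε ≤ 1 / 6) :
    volume.real (squareLayer ε) ≤ 36 * ε := by
  refine (measureReal_union_le _ _).trans
    ((add_le_add (measureReal_union_le _ _) (measureReal_union_le _ _)).trans ?_)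
  rw [volume_real_rect_le (by linarith) (by linarith), volume_real_rect_le (by linarith) (by linarith),
    volume_real_rect_le (by linarith) (by linarith), volume_real_rect_le (by linarith) (by linarith)]
  nlinarith

lemma mem_Ioo_of_notMem_squareLayer {ε : ℝ} {z : Plane}
    (hz : ∀ i, z i ∈ Icc (-(3 * ε)) (1 + 3 * ε)) (h : z ∉ squareLayer ε) (i : Fin 2) :
    z i ∈ Ioo 0 (1 - 3 * ε) := by
  have h0 := hz 0
  have h1 := hz 1
  fin_cases i
  · exact ⟨lt_of_not_ge fun hc => h (Or.inl (Or.inl ⟨⟨h0.1, hc⟩, h1⟩)),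
      lt_of_not_ge fun hc => h (Or.inl (Or.inr ⟨⟨hc, h0.2⟩, h1⟩))⟩
  · exact ⟨lt_of_not_ge fun hc => h (Or.inr (Or.inl ⟨h0, ⟨h1.1, hc⟩⟩)),
      lt_of_not_ge fun hc => h (Or.inr (Or.inr ⟨h0, ⟨hc, h1.2⟩⟩))⟩

lemma integrableOn_fderiv_of_hasCompactSupport {v : ℕ → Plane → Plane} (hv : IsBoundedL2Loc v)
    (n : ℕ) {Ω : Set Plane} (hΩ : MeasurableSet Ω) {φ : Plane → ℝ} (hφ : ContDiff ℝ ∞ φ)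
    (hc : HasCompactSupport φ) : IntegrableOn (fun z => fderiv ℝ φ z (v n z)) Ω := by
  have hcont := hφ.continuous_fderiv (by simp)
  obtain ⟨c, hbound⟩ := hcont.bounded_above_of_compact_support (hc.fderiv ℝ)
  obtain ⟨R, hR⟩ := (hc.fderiv ℝ).isCompact.isBounded.subset_closedBall 0
  refine integrableOn_pairing hv n hΩ hcont.aestronglyMeasurable (fun z _ => hbound z)
    (R := R) fun z _ hz => ?_
  by_contra h
  have := hR (subset_tsupport _ h)
  rw [mem_closedBall_zero_iff] at this
  linarith

/-- The pairing with the gradient of a test function of the plane, outside the square, tends to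
zero. -/
theorem tendsto_square_pairing {K : Set Plane} (hK : IsInclusionShape K)
    {ε d : ℕ → ℝ} (hε : ∀ n, 0 < ε n) (hd : ∀ n, 0 < d n) (hε0 : Tendsto ε atTop (𝓝 0))
    {v : ℕ → Plane → Plane} (hv : IsBoundedL2Loc v)
    (hdiv : ∀ n, IsDivFreeTangent (squareFluidDomain K (ε n) (d n)) (v n))
    (h1 : !₂[(1 : ℝ), 0] ∈ frontier K) (h2 : !₂[(-1 : ℝ), 0] ∈ frontier K)
    (h3 : !₂[(0 : ℝ), 1] ∈ frontier K) (h4 : !₂[(0 : ℝ), -1] ∈ frontier K)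
    (h : Tendsto (fun n => d n / ε n) atTop (𝓝 0))
    {P : Plane → ℝ} (hP : ContDiff ℝ ∞ P) (hPc : HasCompactSupport P) :
    Tendsto (fun n => ∫ z in squareExterior, fderiv ℝ P z (v n z)) atTop (𝓝 0) := by
  obtain ⟨M, hM⟩ := exists_deriv_step_bound
  have hM0 : 0 ≤ M := (abs_nonneg _).trans (hM 0)
  obtain ⟨C, hC⟩ := (hP.continuous_fderiv (by simp)).bounded_above_of_compact_support (hPc.fderiv ℝ)
  have hC0 : 0 ≤ C := (norm_nonneg _).trans (hC 0)
  obtain ⟨D, hD, hpair⟩ := exists_setIntegral_norm_le hv 4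
  rw [Metric.tendsto_nhds]
  intro r hr
  -- `e` is fixed before `n` tends to infinity: the bound tends to a multiple of `√e`, made smaller
  -- than `r` in advance.
  have hsqrt : Tendsto (fun e : ℝ => D * (8 * C * M * √(2 * e))) (𝓝[>] 0) (𝓝 0) := by
    have hcont : Continuous fun e : ℝ => D * (8 * C * M * √(2 * e)) := by fun_prop
    have := hcont.tendsto 0
    simp only [mul_zero, Real.sqrt_zero] at this
    exact this.mono_left nhdsWithin_le_nhds
  obtain ⟨e, ⟨her, he1⟩, he⟩ := ((hsqrt.eventually_lt_const hr).and
    (nhdsWithin_le_nhds (Iic_mem_nhds one_pos)) |>.and self_mem_nhdsWithin).exists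
  replace he : 0 < e := he
  replace he1 : e ≤ 1 := he1
  obtain ⟨t, C', ht, hC', hφ⟩ := exists_square_competitor hK h1 h2 h3 h4 hM hP hPc hC he he1
  -- The width `t`, which depends on `e`, cancels in the limit: a gradient of order `1 / t` acts on
  -- gaps of area tending to at most `2 * e * t ^ 2`.
  have hbnd : Tendsto (fun n => D * ((C + C') * √(36 * ε n) +
      8 * C * M / t * √(2 * t * (e * t + d n / ε n)))) atTop (𝓝 (D * (8 * C * M * √(2 * e)))) := by
    have l1 : Tendsto (fun n => √(36 * ε n)) atTop (𝓝 0) := by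
      have := (Real.continuous_sqrt.tendsto _).comp (hε0.const_mul 36)
      rwa [mul_zero, Real.sqrt_zero] at this
    have l2 : Tendsto (fun n => √(2 * t * (e * t + d n / ε n))) atTop (𝓝 (√(2 * e) * t)) := by
      have := (Real.continuous_sqrt.tendsto _).comp ((h.const_add (e * t)).const_mul (2 * t))
      rwa [add_zero, show 2 * t * (e * t) = 2 * e * t ^ 2 by ring, Real.sqrt_mul (by positivity),
        Real.sqrt_sq ht.le] at this
    have := ((l1.const_mul (C + C')).add (l2.const_mul (8 * C * M / t))).const_mul D
    rwa [mul_zero, zero_add, show 8 * C * M / t * (√(2 * e) * t) = 8 * C * M * √(2 * e) by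
      field_simp] at this
  filter_upwards [hbnd.eventually_lt_const her, hε0.eventually_le_const (show (0 : ℝ) < 1 / 6 by norm_num),
    h.eventually_le_const one_pos] with n hn hn6 hdε
  have hεn := hε n
  have hdn := hd n
  rw [div_le_one hεn] at hdε
  obtain ⟨φ, hφs, hφc, hφb, hφout, hφin⟩ := hφ (ε n) (d n) hεn hdn hdε
  rw [dist_zero_right, Real.norm_eq_abs]
  refine lt_of_le_of_lt ?_ hn
  set F := squareFluidDomain K (ε n) (d n) with hF
  set box := rect (-(3 * ε n)) (1 + 3 * ε n) (-(3 * ε n)) (1 + 3 * ε n) with hbox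
  have hFm : MeasurableSet F := (isOpen_squareFluidDomain hK.isCompact _ _).measurableSet
  have hzero : ∫ z in F, fderiv ℝ φ z (v n z) = 0 := by
    have := hdiv n φ hφs hφc
    simpa only [inner_gradient_eq] using this
  have hball : box ⊆ Metric.ball 0 4 := fun z hz => by
    rw [mem_ball_zero_iff]
    have a0 := abs_le.2 ⟨show -(1 + 3 * ε n) ≤ z 0 by linarith [hz.1.1], hz.1.2⟩
    have a1 := abs_le.2 ⟨show -(1 + 3 * ε n) ≤ z 1 by linarith [hz.2.1], hz.2.2⟩
    exact (norm_le_abs_add_abs z).trans_lt (by linarith)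
  have key := abs_pairing_sub_le (hpair n) isOpen_squareExterior.measurableSet hFm
    (integrableOn_fderiv_of_hasCompactSupport hv n isOpen_squareExterior.measurableSet hP hPc)
    (integrableOn_fderiv_of_hasCompactSupport hv n hFm hφs hφc)
    (A := squareLayer (ε n)) (B := latticeGaps (ε n) (d n) e t ∩ box)
    (isClosed_squareLayer _).measurableSet
    ((isClosed_latticeGaps _ _ _ _).inter (isClosed_rect _ _ _ _)).measurableSet
    ((squareLayer_subset hεn hn6).trans hball) (inter_subset_right.trans hball)
    (a := C + C') (b := 8 * C * M / t) (by positivity) (by positivity) fun z => ?_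
  · rw [hzero, sub_zero] at key
    refine key.trans (mul_le_mul_of_nonneg_left (add_le_add ?_ ?_) hD)
    · exact mul_le_mul_of_nonneg_left
        (Real.sqrt_le_sqrt (volume_real_squareLayer_le hεn hn6)) (by positivity)
    · have hB := volume_real_latticeGaps_le hεn hdn he.le ht.le
      exact mul_le_mul_of_nonneg_left
        (Real.sqrt_le_sqrt ((measureReal_mono inter_subset_left hB.1).trans hB.2)) (by positivity)
  · have hBn : 0 ≤ (latticeGaps (ε n) (d n) e t ∩ box).indicator (fun _ => 8 * C * M / t) z :=
      indicator_nonneg (fun _ _ => by positivity) _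
    have hAn : 0 ≤ (squareLayer (ε n)).indicator (fun _ => C + C') z :=
      indicator_nonneg (fun _ _ => by positivity) _
    by_cases hz : ∃ i, z i ∉ Icc (-(3 * ε n)) (1 + 3 * ε n)
    · have hzΩ : z ∈ squareExterior := fun hm => by
        obtain ⟨i, hi⟩ := hz
        fin_cases i
        · exact hi (Icc_subset_Icc (by linarith) (by linarith) hm.1)
        · exact hi (Icc_subset_Icc (by linarith) (by linarith) hm.2)
      rw [indicator_of_mem hzΩ, indicator_of_mem (mem_squareFluidDomain_of_notMem hK hεn hdn hz),
        hφout z hz, sub_self, norm_zero]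
      positivity
    push Not at hz
    by_cases hzA : z ∈ squareLayer (ε n)
    · rw [indicator_of_mem hzA]
      have hle := (norm_sub_le (squareExterior.indicator (fderiv ℝ P) z)
        (F.indicator (fderiv ℝ φ) z)).trans (add_le_add
          ((norm_indicator_le_norm_self _ _).trans (hC z))
          ((norm_indicator_le_norm_self _ _).trans (hφb z)))
      linarith
    · have hin := mem_Ioo_of_notMem_squareLayer hz hzA
      have hzΩ : z ∉ squareExterior := fun hm => hm
        ⟨⟨(hin 0).1.le, by linarith [(hin 0).2]⟩, ⟨(hin 1).1.le, by linarith [(hin 1).2]⟩⟩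
      rw [indicator_of_notMem hzΩ, zero_sub, norm_neg, indicator_of_notMem hzA, zero_add]
      by_cases hzF : z ∈ F
      swap
      · rw [indicator_of_notMem hzF, norm_zero]; exact hBn
      rw [indicator_of_mem hzF]
      refine (hφin z hzF hin).trans (le_of_eq ?_)
      have hzbox : z ∈ box := ⟨hz 0, hz 1⟩
      by_cases hzB : z ∈ latticeGaps (ε n) (d n) e t
      · rw [indicator_of_mem hzB, indicator_of_mem (mem_inter hzB hzbox)]
      · rw [indicator_of_notMem hzB, indicator_of_notMem fun hm => hzB hm.1]

/-! ### Dilated obstacles and conclusion -/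

lemma dilate_apply (m : Plane) (l : ℝ) (z : Plane) (i : Fin 2) :
    dilate m l z i = m i + l * (z i - m i) := by
  simp [dilate]

/-- The preimage of `[0, 1]` under the dilation about `1 / 2` is shorter by `(1 - 1 / l) / 2` at
each end; this is the room `δ` gained around the obstacle. -/
lemma mem_Icc_of_dilate {s l : ℝ} (hl : 1 ≤ l) (h : 1 / 2 + l * (s - 1 / 2) ∈ Icc (0 : ℝ) 1) :
    s ∈ Icc ((1 - 1 / l) / 2) (1 - (1 - 1 / l) / 2) := by
  have hl0 : 0 < l := by linarith
  have h' : |l * (s - 1 / 2)| ≤ 1 / 2 := abs_le.2 ⟨by linarith [h.1], by linarith [h.2]⟩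
  rw [abs_mul, abs_of_pos hl0, ← le_div_iff₀' hl0] at h'
  have := abs_le.1 h'
  have e : 1 / 2 / l = 1 / l / 2 := by ring
  rw [e] at this
  exact ⟨by linarith [this.1], by linarith [this.2]⟩

lemma mem_unit_of_dilate {s l : ℝ} (hl : 1 ≤ l) (h : 1 / 2 + l * (s - 1 / 2) ∈ Icc (0 : ℝ) 1) :
    s ∈ Icc (0 : ℝ) 1 := by
  have := mem_Icc_of_dilate hl h
  have h1 : 1 / l ≤ 1 := (div_le_one (by linarith)).2 hl
  exact ⟨by linarith [this.1], by linarith [this.2]⟩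

/-- Non-penetration through the segment. -/
theorem tendsto_segment_test {K : Set Plane} (hK : IsInclusionShape K)
    {ε d : ℕ → ℝ} (hε : ∀ n, 0 < ε n) (hd : ∀ n, 0 < d n) (hε0 : Tendsto ε atTop (𝓝 0))
    {v : ℕ → Plane → Plane} (hv : IsBoundedL2Loc v)
    (hdiv : ∀ n, IsDivFreeTangent (segmentFluidDomain K (ε n) (d n)) (v n))
    {γ : ℝ≥0∞} (hγ : HasTangencyExponent K γ)
    (h : Tendsto (fun n => d n / ε n ^ (2 + (γ⁻¹).toReal)) atTop (𝓝 0))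
    {p : Plane → ℝ} (hp : IsTestFunction segmentExterior p) :
    Tendsto (fun n => ∫ z in segmentExterior, inner ℝ (v n z) (gradient p z)) atTop (𝓝 0) := by
  have hcoord : ∀ l z, dilate !₂[1 / 2, 0] l z 0 = 1 / 2 + l * (z 0 - 1 / 2) ∧
      dilate !₂[1 / 2, 0] l z 1 = l * z 1 := fun l z => by
    rw [dilate_apply, dilate_apply]; simp
  refine tendsto_pairing_of_dilations hv isOpen_segmentExterior (m := !₂[1 / 2, 0])
    (fun z hz l hl hm => hz ?_) hp fun l hl C R hC hR hq => ?_
  · simp only [mem_ofPred_eq, (hcoord l z).1, (hcoord l z).2] at hm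
    exact ⟨mem_unit_of_dilate hl hm.1, (mul_eq_zero.1 hm.2).resolve_left (by linarith)⟩
  · have h1 : 1 / l < 1 := (div_lt_one (by linarith)).2 hl
    refine tendsto_segment_pairing hK hε hd hε0 hv hdiv hγ h hC hR
      (δ := (1 - 1 / l) / 2) (by linarith) (hq.mono fun z hz hm => hz ?_)
    simp only [mem_ofPred_eq, (hcoord l z).1, (hcoord l z).2] at hm
    exact ⟨mem_Icc_of_dilate hl.le hm.1, (mul_eq_zero.1 hm.2).resolve_left (by linarith)⟩

/-- A function smooth off a smaller square extends from the exterior of the unit square to a test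
function of the plane. -/
lemma exists_extension_from_square {δ : ℝ} (hδ : 0 < δ) {q : Plane → ℝ} {C R : ℝ}
    (hq : IsTameOn (rect δ (1 - δ) δ (1 - δ))ᶜ q C R) :
    ∃ P : Plane → ℝ, ContDiff ℝ ∞ P ∧ HasCompactSupport P ∧ EqOn P q squareExterior := by
  set S := rect (δ / 2) (1 - δ / 2) (δ / 2) (1 - δ / 2) with hS
  set T : Set Plane := {z | z 0 ∈ Ioo (0 : ℝ) 1 ∧ z 1 ∈ Ioo (0 : ℝ) 1}ᶜ with hT
  have hTc : IsClosed T := ((isOpen_Ioo.preimage (continuous_coord 0)).inter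
    (isOpen_Ioo.preimage (continuous_coord 1))).isClosed_compl
  -- `κ` vanishes around the small square, where `q` need not be smooth, and equals `1` off the open
  -- unit square.
  obtain ⟨κ, hκ, hκ0, hκ1, -⟩ := exists_smooth_urysohn (A := S) (B := T) (isClosed_rect _ _ _ _) hTc
    (Set.disjoint_left.2 fun z hz hz' => hz'
      ⟨⟨by linarith [hz.1.1], by linarith [hz.1.2]⟩, ⟨by linarith [hz.2.1], by linarith [hz.2.2]⟩⟩)
  have hV : IsOpen (rect δ (1 - δ) δ (1 - δ))ᶜ := (isClosed_rect _ _ _ _).isOpen_compl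
  refine ⟨fun z => κ z * q z, contDiff_iff_contDiffAt.2 fun z => ?_, ?_, fun z hz => ?_⟩
  · by_cases hz : z ∈ rect δ (1 - δ) δ (1 - δ)
    · have ho : IsOpen {z : Plane | z 0 ∈ Ioo (δ / 2) (1 - δ / 2) ∧ z 1 ∈ Ioo (δ / 2) (1 - δ / 2)} :=
        (isOpen_Ioo.preimage (continuous_coord 0)).inter (isOpen_Ioo.preimage (continuous_coord 1))
      have : (fun z => κ z * q z) =ᶠ[𝓝 z] fun _ => 0 := by
        filter_upwards [ho.mem_nhds ⟨⟨by linarith [hz.1.1], by linarith [hz.1.2]⟩,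
          ⟨by linarith [hz.2.1], by linarith [hz.2.2]⟩⟩] with y hy
        rw [hκ0 y ⟨Ioo_subset_Icc_self hy.1, Ioo_subset_Icc_self hy.2⟩, zero_mul]
      exact contDiffAt_const.congr_of_eventuallyEq this
    · exact hκ.contDiffAt.mul (hq.smooth.contDiffAt (hV.mem_nhds hz))
  · refine HasCompactSupport.intro (isCompact_closedBall 0 (max R 2)) fun z hz => ?_
    rw [mem_closedBall_zero_iff, not_le, max_lt_iff] at hz
    rw [hq.zero_at_large z (fun hm => ?_) hz.1, mul_zero]
    have a0 := abs_le.2 ⟨show -1 ≤ z 0 by linarith [hm.1.1], show z 0 ≤ 1 by linarith [hm.1.2]⟩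
    have a1 := abs_le.2 ⟨show -1 ≤ z 1 by linarith [hm.2.1], show z 1 ≤ 1 by linarith [hm.2.2]⟩
    linarith [norm_le_abs_add_abs z, hz.2]
  · have hzT : z ∈ T := fun hm => hz ⟨Ioo_subset_Icc_self hm.1, Ioo_subset_Icc_self hm.2⟩
    simp only [hκ1 z hzT, one_mul]

/-- Non-penetration through the boundary of the square. -/
theorem tendsto_square_test {K : Set Plane} (hK : IsInclusionShape K)
    {ε d : ℕ → ℝ} (hε : ∀ n, 0 < ε n) (hd : ∀ n, 0 < d n) (hε0 : Tendsto ε atTop (𝓝 0))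
    {v : ℕ → Plane → Plane} (hv : IsBoundedL2Loc v)
    (hdiv : ∀ n, IsDivFreeTangent (squareFluidDomain K (ε n) (d n)) (v n))
    (h1 : !₂[(1 : ℝ), 0] ∈ frontier K) (h2 : !₂[(-1 : ℝ), 0] ∈ frontier K)
    (h3 : !₂[(0 : ℝ), 1] ∈ frontier K) (h4 : !₂[(0 : ℝ), -1] ∈ frontier K)
    (h : Tendsto (fun n => d n / ε n) atTop (𝓝 0))
    {p : Plane → ℝ} (hp : IsTestFunction squareExterior p) :
    Tendsto (fun n => ∫ z in squareExterior, inner ℝ (v n z) (gradient p z)) atTop (𝓝 0) := by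
  have hcoord : ∀ l z i, dilate !₂[1 / 2, 1 / 2] l z i = 1 / 2 + l * (z i - 1 / 2) := fun l z i => by
    rw [dilate_apply]; fin_cases i <;> simp
  refine tendsto_pairing_of_dilations hv isOpen_squareExterior (m := !₂[1 / 2, 1 / 2])
    (fun z hz l hl hm => hz ?_) hp fun l hl C R hC hR hq => ?_
  · simp only [mem_ofPred_eq, hcoord] at hm
    exact ⟨mem_unit_of_dilate hl hm.1, mem_unit_of_dilate hl hm.2⟩
  · have hl1 : 1 / l < 1 := (div_lt_one (by linarith)).2 hl
    obtain ⟨P, hP, hPc, hPq⟩ := exists_extension_from_square (δ := (1 - 1 / l) / 2) (by linarith)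
      (hq.mono fun z hz hm => hz (by
        simp only [mem_ofPred_eq, hcoord] at hm
        exact ⟨mem_Icc_of_dilate hl.le hm.1, mem_Icc_of_dilate hl.le hm.2⟩))
    refine (tendsto_square_pairing hK hε hd hε0 hv hdiv h1 h2 h3 h4 h hP hPc).congr fun n => ?_
    refine setIntegral_congr_fun isOpen_squareExterior.measurableSet fun z hz => ?_
    simp only [(hPq.eventuallyEq_of_mem (isOpen_squareExterior.mem_nhds hz)).fderiv_eq]

end PorousMedium

end

theorem proposition2p2 (K : Set PorousMedium.Plane) (hK : PorousMedium.IsInclusionShape K)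
    (ε d : ℕ → ℝ) (hε : ∀ n, 0 < ε n) (hd : ∀ n, 0 < d n) (hε0 : Tendsto ε atTop (𝓝 0))
    (v : ℕ → PorousMedium.Plane → PorousMedium.Plane) (hv : PorousMedium.IsBoundedL2Loc v) :
    -- inclusions distributed along the unit segment
    ((∀ n, PorousMedium.IsDivFreeTangent
        (PorousMedium.segmentFluidDomain K (ε n) (d n)) (v n)) →
      ∀ γ : ℝ≥0∞, PorousMedium.HasTangencyExponent K γ →
      Tendsto (fun n => d n / ε n ^ (2 + (γ⁻¹).toReal)) atTop (𝓝 0) →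
      ∀ p : PorousMedium.Plane → ℝ,
        PorousMedium.IsTestFunction PorousMedium.segmentExterior p →
        Tendsto (fun n => ∫ x in PorousMedium.segmentExterior, inner ℝ (v n x) (gradient p x))
          atTop (𝓝 0)) ∧
    -- inclusions distributed over the unit square
    ((∀ n, PorousMedium.IsDivFreeTangent
        (PorousMedium.squareFluidDomain K (ε n) (d n)) (v n)) →
      !₂[(1 : ℝ), 0] ∈ frontier K → !₂[(-1 : ℝ), 0] ∈ frontier K →
      !₂[(0 : ℝ), 1] ∈ frontier K → !₂[(0 : ℝ), -1] ∈ frontier K →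
      Tendsto (fun n => d n / ε n) atTop (𝓝 0) →
      ∀ p : PorousMedium.Plane → ℝ,
        PorousMedium.IsTestFunction PorousMedium.squareExterior p →
        Tendsto (fun n => ∫ x in PorousMedium.squareExterior, inner ℝ (v n x) (gradient p x))
          atTop (𝓝 0)) :=
  ⟨fun hdiv _ hγ h _ hp => PorousMedium.tendsto_segment_test hK hε hd hε0 hv hdiv hγ h hp,
    fun hdiv h1 h2 h3 h4 h _ hp =>
      PorousMedium.tendsto_square_test hK hε hd hε0 hv hdiv h1 h2 h3 h4 h hp⟩
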